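/- **Setting.** Let $\mathsf S\subset\mathbb R^{d}$ be a Borel set with Euclidean distance and Lebesgue measure $\lambda$, and let $\mathsf A$ be a compact metric space with metric $\rho_{\mathsf A}$ (for instance a compact subset of $\mathbb R^{d_{\mathsf A}}$). Consider a Markov decision process with horizon $H$, transition kernels $P_h(\cdot|x,a)$ on $\mathsf S$ with jointly measurable densities $p_h^a(y|x)$ with respect to $\lambda$ ($1\le h\le H$), measurable running rewards $R_h:\mathsf S\times\mathsf A\to\mathbb R$ ($0\le h<H$) and a measurable terminal reward $F:\mathsf S\to\mathbb R$, where $|R_h|\le G$ and $|F|\le G$. Let $\Pi$ be the set of randomized policies $\boldsymbol\pi=(\pi_0,\dots,\pi_{H-1})$ with measurable $\pi_t:\mathsf S\to\mathcal P(\mathsf A)$. Under $\mathbb P_{\boldsymbol\pi}$ the chain satisfies $S_0=x_0$, $A_t\sim\pi_t(S_t)$, $S_{t+1}\sim P_{t+1}(\cdot|S_t,A_t)$. Put $$V_0^\star(x_0)=\sup_{\boldsymbol\pi\in\Pi}\mathbb E_{\boldsymbol\pi}\Big[\sum_{t=0}^{H-1}R_t(S_t,A_t)+F(S_H)\Big].$$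 **Local density bounds.** Let $\mathcal D\subset\mathsf S$ be compact with $\lambda(\mathcal D)>0$. Suppose there are constants $\delta_{\mathcal D},\Lambda_{\mathcal D},L_{\mathcal D}>0$ and a measurable $\mathcal L_{\mathcal D}:\mathsf S\to\mathbb R_+$ such that, for all $1\le h\le H$, $a,a_1,a_2\in\mathsf A$, $x,z,x_1,x_2\in\mathcal D$ and $y\in\mathsf S$, $$\delta_{\mathcal D}\le p_h^a(z|x)\le\Lambda_{\mathcal D},\qquad |p_h^{a_1}(y|x_1)-p_h^{a_2}(y|x_2)|\le\mathcal L_{\mathcal D}(y)\big(|x_1-x_2|+\rho_{\mathsf A}(a_1,a_2)\big),$$ $$\|\mathcal L_{\mathcal D}\|_{L^\infty(\mathcal D)}+\frac1{\lambda(\mathcal D)}\|\mathcal L_{\mathcal D}\|_{L^1(\mathsf S\setminus\mathcal D)}\le L_{\mathcal D}.$$ **Reflected chain.** From $x\in\mathcal D$ under action $a$ at step $h$, draw $Y\sim P_h(\cdot|x,a)$ and, independently, $Q$ uniformly on $\mathcal D$; move to $Y$ if $Y\in\mathcal D$ and to $Q$ otherwise. Its transition densities on $\mathcal D$ are $$p_h^{a,\mathcal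 D}(y|x)=p_h^a(y|x)+\frac1{\lambda(\mathcal D)}\int_{\mathsf S\setminus\mathcal D}p_h^a(z|x)\,dz .$$ **Algorithm.** Fix $x_0\in\mathcal D$ and controls $b_0,\dots,b_{H-1}\in\mathsf A$. Simulate $N$ independent copies $(S_h^{(n)})_{0\le h\le H}$, $n=1,\dots,N$, of the reflected chain under these controls, all started in $x_0$. Put $\overline V_H^{\mathcal D}=F$ and, for $h=H-1,\dots,0$, $$\overline V_h^{\mathcal D}(x)=\sup_{a\in\mathsf A}\Big(R_h(x,a)+\sum_{n=1}^N\overline V_{h+1}^{\mathcal D}(S_{h+1}^{(n)})\,w_{h,n}(x,a)\Big)\quad\text{for } x=S_h^{(1)},\dots,S_h^{(N)},$$ $$w_{h,n}(x,a)=\frac{r_n}{\sum_{n'=1}^N r_{n'}},\qquad r_n=\frac{p_{h+1}^{a,\mathcal D}(S_{h+1}^{(n)}|x)}{\sum_{k\ne n}p_{h+1}^{b_h,\mathcal D}(S_{h+1}^{(n)}|S_h^{(k)})}\qquad(0/0=0).$$ The output is $\overline V_0^{\mathcal D}(x_0)$. **Theorem.** There are an absolute constant $C$ and an absolute $N_0$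 such that in this setting, for all $N>N_0$, the random variable $|\overline V_0^{\mathcal D}(x_0)-V_0^\star(x_0)|$ is integrable and $$\mathbb E\big[|\overline V_0^{\mathcal D}(x_0)-V_0^\star(x_0)|\big]\le C\left[\frac{H^2G}{\sqrt N}\left(\frac{L_{\mathcal D}\,\mathrm{DI}(\mathcal D\times\mathsf A)+L_{\mathcal D}\,\mathrm{diam}(\mathcal D)\,\mathrm{diam}(\mathsf A)+\Lambda_{\mathcal D}}{\delta_{\mathcal D}}+\frac{\Lambda_{\mathcal D}^2}{\delta_{\mathcal D}^2}\right)+HG\sum_{l=0}^{H}\sup_{\boldsymbol\pi\in\Pi}\mathbb P_{\boldsymbol\pi}(S_l\notin\mathcal D)\right].$$ Here $\mathrm{DI}(\mathsf X)=\int_0^{\mathrm{diam}(\mathsf X)}\sqrt{\log\mathcal N(\mathsf X,u)}\,du\in[0,\infty]$ is the Dudley integral, $\mathcal N(\mathsf X,u)$ is the least number of balls of radius $u$ covering $\mathsf X$, and $\mathcal D\times\mathsf A$ carries the maximum metric. -/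

import Mathlib

open MeasureTheory ProbabilityTheory Set
open scoped ENNReal NNReal

/- A subset of `ℝ^d` carries the restriction of Lebesgue measure as its reference measure. -/
attribute [instance] MeasureTheory.Measure.Subtype.measureSpace

namespace StochasticMesh

/-! ### Finite horizon Markov decision processes -/

/-- A finite horizon Markov decision process with state space `S` and action space `A`:
horizon `H`, transition functions `P h` (used for `1 ≤ h ≤ H`), running rewards `R h`
(used for `0 ≤ h < H`) and terminal reward `F`. -/
structure MDP (S A : Type*) [MeasurableSpace S] [MeasurableSpace A] where
  H : ℕ
  P : ℕ → Kernel (S × A) S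
  markov : ∀ h, IsMarkovKernel (P h)
  R : ℕ → S → A → ℝ
  measurable_R : ∀ h, Measurable (Function.uncurry (R h))
  F : S → ℝ
  measurable_F : Measurable F

/-- Policies: sequences of measurable maps from states to probability measures on actions
(only the maps at times `0, …, H - 1` matter). -/
structure Policy (S A : Type*) [MeasurableSpace S] [MeasurableSpace A] where
  π : ℕ → Kernel S A
  markov : ∀ t, IsMarkovKernel (π t)

attribute [instance] MDP.markov Policy.markov

/-- The policy that applies the deterministic controls `b 0, b 1, …` whatever the state is. -/
noncomputable def Policy.const {S A : Type*} [MeasurableSpace S] [MeasurableSpace A]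
    (b : ℕ → A) : Policy S A where
  π t := Kernel.const S (Measure.dirac (b t))
  markov _ := inferInstance

namespace MDP

section General

variable {S A : Type*} [MeasurableSpace S] [MeasurableSpace A]

/-- One step of the controlled chain: given the history up to time `n`, with last pair
`(Sₙ, Aₙ)`, draw `Sₙ₊₁ ∼ Pₙ₊₁(· | Sₙ, Aₙ)` and then `Aₙ₊₁ ∼ πₙ₊₁(Sₙ₊₁)`. -/
noncomputable def step (M : MDP S A) (π : Policy S A) (n : ℕ) :
    Kernel ((_ : Finset.Iic n) → S × A) (S × A) :=
  (M.P (n + 1) ⊗ₖ (π.π (n + 1)).prodMkLeft (S × A)).comap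
    (fun hist ↦ hist ⟨n, Finset.mem_Iic.2 le_rfl⟩) (measurable_pi_apply _)

instance (M : MDP S A) (π : Policy S A) (n : ℕ) : IsMarkovKernel (M.step π n) := by
  unfold step; infer_instance

/-- The law of the controlled process `(S_t, A_t)_{t ≥ 0}` under the policy `π`, started in
`S₀ = x`. Only the times `t ≤ H` are relevant. -/
noncomputable def pathLaw (M : MDP S A) (π : Policy S A) (x : S) : Measure (ℕ → S × A) :=
  Kernel.trajMeasure (X := fun _ ↦ S × A) (Measure.dirac x ⊗ₘ π.π 0) (M.step π)

/-- The expected reward `E_{π,x}[∑_{t<H} R_t(S_t, A_t) + F(S_H)]` of a policy. -/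
noncomputable def policyValue (M : MDP S A) (π : Policy S A) (x : S) : ℝ :=
  ∫ w, ((∑ t ∈ Finset.range M.H, M.R t (w t).1 (w t).2) + M.F (w M.H).1) ∂(M.pathLaw π x)

/-- The maximal expected reward `V₀*(x)`. -/
noncomputable def optValue (M : MDP S A) (x : S) : ℝ :=
  ⨆ π : Policy S A, M.policyValue π x

/-- `q h a y x`, read `q_h^a(y | x)`, is a jointly measurable version of the transition densities
of `M` with respect to the reference measure of the state space. -/
structure HasDensity {S A : Type*} [MeasureSpace S] [MeasurableSpace A]
    (M : MDP S A) (q : ℕ → A → S → S → ℝ) : Prop where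
  measurable : ∀ h ∈ Finset.Icc 1 M.H, Measurable fun z : A × S × S ↦ q h z.1 z.2.1 z.2.2
  nonneg : ∀ h ∈ Finset.Icc 1 M.H, ∀ a y x, 0 ≤ q h a y x
  eq_withDensity : ∀ h ∈ Finset.Icc 1 M.H, ∀ x a,
    M.P h (x, a) = volume.withDensity fun y ↦ ENNReal.ofReal (q h a y x)

/-! ### The weighted stochastic mesh algorithm -/

/-- `X n t`, for `n < N` and `t ≤ H`, are `N` independent copies of the state process of `M` run
with the controls `b 0, …, b (H - 1)` and started in `x`. -/
structure IsMesh (M : MDP S A) (b : ℕ → A) (x : S) {Ω : Type*} [MeasurableSpace Ω]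
    (Pr : Measure Ω) {N : ℕ} (X : Fin N → ℕ → Ω → S) : Prop where
  measurable : ∀ n, ∀ t ≤ M.H, Measurable (X n t)
  law : ∀ n, Pr.map (fun ω (t : Fin (M.H + 1)) ↦ X n t ω) =
    (M.pathLaw (Policy.const b) x).map (fun w (t : Fin (M.H + 1)) ↦ (w t).1)
  indep : iIndepFun (fun n ω (t : Fin (M.H + 1)) ↦ X n t ω) Pr

/-- The weight `w_{h,n,N}(x, a)` of the mesh `s`, where `s n t` is the position of the `n`-th
chain at time `t`. (Lean's convention `0 / 0 = 0` is the one intended.) -/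
noncomputable def weight {S A : Type*} (q : ℕ → A → S → S → ℝ) (b : ℕ → A) {N : ℕ}
    (s : Fin N → ℕ → S) (h : ℕ) (n : Fin N) (x : S) (a : A) : ℝ :=
  (q (h + 1) a (s n (h + 1)) x /
      ∑ k ∈ Finset.univ.erase n, q (h + 1) (b h) (s n (h + 1)) (s k h)) /
    ∑ n' : Fin N, q (h + 1) a (s n' (h + 1)) x /
      ∑ k' ∈ Finset.univ.erase n', q (h + 1) (b h) (s n' (h + 1)) (s k' h)

/-- The backward recursion on the mesh `s`: `meshStage q b s j` is the approximate value function
at time `H - j`. It is evaluated only in the mesh points of that time. -/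
noncomputable def meshStage (M : MDP S A) (q : ℕ → A → S → S → ℝ) (b : ℕ → A) {N : ℕ}
    (s : Fin N → ℕ → S) : ℕ → S → ℝ
  | 0 => M.F
  | j + 1 => fun x ↦ ⨆ a : A, (M.R (M.H - (j + 1)) x a +
      ∑ n, M.meshStage q b s j (s n (M.H - (j + 1) + 1)) * weight q b s (M.H - (j + 1)) n x a)

/-- The output of the algorithm: the approximate value at time `0`. -/
noncomputable def meshValue (M : MDP S A) (q : ℕ → A → S → S → ℝ) (b : ℕ → A) {N : ℕ}
    (s : Fin N → ℕ → S) (x : S) : ℝ :=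
  M.meshStage q b s M.H x

end General

end MDP

/-! ### Reflection in a compact set -/

section Reflection

variable {d : ℕ} {S : Set (EuclideanSpace ℝ (Fin d))} {A : Type*} [MeasurableSpace A]

theorem volume_ne_top (hS : MeasurableSet S) {D : Set S} (hD : IsCompact D) :
    volume D ≠ ⊤ := by
  rw [Measure.Subtype.volume_def, (MeasurableEmbedding.subtype_coe hS).comap_apply]
  exact (hD.image continuous_subtype_val).measure_lt_top.ne

/-- The uniform distribution on `D`. -/
noncomputable def unif (D : Set S) : Measure D :=
  (volume D)⁻¹ • volume

theorem isProbabilityMeasure_unif (hS : MeasurableSet S) {D : Set S} (hD : IsCompact D)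
    (h0 : 0 < volume D) : IsProbabilityMeasure (unif D) := by
  constructor
  have h : (volume : Measure D) univ = volume D := by
    rw [Measure.Subtype.volume_def,
      (MeasurableEmbedding.subtype_coe hD.isClosed.measurableSet).comap_apply]
    simp
  rw [unif, Measure.smul_apply, h, smul_eq_mul,
    ENNReal.inv_mul_cancel h0.ne' (volume_ne_top hS hD)]

open Classical in
/-- The reflection rule: keep `y` if it lies in `D`, and replace it by `z ∈ D` otherwise. -/
noncomputable def reflectPoint (D : Set S) (u : S × D) : D :=
  if h : u.1 ∈ D then ⟨u.1, h⟩ else u.2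

theorem measurable_reflectPoint {D : Set S} (hD : MeasurableSet D) :
    Measurable (reflectPoint D) := by
  classical
  unfold reflectPoint
  refine Measurable.dite (s := {u : S × D | u.1 ∈ D}) (f := fun u ↦ ⟨u.1.1, u.2⟩)
    (g := fun u ↦ u.1.2) ?_ ?_ (measurable_fst hD)
  · exact (measurable_fst.comp measurable_subtype_coe).subtype_mk
  · exact measurable_snd.comp measurable_subtype_coe

/-- The transition function of the reflected chain: draw `Y ∼ P(· | x, a)` and, independently,
`Q` uniformly on `D`, and move to `Y` if `Y ∈ D` and to `Q` otherwise. -/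
noncomputable def reflectKernel (D : Set S) (P : Kernel (S × A) S) : Kernel (D × A) D :=
  ((P.comap (fun z : D × A ↦ ((z.1 : S), z.2)) (by fun_prop)) ×ₖ
    Kernel.const (D × A) (unif D)).map (reflectPoint D)

/-- The Markov decision process in the compact domain `D`, driven by the reflected chain. -/
noncomputable def MDP.reflect (M : MDP S A) (hS : MeasurableSet S) {D : Set S}
    (hD : IsCompact D) (h0 : 0 < volume D) : MDP D A where
  H := M.H
  P h := reflectKernel D (M.P h)
  markov h := by
    have := isProbabilityMeasure_unif hS hD h0
    exact Kernel.IsMarkovKernel.map _ (measurable_reflectPoint hD.isClosed.measurableSet)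
  R h x a := M.R h x a
  measurable_R h := (M.measurable_R h).comp
    (f := fun z : D × A ↦ ((z.1 : S), z.2)) (by fun_prop)
  F x := M.F x
  measurable_F := M.measurable_F.comp measurable_subtype_coe

/-- The transition densities of the reflected chain,
`p_h^{a,D}(y|x) = p_h^a(y|x) + λ(D)⁻¹ ∫_{S∖D} p_h^a(z|x) dz` for `x, y ∈ D`. -/
noncomputable def reflectDensity (D : Set S) (p : ℕ → A → S → S → ℝ) :
    ℕ → A → D → D → ℝ :=
  fun h a y x ↦ p h a y x + (volume.real D)⁻¹ * ∫ z in Dᶜ, p h a z x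

/-! ### Local density bounds and the Dudley integral -/

/-- The bounds `δ`, `Λ`, `L` on the densities `p_h^a(y|x)`, `1 ≤ h ≤ H`, that are local to `D`. -/
structure LocalDensityBounds {A : Type*} [PseudoMetricSpace A] (p : ℕ → A → S → S → ℝ) (H : ℕ)
    (D : Set S) (δ Λ L : ℝ≥0) : Prop where
  δ_pos : 0 < δ
  Λ_pos : 0 < Λ
  L_pos : 0 < L
  bounds : ∀ h ∈ Finset.Icc 1 H, ∀ a, ∀ x ∈ D, ∀ z ∈ D, δ ≤ p h a z x ∧ p h a z x ≤ Λ
  lipschitz : ∃ ℒ : S → ℝ, Measurable ℒ ∧ (∀ y, 0 ≤ ℒ y) ∧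
    (∀ h ∈ Finset.Icc 1 H, ∀ a₁ a₂, ∀ x₁ ∈ D, ∀ x₂ ∈ D, ∀ y,
      |p h a₁ y x₁ - p h a₂ y x₂| ≤ ℒ y * (dist x₁ x₂ + dist a₁ a₂)) ∧
    eLpNorm ℒ ∞ (volume.restrict D) +
      (volume D)⁻¹ * eLpNorm ℒ 1 (volume.restrict Dᶜ) ≤ L

end Reflection

/-- The Dudley integral `∫_0^{diam X} √(log N(X, ρ, u)) du`, where `N(X, ρ, u)` is the least number
of balls of radius `u` that cover `X`. It takes the value `∞` if the integral diverges. -/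
noncomputable def dudleyIntegral {Y : Type*} [PseudoMetricSpace Y] (X : Set Y) : ℝ≥0∞ :=
  ∫⁻ u in {u : ℝ | 0 < u ∧ ENNReal.ofReal u ≤ Metric.ediam X},
    (ENNReal.log (Metric.externalCoveringNumber u.toNNReal X : ℝ≥0∞)).toENNReal ^ (1 / 2 : ℝ)

end StochasticMesh

/-!
The error is split at the optimal value of the reflected process,
`|V̄₀ - V₀*| ≤ |V̄₀ - V₀ᴰ| + |V₀ᴰ - V₀*|`, where `V₀ᴰ` is computed by dynamic programming with the
reflected densities (`MDP.optStage`).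

**Truncation.** Along the original chain, `V_hᴰ` (extended by zero off `D`) satisfies the Bellman
inequality up to the mass that leaves `D` in the next step: integrating it against the reflected
density or against the original transition function makes a difference of the order
`H G P(Y ∉ D)`. Summation along the chain compares the value of every policy with `V₀ᴰ`; for the
converse inequality one needs a policy that nearly attains the suprema in the recursion of `V_hᴰ`.
The result is `abs_optStage_sub_optValue_le`. No continuity of the rewards is assumed, so suprema
over the actions are only universally measurable, and the near-optimal policy comes from a selection
theorem that holds almost everywhere. Both facts rest on the universal measurability of analytic
sets (`aemeasurable_iSup_of_measurable`, `exists_measurable_selection`). Almost everywhere suffices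
since the laws of the chain after time zero are absolutely continuous; the starting point is treated
separately.

**Statistical error.** One step of the mesh estimates `∫ f(y) p(y | x, a) dy`, with `f` the next
value function of the reflected process, by a self-normalized importance sampling estimator. If the
mixture in the denominator contained the own starting point of each sample point, then,
conditionally on all the starting points, the unnormalized estimator would be an unbiased sum of
independent terms of the order `‖f‖ Λ / (δ N)`, with increments in `(x, a)` controlled by the
Lipschitz constant. Hence its error would be a subgaussian process on `D × A`, and chaining bounds
the supremum of such a process by the Dudley integral
(`lintegral_iSup_le_dudleyIntegral`, `DensityFamily.exists_majorant_mixtureEstimator`). Leaving out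
the own starting point costs `O(1 / N)`, and the normalization costs the error of the same estimator
with `f = 1` (`DensityFamily.exists_majorant_selfNormalized`). These bounds are uniform in `(x, a)`,
and the weights are nonnegative with sum at most one, so the errors of the `H` steps simply add up
(`MDP.IsMesh.lintegral_abs_meshValue_sub_le`). Each of them is of order `H G / √N`, which explains
the factor `H ^ 2`.

Reflection preserves the form of the local bounds: the reflected densities are Lipschitz with
constant `L` for almost every end point (`ae_reflectDensity_sub_le`), and the ratio of their bounds
is at most `3 Λ / δ` (`exists_reflectDensity_mem_Icc`).
-/

namespace StochasticMesh

/-! ### Analytic sets, suprema of Borel functions, and almost everywhere selection -/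

section Analytic

open Filter Topology

variable {X : Type*} [TopologicalSpace X] [PolishSpace X] [MeasurableSpace X] [BorelSpace X]

/-- Half of Choquet's capacitability theorem: the continuous image of the Baire space is
approximated from inside, in measure, by the images of the compact boxes `{σ | σ ≤ n}`. -/
theorem exists_isCompact_subset_range {f : (ℕ → ℕ) → X} (hf : Continuous f) (μ : Measure X)
    [IsFiniteMeasure μ] {c : ℝ≥0∞} (hc : c < μ (range f)) :
    ∃ K ⊆ range f, IsCompact K ∧ c ≤ μ K := by
  have step : ∀ (E : Set (ℕ → ℕ)) (k : ℕ), c < μ (f '' E) →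
      ∃ m, c < μ (f '' (E ∩ {σ | σ k ≤ m})) := by
    intro E k hE
    have hmono : Monotone fun m ↦ f '' (E ∩ {σ : ℕ → ℕ | σ k ≤ m}) := fun m m' hm ↦
      image_mono (inter_subset_inter_right _ fun σ (hσ : σ k ≤ m) ↦ hσ.trans hm)
    have hun : f '' E = ⋃ m, f '' (E ∩ {σ : ℕ → ℕ | σ k ≤ m}) := by
      rw [← image_iUnion, ← inter_iUnion]
      congr 1
      exact (inter_eq_left.2 fun σ _ ↦ mem_iUnion.2 ⟨σ k, le_refl (σ k)⟩).symm
    rw [hun, hmono.measure_iUnion] at hE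
    exact lt_iSup_iff.1 hE
  choose! m hm using step
  let E : ℕ → Set (ℕ → ℕ) := fun k ↦
    Nat.rec univ (fun k E ↦ E ∩ {σ | σ k ≤ m E k}) k
  have hE : ∀ k, c < μ (f '' E k) := by
    intro k
    induction k with
    | zero => simpa [E] using hc
    | succ k ih => exact hm _ _ ih
  let n : ℕ → ℕ := fun k ↦ m (E k) k
  have hEn : ∀ k, ∀ σ ∈ E k, ∀ i < k, σ i ≤ n i := by
    intro k
    induction k with
    | zero => intro σ _ i hi; omega
    | succ k ih =>
      intro σ hσ i hi
      rcases Nat.lt_succ_iff_lt_or_eq.1 hi with h | rfl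
      · exact ih σ hσ.1 i h
      · exact hσ.2
  have hKc : IsCompact (univ.pi fun i ↦ Set.Iic (n i)) :=
    isCompact_univ_pi fun i ↦ (finite_Iic (n i)).isCompact
  refine ⟨f '' univ.pi fun i ↦ Set.Iic (n i), image_subset_range _ _, hKc.image hf, ?_⟩
  let := TopologicalSpace.upgradeIsCompletelyMetrizable X
  rw [Set.measure_eq_iInf_isOpen]
  refine le_iInf₂ fun U hU ↦ le_iInf fun hUo ↦ ?_
  -- an open set around the image of the box contains some `f '' E k`
  suffices ∃ k, f '' E k ⊆ U by
    obtain ⟨k, hk⟩ := this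
    exact (hE k).le.trans (measure_mono hk)
  by_contra! hcon
  have : ∀ k, ∃ σ ∈ E k, f σ ∉ U := by
    intro k
    obtain ⟨_, ⟨σ, hσ, rfl⟩, h⟩ := not_subset.1 (hcon k)
    exact ⟨σ, hσ, h⟩
  choose σ hσE hσU using this
  obtain ⟨τ, hτ, φ, hφ, hlim⟩ := hKc.tendsto_subseq (x := fun k i ↦ min (σ k i) (n i))
    fun k i _ ↦ mem_Iic.2 (min_le_right _ _)
  have hlim' : Tendsto (fun k ↦ σ (φ k)) atTop (𝓝 τ) := by
    rw [tendsto_pi_nhds] at hlim ⊢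
    intro i
    refine (hlim i).congr' ?_
    filter_upwards [eventually_gt_atTop i] with k hk
    exact min_eq_left (hEn _ _ (hσE (φ k)) i (hk.trans_le (hφ.id_le k)))
  exact (hUo.isClosed_compl.mem_of_tendsto ((hf.tendsto τ).comp hlim')
    (Eventually.of_forall fun k ↦ hσU (φ k))) (hU ⟨τ, hτ, rfl⟩)

/-- Analytic sets are universally measurable. -/
theorem nullMeasurableSet_of_analyticSet {s : Set X} (hs : AnalyticSet s) (μ : Measure X)
    [IsFiniteMeasure μ] : NullMeasurableSet s μ := by
  rw [AnalyticSet] at hs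
  rcases hs with rfl | ⟨f, hf, rfl⟩
  · exact nullMeasurableSet_empty
  rcases eq_or_ne (μ (range f)) 0 with h0 | h0
  · exact NullMeasurableSet.of_null h0
  obtain ⟨u, -, hu, hlim⟩ := exists_seq_strictMono_tendsto' (pos_iff_ne_zero.2 h0)
  choose K hKs hK hKu using fun n ↦ exists_isCompact_subset_range hf μ (hu n).2
  have hKm : MeasurableSet (⋃ n, K n) := MeasurableSet.iUnion fun n ↦ (hK n).measurableSet
  refine NullMeasurableSet.congr hKm.nullMeasurableSet
    (ae_eq_of_subset_of_measure_ge (iUnion_subset hKs) ?_ hKm.nullMeasurableSet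
      (measure_ne_top _ _))
  exact le_of_tendsto' hlim fun n ↦ (hKu n).trans (measure_mono (subset_iUnion K n))

end Analytic

section Supremum

variable {X A : Type*} [MeasurableSpace X] [StandardBorelSpace X] [MeasurableSpace A]
  [StandardBorelSpace A]

/-- The projection of a Borel set is universally measurable. -/
theorem nullMeasurableSet_image_fst {B : Set (X × A)} (hB : MeasurableSet B) (μ : Measure X)
    [IsFiniteMeasure μ] : NullMeasurableSet (Prod.fst '' B) μ := by
  let := upgradeStandardBorel X
  exact nullMeasurableSet_of_analyticSet (hB.analyticSet_image measurable_fst) μ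

/-- A partial supremum of a Borel function need not be Borel measurable, but it is universally
measurable. -/
theorem aemeasurable_iSup_of_measurable [Nonempty A] {g : X → A → ℝ}
    (hg : Measurable (Function.uncurry g)) (hb : ∀ x, BddAbove (range (g x))) (μ : Measure X)
    [IsFiniteMeasure μ] : AEMeasurable (fun x ↦ ⨆ a, g x a) μ := by
  refine NullMeasurable.aemeasurable ?_
  refine measurable_of_Ioi (δ := NullMeasurableSpace X μ) fun c ↦ ?_
  have : (fun x ↦ ⨆ a, g x a) ⁻¹' Ioi c = Prod.fst '' {z : X × A | c < Function.uncurry g z} := by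
    ext x
    simp [lt_ciSup_iff (hb x)]
  have h := nullMeasurableSet_image_fst (B := {z : X × A | c < Function.uncurry g z})
    (measurableSet_lt measurable_const hg) μ
  exact this ▸ h

end Supremum

section Selection

open Filter Topology

variable {X A : Type*} [MeasurableSpace X] [StandardBorelSpace X] [MeasurableSpace A]
  [StandardBorelSpace A]

/-- Almost everywhere measurable selection (Jankov, von Neumann). Parametrize `B` by the
Baire space and select in each fibre the lexicographically least parameter; its finite prefixes are
determined by the analytic sets `C l` of all points that have a parameter with prefix `l`. -/
theorem exists_measurable_selection [Nonempty A] {B : Set (X × A)} (hB : MeasurableSet B)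
    (μ : Measure X) [IsFiniteMeasure μ] :
    ∃ α : X → A, Measurable α ∧ ∀ᵐ x ∂μ, (∃ a, (x, a) ∈ B) → (x, α x) ∈ B := by
  let := upgradeStandardBorel X
  let := upgradeStandardBorel A
  have hBa := hB.analyticSet
  rw [AnalyticSet] at hBa
  rcases hBa with rfl | ⟨f, hf, rfl⟩
  · exact ⟨fun _ ↦ Classical.arbitrary A, measurable_const, by simp⟩
  let φ : (ℕ → ℕ) → X := fun τ ↦ (f τ).1
  have hφ : Continuous φ := continuous_fst.comp hf
  let Z : List ℕ → Set (ℕ → ℕ) := fun l ↦ {τ | (List.range l.length).map τ = l}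
  have hZ : ∀ l, MeasurableSet (Z l) := by
    have hgen : ∀ L l : List ℕ, MeasurableSet {τ : ℕ → ℕ | L.map τ = l} := by
      intro L
      induction L with
      | nil => intro l; simp
      | cons a L ih =>
        intro l
        cases l with
        | nil => simp
        | cons b l =>
          simp only [List.map_cons, List.cons.injEq]
          exact (measurable_pi_apply a (measurableSet_singleton b)).inter (ih l)
    exact fun l ↦ hgen _ l
  let C : List ℕ → Set X := fun l ↦ φ '' Z l
  have hC : ∀ l, NullMeasurableSet (C l) μ := fun l ↦
    nullMeasurableSet_of_analyticSet ((hZ l).analyticSet.image_of_continuous hφ) μ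
  have hCnil : ∀ x, (∃ a, (x, a) ∈ range f) → x ∈ C [] := by
    rintro x ⟨a, τ, hτ⟩
    exact ⟨τ, by simp [Z], by simp [φ, hτ]⟩
  have hCsucc : ∀ l x, x ∈ C l → ∃ m, x ∈ C (l ++ [m]) := by
    rintro l x ⟨τ, hτ, rfl⟩
    refine ⟨τ l.length, τ, ?_, rfl⟩
    simp only [Z, mem_ofPred_eq, List.length_append, List.length_singleton, List.range_succ,
      List.map_append, List.map_singleton] at hτ ⊢
    rw [hτ]
  choose C' hC'm hC' using fun l ↦ (hC l).exists_measurable_superset_ae_eq |> fun ⟨t, _, h⟩ ↦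
    (⟨t, h⟩ : ∃ t, MeasurableSet t ∧ t =ᵐ[μ] C l)
  let nxt : List ℕ → X → ℕ := fun l x ↦ sInf {m | x ∈ C' (l ++ [m])}
  have hnxt : ∀ l, Measurable (nxt l) := by
    intro l
    refine measurable_of_Iic fun k ↦ ?_
    have : nxt l ⁻¹' Iic k = (⋂ m, (C' (l ++ [m]))ᶜ) ∪ ⋃ j ∈ Iic k, C' (l ++ [j]) := by
      ext x
      simp only [nxt, mem_preimage, mem_Iic, mem_union, mem_iInter, mem_compl_iff, mem_iUnion,
        exists_prop]
      constructor
      · intro h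
        by_cases hne : ∃ m, x ∈ C' (l ++ [m])
        · exact Or.inr ⟨_, h, Nat.sInf_mem hne⟩
        · exact Or.inl (not_exists.1 hne)
      · rintro (h | ⟨j, hj, hx⟩)
        · have : {m | x ∈ C' (l ++ [m])} = ∅ := eq_empty_of_forall_notMem h
          simp [this]
        · exact (Nat.sInf_le hx).trans hj
    rw [this]
    exact (MeasurableSet.iInter fun m ↦ (hC'm _).compl).union
      (MeasurableSet.biUnion (to_countable _) fun j _ ↦ hC'm _)
  let pre : ℕ → X → List ℕ := fun k x ↦ Nat.rec [] (fun _ l ↦ l ++ [nxt l x]) k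
  let σ : X → ℕ → ℕ := fun x k ↦ nxt (pre k x) x
  let : MeasurableSpace (List ℕ) := ⊤
  have hpre : ∀ k, Measurable (pre k) := by
    intro k
    induction k with
    | zero => exact measurable_const
    | succ k ih =>
      have h1 : Measurable fun z : List ℕ × X ↦ z.1 ++ [nxt z.1 z.2] := by
        refine measurable_from_prod_countable_right fun l ↦ ?_
        exact (measurable_from_top (f := fun n : ℕ ↦ l ++ [n])).comp (hnxt l)
      exact h1.comp (ih.prodMk measurable_id)
  have hσ : Measurable σ := by
    refine measurable_pi_iff.2 fun k ↦ ?_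
    have h1 : Measurable fun z : List ℕ × X ↦ nxt z.1 z.2 :=
      measurable_from_prod_countable_right hnxt
    exact h1.comp ((hpre k).prodMk measurable_id)
  have hpreσ : ∀ k x, pre k x = (List.range k).map (σ x) := by
    intro k x
    induction k with
    | zero => rfl
    | succ k ih =>
      rw [List.range_succ, List.map_append, ← ih]
      rfl
  refine ⟨fun x ↦ (f (σ x)).2, measurable_snd.comp (hf.measurable.comp hσ), ?_⟩
  filter_upwards [ae_all_iff.2 fun l ↦ (hC' l).mem_iff] with x hx hex
  have hmem : ∀ k, x ∈ C (pre k x) := by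
    intro k
    induction k with
    | zero => exact hCnil x hex
    | succ k ih =>
      obtain ⟨m, hm⟩ := hCsucc _ x ih
      have : sInf {m | x ∈ C' (pre k x ++ [m])} ∈ {m | x ∈ C' (pre k x ++ [m])} :=
        Nat.sInf_mem ⟨m, (hx _).2 hm⟩
      exact (hx _).1 this
  choose τ hτ hτx using hmem
  have hτlim : Tendsto τ atTop (𝓝 (σ x)) := by
    rw [tendsto_pi_nhds]
    intro i
    refine tendsto_const_nhds.congr' ?_
    filter_upwards [eventually_gt_atTop i] with k hk
    have h := hτ k
    simp only [Z, mem_ofPred_eq, hpreσ, List.length_map, List.length_range] at h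
    exact (List.map_inj_left.1 h i (List.mem_range.2 hk)).symm
  have hfix : φ (σ x) = x :=
    tendsto_nhds_unique ((hφ.tendsto (σ x)).comp hτlim)
      (tendsto_const_nhds.congr fun k ↦ (hτx k).symm)
  exact ⟨σ x, Prod.ext hfix rfl⟩

end Selection

/-! ### Dudley's entropy bound -/

section Maximal

variable {Ω : Type*} [MeasurableSpace Ω] {μ : Measure Ω} [IsProbabilityMeasure μ]

/-- The maximal inequality for finitely many subgaussian variables. -/
theorem lintegral_iSup_abs_le {ι : Type*} [Finite ι] [Nonempty ι] {W : ι → Ω → ℝ}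
    (hW : ∀ i, Measurable (W i)) {σ : ℝ} (hσ : 0 < σ)
    (hexp : ∀ i l, ∫⁻ ω, ENNReal.ofReal (Real.exp (l * W i ω)) ∂μ ≤
      ENNReal.ofReal (Real.exp ((l * σ) ^ 2 / 2)))
    {M : ℕ} (hM : Nat.card ι ≤ M) :
    ∫⁻ ω, ⨆ i, ENNReal.ofReal |W i ω| ∂μ ≤
      ENNReal.ofReal (3 * σ * √(Real.log (2 * M))) := by
  have := Fintype.ofFinite ι
  have hM1 : 1 ≤ M := (Nat.card_pos (α := ι)).trans_le hM
  have hM1' : (1 : ℝ) ≤ M := by exact_mod_cast hM1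
  set m : ℝ := Real.log (2 * M) with hm
  have hm0 : 2 / 3 < m := by
    have : Real.log 2 ≤ m := Real.log_le_log (by norm_num) (by linarith)
    have := Real.log_two_gt_d9
    norm_num at *
    linarith
  have hs : 0 < √m := Real.sqrt_pos.2 (by linarith)
  have hss : √m * √m = m := Real.mul_self_sqrt (by linarith)
  set l : ℝ := √m / σ with hl
  have hl0 : 0 < l := div_pos hs hσ
  have hlσ : l * σ = √m := div_mul_cancel₀ _ hσ.ne'
  -- `a` balances the threshold and the exponential tail in `|w| ≤ a + (e^{l(w-a)} + e^{l(-w-a)})/l`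
  set a : ℝ := 3 / 2 * σ * √m with ha
  have hla : l * a = 3 / 2 * m := by
    rw [ha, hl]
    field_simp
    linarith [hss, sq √m]
  have hpt : ∀ w : ℝ, |w| ≤
      a + Real.exp (-(l * a)) / l * (Real.exp (l * w) + Real.exp (-l * w)) := by
    intro w
    have h1 : l * (|w| - a) ≤ Real.exp (l * (|w| - a)) := by
      linarith [Real.add_one_le_exp (l * (|w| - a))]
    have h2 : Real.exp (l * (|w| - a)) ≤
        Real.exp (-(l * a)) * (Real.exp (l * w) + Real.exp (-l * w)) := by
      rw [show l * (|w| - a) = -(l * a) + l * |w| by ring, Real.exp_add]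
      refine mul_le_mul_of_nonneg_left ?_ (Real.exp_pos _).le
      rcases abs_cases w with ⟨h, -⟩ | ⟨h, -⟩ <;> rw [h]
      · linarith [Real.exp_pos (-l * w)]
      · rw [mul_neg, ← neg_mul]; linarith [Real.exp_pos (l * w)]
    have h3 : |w| - a ≤ Real.exp (-(l * a)) * (Real.exp (l * w) + Real.exp (-l * w)) / l := by
      rw [le_div_iff₀ hl0]; linarith
    have : Real.exp (-(l * a)) * (Real.exp (l * w) + Real.exp (-l * w)) / l =
      Real.exp (-(l * a)) / l * (Real.exp (l * w) + Real.exp (-l * w)) := by ring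
    linarith
  set r : ℝ := Real.exp (-(l * a)) / l with hr
  have hr0 : 0 ≤ r := by positivity
  have hmeas : ∀ (t : ℝ) i, Measurable fun ω ↦ ENNReal.ofReal (Real.exp (t * W i ω)) := fun t i ↦
    ((hW i).const_mul t).exp.ennreal_ofReal
  calc ∫⁻ ω, ⨆ i, ENNReal.ofReal |W i ω| ∂μ
      ≤ ∫⁻ ω, (ENNReal.ofReal a + ENNReal.ofReal r * ∑ i,
          (ENNReal.ofReal (Real.exp (l * W i ω)) + ENNReal.ofReal (Real.exp (-l * W i ω)))) ∂μ := by
        refine lintegral_mono fun ω ↦ iSup_le fun i ↦ ?_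
        refine (ENNReal.ofReal_le_ofReal (hpt (W i ω))).trans ?_
        refine ENNReal.ofReal_add_le.trans ?_
        gcongr
        rw [ENNReal.ofReal_mul hr0]
        gcongr
        rw [ENNReal.ofReal_add (Real.exp_pos _).le (Real.exp_pos _).le]
        exact Finset.single_le_sum (f := fun i ↦ ENNReal.ofReal (Real.exp (l * W i ω)) +
          ENNReal.ofReal (Real.exp (-l * W i ω))) (fun _ _ ↦ zero_le) (Finset.mem_univ i)
    _ = ENNReal.ofReal a + ENNReal.ofReal r * ∑ i,
          (∫⁻ ω, ENNReal.ofReal (Real.exp (l * W i ω)) ∂μ +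
            ∫⁻ ω, ENNReal.ofReal (Real.exp (-l * W i ω)) ∂μ) := by
        have hadd : ∀ i, Measurable fun ω ↦ ENNReal.ofReal (Real.exp (l * W i ω)) +
            ENNReal.ofReal (Real.exp (-l * W i ω)) := fun i ↦ (hmeas _ i).add (hmeas _ i)
        rw [lintegral_add_left measurable_const, lintegral_const, measure_univ, mul_one,
          lintegral_const_mul _ (Finset.measurable_sum _ fun i _ ↦ hadd i),
          lintegral_finsetSum _ fun i _ ↦ hadd i]
        simp_rw [lintegral_add_left (hmeas _ _)]
    _ ≤ ENNReal.ofReal a + ENNReal.ofReal r * ∑ _i : ι,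
          (ENNReal.ofReal (Real.exp (m / 2)) + ENNReal.ofReal (Real.exp (m / 2))) := by
        have e1 : (l * σ) ^ 2 / 2 = m / 2 := by rw [hlσ, sq, hss]
        have e2 : (-l * σ) ^ 2 / 2 = m / 2 := by rw [← e1]; ring
        gcongr with i
        · simpa only [e1] using hexp i l
        · simpa only [e2] using hexp i (-l)
    _ = ENNReal.ofReal (a + r * (Nat.card ι * (Real.exp (m / 2) + Real.exp (m / 2)))) := by
        rw [Finset.sum_const, Finset.card_univ, ← Nat.card_eq_fintype_card, nsmul_eq_mul,
          ← ENNReal.ofReal_add (Real.exp_pos _).le (Real.exp_pos _).le, ← ENNReal.ofReal_natCast,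
          ← ENNReal.ofReal_mul (by positivity), ← ENNReal.ofReal_mul hr0,
          ← ENNReal.ofReal_add (by positivity) (by positivity)]
    _ ≤ ENNReal.ofReal (3 * σ * √m) := by
        refine ENNReal.ofReal_le_ofReal ?_
        have hcard : (Nat.card ι : ℝ) ≤ M := by exact_mod_cast hM
        have h1 : r * (Nat.card ι * (Real.exp (m / 2) + Real.exp (m / 2))) ≤ 1 / l := by
          calc r * (Nat.card ι * (Real.exp (m / 2) + Real.exp (m / 2)))
              ≤ r * (M * (Real.exp (m / 2) + Real.exp (m / 2))) := by gcongr
            _ = Real.exp (-(l * a)) * Real.exp (m / 2) * Real.exp m / l := by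
                rw [hm, Real.exp_log (by linarith), hr]; ring
            _ = 1 / l := by
                rw [← Real.exp_add, ← Real.exp_add, hla,
                  show -(3 / 2 * m) + m / 2 + m = 0 by ring, Real.exp_zero]
        have h2 : 1 / l ≤ 3 / 2 * σ * √m := by
          rw [hl, one_div_div, div_le_iff₀ hs]
          nlinarith [hss]
        linarith

theorem lintegral_abs_le_of_exp_le {W : Ω → ℝ} (hW : Measurable W) {σ : ℝ} (hσ : 0 ≤ σ)
    (hexp : ∀ l, ∫⁻ ω, ENNReal.ofReal (Real.exp (l * W ω)) ∂μ ≤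
      ENNReal.ofReal (Real.exp ((l * σ) ^ 2 / 2))) :
    ∫⁻ ω, ENNReal.ofReal |W ω| ∂μ ≤ ENNReal.ofReal (3 * σ) := by
  have hlim : ∀ τ, σ < τ → ∫⁻ ω, ENNReal.ofReal |W ω| ∂μ ≤ ENNReal.ofReal (3 * τ) := by
    intro τ hτ
    have h := lintegral_iSup_abs_le (μ := μ) (ι := Unit) (W := fun _ ↦ W) (fun _ ↦ hW)
      (hσ.trans_lt hτ) (fun _ l ↦ (hexp l).trans (ENNReal.ofReal_le_ofReal
        (Real.exp_le_exp.2 (by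
          rw [mul_pow, mul_pow]
          gcongr)))) (M := 1) (by simp)
    simp only [iSup_const] at h
    refine h.trans (ENNReal.ofReal_le_ofReal ?_)
    have : √(Real.log (2 * (1 : ℕ))) ≤ 1 := by
      rw [Real.sqrt_le_one]
      have := Real.log_two_lt_d9
      norm_num at *
      linarith
    exact mul_le_of_le_one_right (by linarith) this
  have hc : Filter.Tendsto (fun τ ↦ ENNReal.ofReal (3 * τ)) (nhdsWithin σ (Ioi σ))
      (nhds (ENNReal.ofReal (3 * σ))) :=
    (ENNReal.continuous_ofReal.comp (continuous_const.mul continuous_id)).continuousWithinAt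
  exact ge_of_tendsto hc (eventually_mem_nhdsWithin.mono fun τ hτ ↦ hlim τ hτ)

end Maximal

section Entropy

variable {Y : Type*} [PseudoMetricSpace Y] {X : Set Y}

/-- The integrand `√(log N(X, u))` of the Dudley integral. -/
noncomputable def entropyRoot (X : Set Y) (u : ℝ) : ℝ≥0∞ :=
  (ENNReal.log (Metric.externalCoveringNumber u.toNNReal X : ℝ≥0∞)).toENNReal ^ (1 / 2 : ℝ)

theorem entropyRoot_antitone : Antitone (entropyRoot X) := by
  intro u v huv
  refine ENNReal.rpow_le_rpow (EReal.toENNReal_le_toENNReal (ENNReal.log_monotone ?_)) (by norm_num)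
  exact_mod_cast Metric.externalCoveringNumber_anti (Real.toNNReal_le_toNNReal huv)

theorem externalCoveringNumber_ne_top (hX : TotallyBounded X) {u : ℝ} (hu : 0 < u) :
    Metric.externalCoveringNumber u.toNNReal X ≠ ⊤ := by
  obtain ⟨C, -, hC, hcov⟩ := Metric.exists_finite_isCover_of_totallyBounded
    (ε := u.toNNReal) (by simpa using hu) hX
  exact (hcov.externalCoveringNumber_le_encard.trans_lt (encard_lt_top_iff.2 hC)).ne

theorem entropyRoot_eq {u : ℝ} {n : ℕ} (hn : 1 ≤ n)
    (h : Metric.externalCoveringNumber u.toNNReal X = n) :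
    entropyRoot X u = ENNReal.ofReal √(Real.log n) := by
  have hn' : (1 : ℝ) ≤ n := by exact_mod_cast hn
  rw [entropyRoot, h]
  have : (((n : ℕ∞) : ℝ≥0∞)) = ENNReal.ofReal (n : ℝ) := by simp
  rw [this, ENNReal.log_ofReal_of_pos (by linarith), EReal.toENNReal_of_ne_top (EReal.coe_ne_top _),
    EReal.toReal_coe, ENNReal.ofReal_rpow_of_nonneg (Real.log_nonneg hn') (by norm_num),
    Real.sqrt_eq_rpow]

/-- A net of `X` with mesh `2 u` inside `X`, no larger than the least external cover by balls of
radius `u`. -/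
theorem exists_net (hX : TotallyBounded X) {u : ℝ} (hu : 0 < u) :
    ∃ (C : Finset X) (π : X → X), (∀ t, π t ∈ C) ∧ (∀ t, dist t (π t) ≤ 2 * u) ∧
      C.card ≤ (Metric.externalCoveringNumber u.toNNReal X).toNat := by
  have hle := Metric.coveringNumber_two_mul_le_externalCoveringNumber u.toNNReal X
  have hfin := externalCoveringNumber_ne_top hX hu
  obtain ⟨C, hCX, hC, hcov, hcard⟩ := Metric.exists_set_encard_eq_coveringNumber
    (ne_top_of_le_ne_top hfin hle)
  have hpt : ∀ t : X, ∃ s : X, (s : Y) ∈ C ∧ dist t s ≤ 2 * u := by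
    intro t
    obtain ⟨s, hs, hts⟩ := hcov t.2
    refine ⟨⟨s, hCX hs⟩, hs, ?_⟩
    have : edist (t : Y) s ≤ ENNReal.ofReal (2 * u) := by
      refine hts.trans (le_of_eq ?_)
      rw [ENNReal.ofReal_mul (by norm_num)]
      simp [ENNReal.ofReal]
    rw [edist_dist, ENNReal.ofReal_le_ofReal_iff (by positivity)] at this
    exact this
  choose π hπC hπ using hpt
  have hfinC : (Subtype.val ⁻¹' C : Set X).Finite := hC.preimage Subtype.val_injective.injOn
  refine ⟨hfinC.toFinset, π, fun t ↦ by simpa using hπC t, hπ, ?_⟩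
  have h1 : ((hfinC.toFinset.card : ℕ) : ℕ∞) ≤ Metric.externalCoveringNumber u.toNNReal X := by
    rw [← Set.encard_coe_eq_coe_finsetCard, hfinC.coe_toFinset]
    have : (Subtype.val ⁻¹' C : Set X).encard =
        (Subtype.val '' (Subtype.val ⁻¹' C : Set X)).encard :=
      (Subtype.val_injective.encard_image _).symm
    rw [this]
    exact (encard_le_encard (image_preimage_subset _ _)).trans (hcard.trans_le hle)
  rw [← ENat.natCast_toNat hfin] at h1
  exact_mod_cast h1

theorem two_le_externalCoveringNumber {u : ℝ} (hu : 0 ≤ u)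
    (h : ENNReal.ofReal (2 * u) < Metric.ediam X) :
    2 ≤ Metric.externalCoveringNumber u.toNNReal X := by
  by_contra! hlt
  simp only [Metric.externalCoveringNumber] at hlt
  obtain ⟨C, hC⟩ := iInf_lt_iff.1 hlt
  obtain ⟨hcov, hC⟩ := iInf_lt_iff.1 hC
  have hC1 : C.encard ≤ 1 := Order.le_of_lt_add_one (by simpa [one_add_one_eq_two] using hC)
  have hsub := encard_le_one_iff.1 hC1
  refine h.not_ge (Metric.ediam_le fun x hx y hy ↦ ?_)
  obtain ⟨s, hs, hxs⟩ := hcov hx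
  obtain ⟨s', hs', hys⟩ := hcov hy
  obtain rfl := hsub s s' hs hs'
  refine (edist_triangle_right x y s).trans ((add_le_add hxs hys).trans (le_of_eq ?_))
  rw [two_mul, ENNReal.ofReal_add hu hu]
  rfl

theorem dudleyIntegral_eq :
    dudleyIntegral X = ∫⁻ u in {u : ℝ | 0 < u ∧ ENNReal.ofReal u ≤ Metric.ediam X},
      entropyRoot X u := rfl

end Entropy

section Chaining

variable {Y : Type*} [PseudoMetricSpace Y] {X : Set Y}
  {Ω : Type*} [MeasurableSpace Ω] {μ : Measure Ω} [IsProbabilityMeasure μ]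
  {Z : X → Ω → ℝ} {c : ℝ}

/-- One link of the chain: the increments between two nets. -/
theorem lintegral_iSup_link_le (hZ : ∀ t, Measurable (Z t)) (hc : 0 < c)
    (hexp : ∀ s t l, ∫⁻ ω, ENNReal.ofReal (Real.exp (l * (Z s ω - Z t ω))) ∂μ ≤
      ENNReal.ofReal (Real.exp ((l * (c * dist s t)) ^ 2 / 2)))
    (C C' : Finset X) {n : ℕ} (hn : 2 ≤ n) (hC : C.card ≤ n) (hC' : C'.card ≤ n) {v : ℝ}
    (hv : 0 < v) :
    ∫⁻ ω, ⨆ p : {p : X × X // p ∈ C ×ˢ C' ∧ dist p.1 p.2 ≤ v},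
      ENNReal.ofReal |Z p.1.1 ω - Z p.1.2 ω| ∂μ ≤
        ENNReal.ofReal (6 * c * v) * ENNReal.ofReal √(Real.log n) := by
  have hfin : Finite {p : X × X // p ∈ C ×ˢ C' ∧ dist p.1 p.2 ≤ v} :=
    ((C ×ˢ C').finite_toSet.subset fun p (hp : p ∈ C ×ˢ C' ∧ dist p.1 p.2 ≤ v) ↦ hp.1).to_subtype
  rcases isEmpty_or_nonempty {p : X × X // p ∈ C ×ˢ C' ∧ dist p.1 p.2 ≤ v} with he | he
  · simp
  have hcard : Nat.card {p : X × X // p ∈ C ×ˢ C' ∧ dist p.1 p.2 ≤ v} ≤ n ^ 2 := by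
    have h1 : Nat.card {p : X × X // p ∈ C ×ˢ C' ∧ dist p.1 p.2 ≤ v} ≤
        Nat.card (C ×ˢ C' : Finset (X × X)) :=
      Nat.card_le_card_of_injective (fun p ↦ ⟨p.1, p.2.1⟩) fun p q h ↦ by
        simpa [Subtype.ext_iff] using h
    rw [Nat.card_eq_fintype_card (α := (C ×ˢ C' : Finset (X × X))), Fintype.card_coe,
      Finset.card_product] at h1
    exact h1.trans ((Nat.mul_le_mul hC hC').trans_eq (sq n).symm)
  refine (lintegral_iSup_abs_le (σ := c * v) (fun p ↦ (hZ p.1.1).sub (hZ p.1.2)) (by positivity)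
    (fun p l ↦ (hexp p.1.1 p.1.2 l).trans (ENNReal.ofReal_le_ofReal (Real.exp_le_exp.2 ?_)))
    hcard).trans ?_
  · have := p.2.2
    simp only [mul_pow l]
    gcongr
  · have hn' : (2 : ℝ) ≤ n := by exact_mod_cast hn
    have hlog : 0 ≤ Real.log n := Real.log_nonneg (by linarith)
    rw [← ENNReal.ofReal_mul (by positivity)]
    refine ENNReal.ofReal_le_ofReal ?_
    have h1 : √(Real.log (2 * (n ^ 2 : ℕ))) ≤ 2 * √(Real.log n) := by
      rw [show (2 : ℝ) = √4 by rw [show (4 : ℝ) = 2 ^ 2 by norm_num]; simp,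
        ← Real.sqrt_mul (by norm_num)]
      refine Real.sqrt_le_sqrt ?_
      push_cast
      rw [show √4 = (2 : ℝ) by rw [show (4 : ℝ) = 2 ^ 2 by norm_num]; simp,
        Real.log_mul (by norm_num) (by positivity), Real.log_pow]
      have : Real.log 2 ≤ Real.log n := Real.log_le_log (by norm_num) hn'
      push_cast
      linarith
    calc 3 * (c * v) * √(Real.log (2 * (n ^ 2 : ℕ))) ≤ 3 * (c * v) * (2 * √(Real.log n)) := by
          gcongr
      _ = 6 * c * v * √(Real.log n) := by ring

/-- Dudley's entropy bound for finitely many members of a process with subgaussian increments.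
The chain runs through nets of mesh `diam X / 4 ^ k`. -/
theorem lintegral_iSup_finset_le (hX : TotallyBounded X) (hZ : ∀ t, Measurable (Z t)) (hc : 0 < c)
    (hexp : ∀ s t l, ∫⁻ ω, ENNReal.ofReal (Real.exp (l * (Z s ω - Z t ω))) ∂μ ≤
      ENNReal.ofReal (Real.exp ((l * (c * dist s t)) ^ 2 / 2)))
    (t₀ : X) (T : Finset X) :
    ∫⁻ ω, ⨆ t ∈ T, ENNReal.ofReal |Z t ω - Z t₀ ω| ∂μ ≤
      80 * ENNReal.ofReal c * dudleyIntegral X := by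
  have hZabs : ∀ s t, Measurable fun ω ↦ ENNReal.ofReal |Z s ω - Z t ω| := fun s t ↦
    (measurable_abs.comp ((hZ s).sub (hZ t))).ennreal_ofReal
  have hone : ∀ s t, ∫⁻ ω, ENNReal.ofReal |Z s ω - Z t ω| ∂μ ≤
      ENNReal.ofReal (3 * (c * dist s t)) := fun s t ↦
    lintegral_abs_le_of_exp_le ((hZ s).sub (hZ t)) (by positivity) (hexp s t)
  have hbdd : Bornology.IsBounded X := hX.isBounded
  have hdiam : Metric.ediam X = ENNReal.ofReal (Metric.diam X) := by
    rw [Metric.diam, ENNReal.ofReal_toReal hbdd.ediam_ne_top]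
  have hdist : ∀ s t : X, dist s t ≤ Metric.diam X := fun s t ↦
    Metric.dist_le_diam_of_mem hbdd s.2 t.2
  rcases (Metric.diam_nonneg (s := X)).eq_or_lt with h0 | h0
  · -- if the diameter is zero, all the increments vanish almost surely
    calc ∫⁻ ω, ⨆ t ∈ T, ENNReal.ofReal |Z t ω - Z t₀ ω| ∂μ
        ≤ ∫⁻ ω, ∑ t ∈ T, ENNReal.ofReal |Z t ω - Z t₀ ω| ∂μ :=
          lintegral_mono fun ω ↦ iSup₂_le fun t ht ↦ Finset.single_le_sum
            (f := fun t ↦ ENNReal.ofReal |Z t ω - Z t₀ ω|) (fun _ _ ↦ zero_le) ht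
      _ = ∑ t ∈ T, ∫⁻ ω, ENNReal.ofReal |Z t ω - Z t₀ ω| ∂μ :=
          lintegral_finsetSum _ fun t _ ↦ hZabs t t₀
      _ ≤ ∑ t ∈ T, 0 := by
          refine Finset.sum_le_sum fun t _ ↦ (hone t t₀).trans ?_
          have : dist t t₀ = 0 := le_antisymm (h0 ▸ hdist t t₀) dist_nonneg
          simp [this]
      _ ≤ _ := by simp
  set Δ := Metric.diam X with hΔ
  let u : ℕ → ℝ := fun k ↦ Δ / 4 ^ k
  have hu : ∀ k, 0 < u k := fun k ↦ by positivity
  have hu4 : ∀ k, u k = 4 * u (k + 1) := fun k ↦ by simp only [u, pow_succ]; field_simp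
  let n : ℕ → ℕ := fun k ↦ (Metric.externalCoveringNumber (u k).toNNReal X).toNat
  have hnE : ∀ k, Metric.externalCoveringNumber (u k).toNNReal X = n k := fun k ↦
    (ENat.natCast_toNat (externalCoveringNumber_ne_top hX (hu k))).symm
  have hn2 : ∀ k, 2 ≤ n (k + 1) := by
    intro k
    have h := two_le_externalCoveringNumber (X := X) (hu (k + 1)).le (by
      rw [hdiam, ENNReal.ofReal_lt_ofReal_iff h0]
      have h4 : (4 : ℝ) ≤ 4 ^ (k + 1) := by
        calc (4 : ℝ) = 4 ^ 1 := by norm_num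
          _ ≤ 4 ^ (k + 1) := pow_le_pow_right₀ (by norm_num) (by omega)
      have : u (k + 1) ≤ Δ / 4 := by
        simp only [u]
        gcongr
      linarith)
    rw [hnE] at h
    exact_mod_cast h
  have hnmono : ∀ k, n k ≤ n (k + 1) := by
    intro k
    have h : Metric.externalCoveringNumber (u k).toNNReal X ≤
        Metric.externalCoveringNumber (u (k + 1)).toNNReal X :=
      Metric.externalCoveringNumber_anti (Real.toNNReal_le_toNNReal (by
        linarith [hu4 k, hu (k + 1)]))
    rw [hnE, hnE] at h
    exact_mod_cast h
  choose C₁ π₁ hπC₁ hπ₁ hcard₁ using fun k ↦ exists_net hX (hu k)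
  -- the coarsest net is replaced by the single point `t₀`
  let C : ℕ → Finset X := fun k ↦ if k = 0 then {t₀} else C₁ k
  let π : ℕ → X → X := fun k t ↦ if k = 0 then t₀ else π₁ k t
  have hπC : ∀ k t, π k t ∈ C k := by
    intro k t
    by_cases hk : k = 0
    · simp [π, C, hk]
    · simpa [π, C, hk] using hπC₁ k t
  have hπ : ∀ k t, dist t (π k t) ≤ 2 * u k := by
    intro k t
    by_cases hk : k = 0
    · subst hk
      have := hdist t t₀
      simp only [π, u, if_true, pow_zero, div_one]
      linarith
    · simpa [π, hk] using hπ₁ k t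
  have hcard : ∀ k, (C (k + 1)).card ≤ n (k + 1) := fun k ↦ by simpa [C] using hcard₁ (k + 1)
  have hcard' : ∀ k, (C k).card ≤ n (k + 1) := by
    rintro (_ | k)
    · exact le_trans (by simp [C]) (hn2 0)
    · exact (hcard k).trans (hnmono _)
  let Gk : ℕ → Ω → ℝ≥0∞ := fun k ω ↦
    ⨆ p : {p : X × X // p ∈ C k ×ˢ C (k + 1) ∧ dist p.1 p.2 ≤ 10 * u (k + 1)},
      ENNReal.ofReal |Z p.1.1 ω - Z p.1.2 ω|
  have hGm : ∀ k, Measurable (Gk k) := by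
    intro k
    have hfin : Finite {p : X × X // p ∈ C k ×ˢ C (k + 1) ∧ dist p.1 p.2 ≤ 10 * u (k + 1)} :=
      ((C k ×ˢ C (k + 1)).finite_toSet.subset
        fun p (hp : p ∈ C k ×ˢ C (k + 1) ∧ dist p.1 p.2 ≤ 10 * u (k + 1)) ↦ hp.1).to_subtype
    exact Measurable.iSup fun p ↦ hZabs _ _
  let I : ℕ → Set ℝ := fun k ↦ Ioc (u (k + 2)) (u (k + 1))
  have hGint : ∀ k, ∫⁻ ω, Gk k ω ∂μ ≤ 80 * ENNReal.ofReal c * ∫⁻ v in I k, entropyRoot X v := by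
    intro k
    refine (lintegral_iSup_link_le hZ hc hexp _ _ (hn2 k) (hcard' k) (hcard k)
      (v := 10 * u (k + 1)) (by linarith [hu (k + 1)])).trans ?_
    rw [← entropyRoot_eq (by linarith [hn2 k]) (hnE (k + 1))]
    have h1 : entropyRoot X (u (k + 1)) * ENNReal.ofReal (u (k + 1) - u (k + 2)) ≤
        ∫⁻ v in I k, entropyRoot X v := by
      rw [← Real.volume_Ioc, ← setLIntegral_const]
      exact setLIntegral_mono' measurableSet_Ioc fun v hv ↦ entropyRoot_antitone hv.2
    refine le_trans (le_of_eq ?_) (mul_le_mul_right h1 (80 * ENNReal.ofReal c))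
    have h2 : 6 * c * (10 * u (k + 1)) = 80 * c * (u (k + 1) - u (k + 2)) := by
      rw [hu4 (k + 1)]; ring
    rw [h2, ENNReal.ofReal_mul (by positivity), ENNReal.ofReal_mul (by norm_num)]
    simp only [ENNReal.ofReal_ofNat]
    ring
  have hsum : ∀ K, ∑ k ∈ Finset.range K, ∫⁻ ω, Gk k ω ∂μ ≤
      80 * ENNReal.ofReal c * dudleyIntegral X := by
    intro K
    have hanti : Antitone u := antitone_nat_of_succ_le fun k ↦ by linarith [hu4 k, hu (k + 1)]
    refine (Finset.sum_le_sum fun k _ ↦ hGint k).trans ?_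
    rw [← Finset.mul_sum]
    gcongr
    rw [← lintegral_biUnion_finset ?_ fun k _ ↦ measurableSet_Ioc, dudleyIntegral_eq]
    · refine lintegral_mono_set (iUnion₂_subset fun k _ v hv ↦ ⟨(hu _).trans hv.1, ?_⟩)
      rw [hdiam]
      refine ENNReal.ofReal_le_ofReal (hv.2.trans ((hanti (Nat.zero_le _)).trans ?_))
      simp [u]
    · have : Pairwise (Function.onFun Disjoint I) := by
        refine (pairwise_disjoint_on I).2 fun k j hkj ↦ ?_
        refine disjoint_left.2 fun v hv hv' ↦ ?_
        exact (hv.1.trans_le hv'.2).not_ge (hanti (by omega))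
      exact fun k _ j _ h ↦ this h
  have hmain : ∀ K, ∫⁻ ω, ⨆ t ∈ T, ENNReal.ofReal |Z t ω - Z t₀ ω| ∂μ ≤
      80 * ENNReal.ofReal c * dudleyIntegral X +
        T.card * ENNReal.ofReal (3 * (c * (2 * u K))) := by
    intro K
    have hpt : ∀ ω, ⨆ t ∈ T, ENNReal.ofReal |Z t ω - Z t₀ ω| ≤
        ∑ k ∈ Finset.range K, Gk k ω + ∑ t ∈ T, ENNReal.ofReal |Z t ω - Z (π K t) ω| := by
      intro ω
      refine iSup₂_le fun t ht ↦ ?_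
      have htel : |Z t ω - Z t₀ ω| ≤ ∑ k ∈ Finset.range K, |Z (π k t) ω - Z (π (k + 1) t) ω| +
          |Z t ω - Z (π K t) ω| := by
        have h1 : Z t ω - Z t₀ ω = ∑ k ∈ Finset.range K, (Z (π (k + 1) t) ω - Z (π k t) ω) +
            (Z t ω - Z (π K t) ω) := by
          rw [Finset.sum_range_sub (fun k ↦ Z (π k t) ω)]
          simp [π]
        rw [h1]
        refine (abs_add_le _ _).trans (add_le_add ((Finset.abs_sum_le_sum_abs _ _).trans_eq ?_)
          le_rfl)
        simp_rw [abs_sub_comm]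
      refine (ENNReal.ofReal_le_ofReal htel).trans ?_
      rw [ENNReal.ofReal_add (Finset.sum_nonneg fun _ _ ↦ abs_nonneg _) (abs_nonneg _),
        ENNReal.ofReal_sum_of_nonneg fun _ _ ↦ abs_nonneg _]
      gcongr with k
      · refine le_iSup (fun p : {p : X × X // p ∈ C k ×ˢ C (k + 1) ∧
          dist p.1 p.2 ≤ 10 * u (k + 1)} ↦ ENNReal.ofReal |Z p.1.1 ω - Z p.1.2 ω|)
          ⟨(π k t, π (k + 1) t), Finset.mk_mem_product (hπC k t) (hπC (k + 1) t), ?_⟩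
        have := dist_triangle_left (π k t) (π (k + 1) t) t
        have h1 := hπ k t
        have h2 := hπ (k + 1) t
        have h3 := hu4 k
        simp only
        linarith
      · exact Finset.single_le_sum (f := fun t ↦ ENNReal.ofReal |Z t ω - Z (π K t) ω|)
          (fun _ _ ↦ zero_le) ht
    refine (lintegral_mono hpt).trans ?_
    rw [lintegral_add_left (Finset.measurable_sum _ fun k _ ↦ hGm k),
      lintegral_finsetSum _ fun k _ ↦ hGm k, lintegral_finsetSum _ fun t _ ↦ hZabs _ _]
    refine add_le_add (hsum K) ((Finset.sum_le_card_nsmul _ _ _ fun t _ ↦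
      (hone t _).trans (ENNReal.ofReal_le_ofReal ?_)).trans_eq (nsmul_eq_mul _ _))
    have := hπ K t
    gcongr
  have hlim : Filter.Tendsto (fun K ↦ 80 * ENNReal.ofReal c * dudleyIntegral X +
      T.card * ENNReal.ofReal (3 * (c * (2 * u K)))) Filter.atTop
      (nhds (80 * ENNReal.ofReal c * dudleyIntegral X + T.card * 0)) := by
    refine tendsto_const_nhds.add (ENNReal.Tendsto.const_mul ?_ (Or.inr (by simp)))
    rw [← ENNReal.ofReal_zero]
    refine ENNReal.tendsto_ofReal ?_
    have : Filter.Tendsto u Filter.atTop (nhds 0) :=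
      tendsto_const_nhds.div_atTop (tendsto_pow_atTop_atTop_of_one_lt (by norm_num))
    simpa using ((this.const_mul 2).const_mul c).const_mul 3
  simpa using ge_of_tendsto' hlim hmain

/-- Dudley's entropy bound for countably many members of the process. -/
theorem lintegral_iSup_le_dudleyIntegral (hX : TotallyBounded X) (hZ : ∀ t, Measurable (Z t))
    (hc : 0 < c)
    (hexp : ∀ s t l, ∫⁻ ω, ENNReal.ofReal (Real.exp (l * (Z s ω - Z t ω))) ∂μ ≤
      ENNReal.ofReal (Real.exp ((l * (c * dist s t)) ^ 2 / 2)))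
    (t₀ : X) (t : ℕ → X) :
    ∫⁻ ω, ⨆ i, ENNReal.ofReal |Z (t i) ω - Z t₀ ω| ∂μ ≤
      80 * ENNReal.ofReal c * dudleyIntegral X := by
  classical
  have hZabs : ∀ s t, Measurable fun ω ↦ ENNReal.ofReal |Z s ω - Z t ω| := fun s t ↦
    (measurable_abs.comp ((hZ s).sub (hZ t))).ennreal_ofReal
  have hsup : ∀ ω, ⨆ i, ENNReal.ofReal |Z (t i) ω - Z t₀ ω| =
      ⨆ k, ⨆ s ∈ (Finset.range k).image t, ENNReal.ofReal |Z s ω - Z t₀ ω| := by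
    intro ω
    refine le_antisymm (iSup_le fun i ↦ ?_) (iSup_le fun k ↦ iSup₂_le fun s hs ↦ ?_)
    · exact le_iSup_of_le (i + 1) (le_iSup₂_of_le (t i)
        (Finset.mem_image_of_mem t (by simp)) le_rfl)
    · obtain ⟨i, -, rfl⟩ := Finset.mem_image.1 hs
      exact le_iSup (fun i ↦ ENNReal.ofReal |Z (t i) ω - Z t₀ ω|) i
  simp_rw [hsup]
  have hm : ∀ k, Measurable fun ω ↦
      ⨆ s ∈ (Finset.range k).image t, ENNReal.ofReal |Z s ω - Z t₀ ω| := fun k ↦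
    Measurable.biSup _ (Finset.countable_toSet _) fun s _ ↦ hZabs s t₀
  rw [lintegral_iSup hm]
  · exact iSup_le fun k ↦ lintegral_iSup_finset_le hX hZ hc hexp t₀ _
  · intro k j hkj ω
    exact biSup_mono fun s hs ↦ Finset.image_subset_image (Finset.range_mono hkj) hs

end Chaining

/-! ### Independent draws from different laws -/

section Product

variable {ι E E' : Type*} [Fintype ι] [MeasurableSpace E] [MeasurableSpace E']

theorem measurable_pi_kernel (κ : Kernel E E') [IsMarkovKernel κ] :
    Measurable fun x : ι → E ↦ Measure.pi fun i ↦ κ (x i) := by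
  refine Measurable.measure_of_isPiSystem_of_isProbabilityMeasure generateFrom_pi.symm
    isPiSystem_pi ?_
  rintro _ ⟨s, hs, rfl⟩
  simp only [Measure.pi_pi]
  exact Finset.measurable_prod _ fun i _ ↦
    (κ.measurable_coe (hs i (mem_univ i))).comp (measurable_pi_apply i)

/-- The kernel that draws the coordinates independently, the `i`-th one from `κ (x i)`. -/
noncomputable def piKernel (ι : Type*) [Fintype ι] (κ : Kernel E E') [IsMarkovKernel κ] :
    Kernel (ι → E) (ι → E') where
  toFun x := Measure.pi fun i ↦ κ (x i)
  measurable' := measurable_pi_kernel κ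

instance (κ : Kernel E E') [IsMarkovKernel κ] : IsMarkovKernel (piKernel ι κ) :=
  ⟨fun x ↦ inferInstanceAs (IsProbabilityMeasure (Measure.pi fun i ↦ κ (x i)))⟩

/-- Independent copies of a pair are obtained by drawing all the first coordinates and then, given
these, all the second ones independently. -/
theorem pi_compProd_eq (μ : Measure E) [IsProbabilityMeasure μ] (κ : Kernel E E')
    [IsMarkovKernel κ] :
    Measure.pi (fun _ : ι ↦ μ ⊗ₘ κ) =
      (Measure.pi (fun _ : ι ↦ μ) ⊗ₘ piKernel ι κ).map fun p i ↦ (p.1 i, p.2 i) := by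
  have hmeas : Measurable fun (p : (ι → E) × (ι → E')) i ↦ (p.1 i, p.2 i) :=
    measurable_pi_iff.2 fun i ↦ ((measurable_pi_apply i).comp measurable_fst).prodMk
      ((measurable_pi_apply i).comp measurable_snd)
  refine Measure.pi_eq fun s hs ↦ ?_
  rw [Measure.map_apply hmeas (MeasurableSet.univ_pi hs),
    Measure.compProd_apply (hmeas (MeasurableSet.univ_pi hs))]
  have hsec : ∀ x : ι → E, piKernel ι κ x
      (Prod.mk x ⁻¹' ((fun (p : (ι → E) × (ι → E')) i ↦ (p.1 i, p.2 i)) ⁻¹' univ.pi s)) =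
      ∏ i, κ (x i) (Prod.mk (x i) ⁻¹' s i) := by
    intro x
    rw [← Measure.pi_pi]
    rfl
  simp_rw [hsec]
  have hind := iIndepFun_pi (μ := fun _ : ι ↦ μ)
    (X := fun i (x : E) ↦ κ x (Prod.mk x ⁻¹' s i))
    fun i ↦ (Kernel.measurable_kernel_prodMk_left (hs i)).aemeasurable
  rw [lintegral_prod_eq_prod_lintegral_of_indepFun _ _ hind fun i ↦
    (Kernel.measurable_kernel_prodMk_left (hs i)).comp (measurable_pi_apply i)]
  refine Finset.prod_congr rfl fun i _ ↦ ?_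
  rw [Measure.compProd_apply (hs i)]
  exact (measurePreserving_eval (fun _ : ι ↦ μ) i).lintegral_comp
    (Kernel.measurable_kernel_prodMk_left (hs i))

theorem lintegral_pi_compProd_le (μ : Measure E) [IsProbabilityMeasure μ] (κ : Kernel E E')
    [IsMarkovKernel κ] {F : (ι → E × E') → ℝ≥0∞} (hF : Measurable F) {c : ℝ≥0∞}
    (h : ∀ x : ι → E, ∫⁻ y, F (fun i ↦ (x i, y i)) ∂Measure.pi (fun i ↦ κ (x i)) ≤ c) :
    ∫⁻ z, F z ∂Measure.pi (fun _ : ι ↦ μ ⊗ₘ κ) ≤ c := by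
  have hmeas : Measurable fun (p : (ι → E) × (ι → E')) i ↦ (p.1 i, p.2 i) :=
    measurable_pi_iff.2 fun i ↦ ((measurable_pi_apply i).comp measurable_fst).prodMk
      ((measurable_pi_apply i).comp measurable_snd)
  rw [pi_compProd_eq, lintegral_map hF hmeas,
    Measure.lintegral_compProd (f := fun p : (ι → E) × (ι → E') ↦ F fun i ↦ (p.1 i, p.2 i))
      (hF.comp hmeas)]
  calc _ ≤ ∫⁻ _, c ∂Measure.pi (fun _ : ι ↦ μ) := lintegral_mono fun x ↦ h x
    _ = c := by simp

/-- Hoeffding's inequality for a sum of independent bounded variables, on the level of moment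
generating functions. -/
theorem lintegral_exp_sum_le {P : ι → Measure E} [∀ i, IsProbabilityMeasure (P i)]
    {ξ : ι → E → ℝ} (hξ : ∀ i, Measurable (ξ i)) {r : ℝ} (hr : 0 ≤ r)
    (hb : ∀ i, ∀ᵐ y ∂P i, |ξ i y| ≤ r) (l : ℝ) :
    ∫⁻ y, ENNReal.ofReal (Real.exp (l * ∑ i, (ξ i (y i) - ∫ v, ξ i v ∂P i))) ∂Measure.pi P ≤
      ENNReal.ofReal (Real.exp ((l * (r * √(Fintype.card ι))) ^ 2 / 2)) := by
  have hsub : ∀ i ∈ Finset.univ, HasSubgaussianMGF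
      (fun y : ι → E ↦ ξ i (y i) - ∫ v, ξ i v ∂P i) ((‖r - -r‖₊ / 2) ^ 2) (Measure.pi P) := by
    intro i _
    have h := hasSubgaussianMGF_of_mem_Icc (hξ i).aemeasurable
      ((hb i).mono fun y hy ↦ abs_le.1 hy)
    exact HasSubgaussianMGF.of_map (μ := Measure.pi P) (Y := fun y : ι → E ↦ y i)
      (measurable_pi_apply i).aemeasurable (by rwa [(measurePreserving_eval P i).map_eq])
  have hind := iIndepFun_pi (μ := P) (X := fun i v ↦ ξ i v - ∫ v, ξ i v ∂P i)
    fun i ↦ ((hξ i).sub_const _).aemeasurable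
  have h := HasSubgaussianMGF.sum_of_iIndepFun hind hsub
  rw [← ofReal_integral_eq_lintegral_ofReal (h.integrable_exp_mul l)
    (ae_of_all _ fun _ ↦ (Real.exp_pos _).le)]
  refine ENNReal.ofReal_le_ofReal ((h.mgf_le l).trans (Real.exp_le_exp.2 (le_of_eq ?_)))
  have hr2 : ‖r - -r‖ = 2 * r := by
    rw [Real.norm_eq_abs, sub_neg_eq_add, ← two_mul, abs_of_nonneg (by positivity)]
  rw [Finset.sum_const, Finset.card_univ, nsmul_eq_mul]
  push_cast
  rw [hr2, mul_pow, mul_pow, Real.sq_sqrt (Nat.cast_nonneg _)]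
  ring

end Product

/-! ### The error of one step of the mesh -/

theorem integral_withDensity_ofReal {E : Type*} [MeasurableSpace E] {ν : Measure E} {ρ : E → ℝ}
    (hρ : Measurable ρ) (h0 : ∀ y, 0 ≤ ρ y) (f : E → ℝ) :
    ∫ y, f y ∂ν.withDensity (fun y ↦ ENNReal.ofReal (ρ y)) = ∫ y, ρ y * f y ∂ν := by
  rw [integral_withDensity_eq_integral_toReal_smul hρ.ennreal_ofReal
    (ae_of_all _ fun _ ↦ ENNReal.ofReal_lt_top)]
  simp_rw [ENNReal.toReal_ofReal (h0 _), smul_eq_mul]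

section OneStep

variable {E : Type*} [MeasurableSpace E] {Y : Type*} [PseudoMetricSpace Y] {X : Set Y}

/-- The setting of one step of the mesh: a transition kernel `κ` with densities `k x`, which
generates the sample, and a family `g θ`, `θ ∈ X`, of probability densities, against which one wants
to integrate. All densities lie between `lo` and `hi`, and `g` is Lipschitz in `θ`. -/
structure DensityFamily (ν : Measure E) (κ : Kernel E E) (k : E → E → ℝ) (g : X → E → ℝ)
    (lo hi ℓ : ℝ) : Prop where
  lo_pos : 0 < lo
  measurable_k : Measurable (Function.uncurry k)
  k_mem : ∀ x y, k x y ∈ Icc lo hi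
  κ_eq : ∀ x, κ x = ν.withDensity fun y ↦ ENNReal.ofReal (k x y)
  measurable_g : ∀ θ, Measurable (g θ)
  g_mem : ∀ θ y, g θ y ∈ Icc lo hi
  integral_g : ∀ θ, ∫ y, g θ y ∂ν = 1
  lipschitz : ∀ᵐ y ∂ν, ∀ θ θ', |g θ y - g θ' y| ≤ ℓ * dist θ θ'

/-- The multiple importance sampling estimator of `∫ f g_θ`: the sample point `y n`, drawn from
`k (x n)`, is weighted with respect to the mixture of all the `k (x j)`. -/
noncomputable def mixtureEstimator (k : E → E → ℝ) (g : X → E → ℝ) (f : E → ℝ) {N : ℕ}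
    (x y : Fin N → E) (θ : X) : ℝ :=
  ∑ n, f (y n) * g θ (y n) / ∑ j, k (x j) (y n)

/-- The estimator of `∫ f g_θ` in which the mixture leaves out the own starting point of the
sample point. -/
noncomputable def leaveOneOutEstimator (k : E → E → ℝ) (g : X → E → ℝ) (f : E → ℝ) {N : ℕ}
    (x y : Fin N → E) (θ : X) : ℝ :=
  ∑ n, f (y n) * (g θ (y n) / ∑ j ∈ Finset.univ.erase n, k (x j) (y n))

variable {ν : Measure E} {κ : Kernel E E} {k : E → E → ℝ}
  {g : X → E → ℝ} {lo hi ℓ : ℝ} {f : E → ℝ} {B : ℝ} {N : ℕ}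

namespace DensityFamily

theorem hi_pos (h : DensityFamily ν κ k g lo hi ℓ) (θ : X) (y : E) : 0 < hi :=
  h.lo_pos.trans_le ((h.g_mem θ y).1.trans (h.g_mem θ y).2)

theorem le_mixture (h : DensityFamily ν κ k g lo hi ℓ) (x : Fin N → E) (y : E) :
    N * lo ≤ ∑ j, k (x j) y := by
  have := Finset.card_nsmul_le_sum Finset.univ (fun j ↦ k (x j) y) lo fun j _ ↦ (h.k_mem _ _).1
  simpa using this

theorem measurable_mixture (h : DensityFamily ν κ k g lo hi ℓ) (x : Fin N → E) :
    Measurable fun y ↦ ∑ j, k (x j) y :=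
  Finset.measurable_sum _ fun _ _ ↦ h.measurable_k.of_uncurry_left

theorem ae_kernel (h : DensityFamily ν κ k g lo hi ℓ) (x : E) {p : E → Prop}
    (hp : ∀ᵐ y ∂ν, p y) : ∀ᵐ y ∂κ x, p y := by
  rw [h.κ_eq x]
  exact (withDensity_absolutelyContinuous ν _).ae_le hp

/-- The mixture estimator is unbiased, whatever the starting points are. -/
theorem sum_integral_eq [IsFiniteMeasure ν] (h : DensityFamily ν κ k g lo hi ℓ) (hN : 0 < N)
    (hf : Measurable f) (hfB : ∀ y, |f y| ≤ B) (x : Fin N → E) (θ : X) :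
    ∑ n, ∫ y, f y * g θ y / ∑ j, k (x j) y ∂κ (x n) = ∫ y, f y * g θ y ∂ν := by
  have hN' : (0 : ℝ) < N := by exact_mod_cast hN
  have hk : ∀ n, Measurable fun y ↦ k (x n) y := fun n ↦ h.measurable_k.of_uncurry_left
  have hmix : ∀ y, 0 < ∑ j, k (x j) y := fun y ↦
    (mul_pos hN' h.lo_pos).trans_le (h.le_mixture x y)
  have hk0 : ∀ n y, 0 ≤ k (x n) y := fun n y ↦ h.lo_pos.le.trans (h.k_mem _ _).1
  have hint : ∀ n, Integrable (fun y ↦ k (x n) y * (f y * g θ y / ∑ j, k (x j) y)) ν := by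
    intro n
    refine Integrable.of_bound ((hk n).mul ((hf.mul (h.measurable_g θ)).div
      (h.measurable_mixture x))).aestronglyMeasurable (B * hi) (ae_of_all _ fun y ↦ ?_)
    have hle : k (x n) y ≤ ∑ j, k (x j) y :=
      Finset.single_le_sum (f := fun j ↦ k (x j) y) (fun j _ ↦ hk0 j y) (Finset.mem_univ n)
    have hg0 : 0 ≤ g θ y := h.lo_pos.le.trans (h.g_mem θ y).1
    rw [Real.norm_eq_abs, show k (x n) y * (f y * g θ y / ∑ j, k (x j) y) =
      (k (x n) y / (∑ j, k (x j) y)) * (f y * g θ y) by ring, abs_mul, abs_mul,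
      abs_of_nonneg (div_nonneg (hk0 n y) (hmix y).le), abs_of_nonneg hg0]
    calc (k (x n) y / (∑ j, k (x j) y)) * (|f y| * g θ y) ≤ 1 * (|f y| * g θ y) := by
          gcongr
          exact (div_le_one (hmix y)).2 hle
      _ ≤ B * hi := by
          rw [one_mul]
          exact mul_le_mul (hfB y) (h.g_mem θ y).2 hg0 ((abs_nonneg _).trans (hfB y))
  calc ∑ n, ∫ y, f y * g θ y / ∑ j, k (x j) y ∂κ (x n)
      = ∑ n, ∫ y, k (x n) y * (f y * g θ y / ∑ j, k (x j) y) ∂ν := by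
        refine Finset.sum_congr rfl fun n _ ↦ ?_
        rw [h.κ_eq (x n), integral_withDensity_ofReal (hk n) (hk0 n)]
    _ = ∫ y, ∑ n, k (x n) y * (f y * g θ y / ∑ j, k (x j) y) ∂ν :=
        (integral_finsetSum _ fun n _ ↦ hint n).symm
    _ = ∫ y, f y * g θ y ∂ν := by
        congr 1 with y
        rw [← Finset.sum_mul, mul_div_cancel₀ _ (hmix y).ne']

theorem measurable_summand (h : DensityFamily ν κ k g lo hi ℓ) (hf : Measurable f)
    (x : Fin N → E) (θ : X) : Measurable fun y ↦ f y * g θ y / ∑ j, k (x j) y :=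
  (hf.mul (h.measurable_g θ)).div (h.measurable_mixture x)

theorem abs_summand_le (h : DensityFamily ν κ k g lo hi ℓ) (hN : 0 < N)
    (hfB : ∀ y, |f y| ≤ B) (x : Fin N → E) (θ : X) (y : E) :
    |f y * g θ y / ∑ j, k (x j) y| ≤ B * hi / (N * lo) := by
  have hN' : (0 : ℝ) < N := by exact_mod_cast hN
  have hlo := h.lo_pos
  have hg0 : 0 ≤ g θ y := hlo.le.trans (h.g_mem θ y).1
  have hB : 0 ≤ B := (abs_nonneg _).trans (hfB y)
  have hmix := h.le_mixture x y
  rw [abs_div, abs_mul, abs_of_nonneg hg0, abs_of_pos ((mul_pos hN' hlo).trans_le hmix)]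
  have h1 := hfB y
  have h2 := (h.g_mem θ y).2
  have h3 := (hg0.trans h2)
  gcongr

theorem ae_abs_summand_sub_le (h : DensityFamily ν κ k g lo hi ℓ) (hN : 0 < N)
    (hfB : ∀ y, |f y| ≤ B) (x : Fin N → E) :
    ∀ᵐ y ∂ν, ∀ θ θ', |f y * g θ y / ∑ j, k (x j) y - f y * g θ' y / ∑ j, k (x j) y| ≤
      B * (ℓ * dist θ θ') / (N * lo) := by
  filter_upwards [h.lipschitz] with y hy θ θ'
  have hN' : (0 : ℝ) < N := by exact_mod_cast hN
  have hlo := h.lo_pos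
  have hB : 0 ≤ B := (abs_nonneg _).trans (hfB y)
  have hmix := h.le_mixture x y
  rw [← sub_div, ← mul_sub, abs_div, abs_mul, abs_of_pos ((mul_pos hN' hlo).trans_le hmix)]
  have h1 := hfB y
  have h2 := hy θ θ'
  have h3 := (abs_nonneg _).trans h2
  gcongr

theorem mixtureEstimator_sub_eq [IsFiniteMeasure ν] (h : DensityFamily ν κ k g lo hi ℓ) (hN : 0 < N)
    (hf : Measurable f) (hfB : ∀ y, |f y| ≤ B) (x y : Fin N → E) (θ : X) :
    mixtureEstimator k g f x y θ - ∫ v, f v * g θ v ∂ν =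
      ∑ n, (f (y n) * g θ (y n) / ∑ j, k (x j) (y n) -
        ∫ v, f v * g θ v / ∑ j, k (x j) v ∂κ (x n)) := by
  rw [Finset.sum_sub_distrib, h.sum_integral_eq hN hf hfB, mixtureEstimator]

theorem measurable_mixtureEstimator (h : DensityFamily ν κ k g lo hi ℓ) (hf : Measurable f)
    (x : Fin N → E) (θ : X) : Measurable fun y : Fin N → E ↦ mixtureEstimator k g f x y θ :=
  Finset.measurable_sum _ fun n _ ↦ (h.measurable_summand hf x θ).comp (measurable_pi_apply n)

/-- Given the starting points, the error of the mixture estimator is a centred process with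
subgaussian increments, so that Dudley's bound applies. -/
theorem lintegral_mixtureEstimator_le [IsFiniteMeasure ν] [IsMarkovKernel κ]
    (h : DensityFamily ν κ k g lo hi ℓ) (hN : 0 < N)
    (hX : TotallyBounded X) (hℓ : 0 < ℓ) (hB : 0 < B) (hf : Measurable f)
    (hfB : ∀ y, |f y| ≤ B) (t : ℕ → X) (x : Fin N → E) :
    ∫⁻ y, ⨆ i, ENNReal.ofReal |mixtureEstimator k g f x y (t i) - ∫ v, f v * g (t i) v ∂ν|
        ∂Measure.pi (fun n ↦ κ (x n)) ≤
      80 * ENNReal.ofReal (B * ℓ / (lo * √N)) * dudleyIntegral X +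
        ENNReal.ofReal (3 * (B * hi / (lo * √N))) := by
  have hN' : (0 : ℝ) < N := by exact_mod_cast hN
  have hlo := h.lo_pos
  have hsq : √(N : ℝ) * √(N : ℝ) = N := Real.mul_self_sqrt hN'.le
  have hsq0 : 0 < √(N : ℝ) := Real.sqrt_pos.2 hN'
  have hhi : 0 < hi := h.hi_pos (t 0) (x ⟨0, hN⟩)
  let φ : X → E → ℝ := fun θ y ↦ f y * g θ y / ∑ j, k (x j) y
  let Z : X → (Fin N → E) → ℝ := fun θ y ↦
    mixtureEstimator k g f x y θ - ∫ v, f v * g θ v ∂ν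
  have hφ : ∀ θ, Measurable (φ θ) := h.measurable_summand hf x
  have hφi : ∀ θ n, Integrable (φ θ) (κ (x n)) := fun θ n ↦
    Integrable.of_bound (hφ θ).aestronglyMeasurable _
      (ae_of_all _ fun y ↦ h.abs_summand_le hN hfB x θ y)
  have hZ : ∀ θ, Measurable (Z θ) := fun θ ↦ (h.measurable_mixtureEstimator hf x θ).sub_const _
  have hZeq : ∀ θ y, Z θ y = ∑ n, (φ θ (y n) - ∫ v, φ θ v ∂κ (x n)) := fun θ y ↦
    h.mixtureEstimator_sub_eq hN hf hfB x y θ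
  have hexp : ∀ s t l, ∫⁻ y, ENNReal.ofReal (Real.exp (l * (Z s y - Z t y)))
      ∂Measure.pi (fun n ↦ κ (x n)) ≤
      ENNReal.ofReal (Real.exp ((l * (B * ℓ / (lo * √N) * dist s t)) ^ 2 / 2)) := by
    intro s t l
    have h1 := lintegral_exp_sum_le (P := fun n ↦ κ (x n)) (ξ := fun _ y ↦ φ s y - φ t y)
      (fun _ ↦ (hφ s).sub (hφ t)) (r := B * (ℓ * dist s t) / (N * lo)) (by positivity)
      (fun n ↦ (h.ae_kernel (x n) (h.ae_abs_summand_sub_le hN hfB x)).mono fun y hy ↦ hy s t) l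
    have h2 : B * (ℓ * dist s t) / (N * lo) * √(Fintype.card (Fin N)) =
        B * ℓ / (lo * √N) * dist s t := by
      rw [Fintype.card_fin]
      nth_rewrite 1 [← hsq]
      field_simp
    rw [h2] at h1
    refine le_trans (lintegral_mono fun y ↦ le_of_eq ?_) h1
    simp_rw [integral_sub (hφi s _) (hφi t _), hZeq]
    rw [← Finset.sum_sub_distrib]
    congr 4 with n
    ring
  have hexp₀ : ∀ l, ∫⁻ y, ENNReal.ofReal (Real.exp (l * Z (t 0) y))
      ∂Measure.pi (fun n ↦ κ (x n)) ≤
      ENNReal.ofReal (Real.exp ((l * (B * hi / (lo * √N))) ^ 2 / 2)) := by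
    intro l
    have h1 := lintegral_exp_sum_le (P := fun n ↦ κ (x n)) (ξ := fun _ y ↦ φ (t 0) y)
      (fun _ ↦ hφ (t 0)) (r := B * hi / (N * lo)) (by positivity)
      (fun n ↦ ae_of_all _ fun y ↦ h.abs_summand_le hN hfB x (t 0) y) l
    have h2 : B * hi / (N * lo) * √(Fintype.card (Fin N)) = B * hi / (lo * √N) := by
      rw [Fintype.card_fin]
      nth_rewrite 1 [← hsq]
      field_simp
    rw [h2] at h1
    simpa only [hZeq] using h1
  have hdud := lintegral_iSup_le_dudleyIntegral hX hZ (by positivity) hexp (t 0) t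
  have hpoint := lintegral_abs_le_of_exp_le (hZ (t 0)) (by positivity) hexp₀
  have hm0 : Measurable fun y ↦ ENNReal.ofReal |Z (t 0) y| :=
    (measurable_abs.comp (hZ (t 0))).ennreal_ofReal
  calc ∫⁻ y, ⨆ i, ENNReal.ofReal |Z (t i) y| ∂Measure.pi (fun n ↦ κ (x n))
      ≤ ∫⁻ y, ((⨆ i, ENNReal.ofReal |Z (t i) y - Z (t 0) y|) + ENNReal.ofReal |Z (t 0) y|)
          ∂Measure.pi (fun n ↦ κ (x n)) := by
        refine lintegral_mono fun y ↦ iSup_le fun i ↦ ?_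
        calc ENNReal.ofReal |Z (t i) y|
            ≤ ENNReal.ofReal (|Z (t i) y - Z (t 0) y| + |Z (t 0) y|) :=
              ENNReal.ofReal_le_ofReal (by
                simpa using abs_add_le (Z (t i) y - Z (t 0) y) (Z (t 0) y))
          _ ≤ _ := ENNReal.ofReal_add_le.trans (add_le_add (le_iSup
              (fun i ↦ ENNReal.ofReal |Z (t i) y - Z (t 0) y|) i) le_rfl)
    _ ≤ _ := by
        rw [lintegral_add_right _ hm0]
        exact add_le_add hdud hpoint

/-- Leaving out the own starting point changes the estimator by a term of order `1 / N`. -/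
theorem abs_leaveOneOutEstimator_sub_le (h : DensityFamily ν κ k g lo hi ℓ) (hN : 2 ≤ N)
    (hfB : ∀ y, |f y| ≤ B) (x y : Fin N → E) (θ : X) :
    |leaveOneOutEstimator k g f x y θ - mixtureEstimator k g f x y θ| ≤
      B * hi ^ 2 / ((N - 1) * lo ^ 2) := by
  have hN' : (2 : ℝ) ≤ N := by exact_mod_cast hN
  have hlo := h.lo_pos
  have hterm : ∀ n, |f (y n) * (g θ (y n) / ∑ j ∈ Finset.univ.erase n, k (x j) (y n)) -
      f (y n) * g θ (y n) / ∑ j, k (x j) (y n)| ≤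
        B * hi ^ 2 / ((N - 1) * lo * (N * lo)) := by
    intro n
    set s := ∑ j ∈ Finset.univ.erase n, k (x j) (y n) with hs
    set S := ∑ j, k (x j) (y n) with hS
    have hsS : S - s = k (x n) (y n) := by
      rw [hs, hS, ← Finset.add_sum_erase _ _ (Finset.mem_univ n)]
      ring
    have hSle : N * lo ≤ S := h.le_mixture x (y n)
    have hsle : (N - 1) * lo ≤ s := by
      have := Finset.card_nsmul_le_sum (Finset.univ.erase n) (fun j ↦ k (x j) (y n)) lo
        fun j _ ↦ (h.k_mem _ _).1
      rw [Finset.card_erase_of_mem (Finset.mem_univ n), Finset.card_univ, Fintype.card_fin,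
        nsmul_eq_mul, Nat.cast_sub (by omega), Nat.cast_one] at this
      exact this
    have hs0 : 0 < s := lt_of_lt_of_le (mul_pos (by linarith) hlo) hsle
    have hS0 : 0 < S := lt_of_lt_of_le (mul_pos (by linarith) hlo) hSle
    have hg := h.g_mem θ (y n)
    have hk := h.k_mem (x n) (y n)
    have hg0 : 0 ≤ g θ (y n) := hlo.le.trans hg.1
    have hk0 : 0 ≤ k (x n) (y n) := hlo.le.trans hk.1
    have hB : 0 ≤ B := (abs_nonneg _).trans (hfB (y n))
    have hfB' := hfB (y n)
    have heq : f (y n) * (g θ (y n) / s) - f (y n) * g θ (y n) / S =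
        f (y n) * (g θ (y n) * k (x n) (y n)) / (s * S) := by
      rw [← hsS]
      field_simp
    have hN1 : (0 : ℝ) < N - 1 := by linarith
    rw [heq, abs_div, abs_mul, abs_of_pos (mul_pos hs0 hS0), abs_of_nonneg (mul_nonneg hg0 hk0),
      sq hi]
    have hg2 := hg.2
    have hk2 := hk.2
    have hhi := hg0.trans hg2
    gcongr
  rw [leaveOneOutEstimator, mixtureEstimator, ← Finset.sum_sub_distrib]
  refine (Finset.abs_sum_le_sum_abs _ _).trans ((Finset.sum_le_card_nsmul _ _ _
    fun n _ ↦ hterm n).trans_eq ?_)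
  have hN1 : (N : ℝ) - 1 ≠ 0 := by linarith
  have hN0 : (N : ℝ) ≠ 0 := by linarith
  rw [Finset.card_univ, Fintype.card_fin, nsmul_eq_mul]
  field_simp

theorem continuous_integral [IsFiniteMeasure ν] (h : DensityFamily ν κ k g lo hi ℓ)
    (hf : Measurable f) (hfB : ∀ y, |f y| ≤ B) : Continuous fun θ ↦ ∫ y, f y * g θ y ∂ν := by
  have hint : ∀ θ, Integrable (fun y ↦ f y * g θ y) ν := fun θ ↦
    Integrable.of_bound (hf.mul (h.measurable_g θ)).aestronglyMeasurable (B * hi)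
      (ae_of_all _ fun y ↦ by
        have hg0 : 0 ≤ g θ y := h.lo_pos.le.trans (h.g_mem θ y).1
        rw [Real.norm_eq_abs, abs_mul, abs_of_nonneg hg0]
        exact mul_le_mul (hfB y) (h.g_mem θ y).2 hg0 ((abs_nonneg _).trans (hfB y)))
  refine (LipschitzWith.of_dist_le' (K := B * ℓ * ν.real univ) fun θ θ' ↦ ?_).continuous
  rw [Real.dist_eq, ← integral_sub (hint θ) (hint θ'), ← Real.norm_eq_abs]
  refine (norm_integral_le_of_norm_le_const (C := B * (ℓ * dist θ θ')) ?_).trans_eq (by ring)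
  filter_upwards [h.lipschitz] with y hy
  rw [← mul_sub, Real.norm_eq_abs, abs_mul]
  exact mul_le_mul (hfB y) (hy θ θ') (abs_nonneg _) ((abs_nonneg _).trans (hfB y))

theorem ae_continuous_mixtureEstimator [IsMarkovKernel κ] (h : DensityFamily ν κ k g lo hi ℓ)
    (μ : Measure E) [IsProbabilityMeasure μ] (f : E → ℝ) (N : ℕ) :
    ∀ᵐ z ∂Measure.pi (fun _ : Fin N ↦ μ ⊗ₘ κ),
      Continuous fun θ ↦ mixtureEstimator k g f (fun n ↦ (z n).1) (fun n ↦ (z n).2) θ := by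
  have h1 : ∀ᵐ p ∂(μ ⊗ₘ κ), ∀ θ θ', |g θ p.2 - g θ' p.2| ≤ ℓ * dist θ θ' := by
    obtain ⟨s, hs, hsm, hs0⟩ := exists_measurable_superset_of_null (ae_iff.1 h.lipschitz)
    refine measure_mono_null (t := Prod.snd ⁻¹' s) (fun p hp ↦ hs hp) ?_
    rw [Measure.compProd_apply (measurable_snd hsm)]
    refine (lintegral_congr fun x ↦ ?_).trans lintegral_zero
    have : ∀ᵐ y ∂κ x, y ∉ s := h.ae_kernel x (measure_eq_zero_iff_ae_notMem.1 hs0)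
    exact measure_eq_zero_iff_ae_notMem.2 this
  have h2 : ∀ n, ∀ᵐ z ∂Measure.pi (fun _ : Fin N ↦ μ ⊗ₘ κ),
      ∀ θ θ', |g θ (z n).2 - g θ' (z n).2| ≤ ℓ * dist θ θ' := fun n ↦
    (Measure.quasiMeasurePreserving_eval (fun _ : Fin N ↦ μ ⊗ₘ κ) n).ae h1
  filter_upwards [ae_all_iff.2 h2] with z hz
  refine continuous_finsetSum _ fun n _ ↦ Continuous.div_const (continuous_const.mul ?_) _
  exact (LipschitzWith.of_dist_le' fun θ θ' ↦ hz n θ θ').continuous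

/-- The uniform error of the mixture estimator. The supremum over all parameters, which need not be
measurable, is dominated by one over a countable dense set. -/
theorem exists_majorant_mixtureEstimator [IsFiniteMeasure ν] [IsMarkovKernel κ]
    [Nonempty X] [TopologicalSpace.SeparableSpace X]
    (h : DensityFamily ν κ k g lo hi ℓ) (hN : 0 < N)
    (hX : TotallyBounded X) (hℓ : 0 < ℓ) (hB : 0 < B) (hf : Measurable f)
    (hfB : ∀ y, |f y| ≤ B) (μ : Measure E) [IsProbabilityMeasure μ] :
    ∃ m : (Fin N → E × E) → ℝ≥0∞, Measurable m ∧
      (∀ᵐ z ∂Measure.pi (fun _ : Fin N ↦ μ ⊗ₘ κ), ∀ θ, ENNReal.ofReal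
        |mixtureEstimator k g f (fun n ↦ (z n).1) (fun n ↦ (z n).2) θ - ∫ v, f v * g θ v ∂ν|
          ≤ m z) ∧
      ∫⁻ z, m z ∂Measure.pi (fun _ : Fin N ↦ μ ⊗ₘ κ) ≤
        80 * ENNReal.ofReal (B * ℓ / (lo * √N)) * dudleyIntegral X +
          ENNReal.ofReal (3 * (B * hi / (lo * √N))) := by
  let t := TopologicalSpace.denseSeq X
  let m : (Fin N → E × E) → ℝ≥0∞ := fun z ↦ ⨆ i, ENNReal.ofReal
    |mixtureEstimator k g f (fun n ↦ (z n).1) (fun n ↦ (z n).2) (t i) - ∫ v, f v * g (t i) v ∂ν|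
  have hm : Measurable m := by
    refine Measurable.iSup fun i ↦ (measurable_abs.comp (Measurable.sub_const
      (Finset.measurable_sum _ fun n _ ↦ ?_) _)).ennreal_ofReal
    have hy : Measurable fun z : Fin N → E × E ↦ (z n).2 :=
      measurable_snd.comp (measurable_pi_apply n)
    refine ((hf.comp hy).mul ((h.measurable_g _).comp hy)).div
      (Finset.measurable_sum _ fun j _ ↦ ?_)
    exact h.measurable_k.comp ((measurable_fst.comp (measurable_pi_apply j)).prodMk hy)
  refine ⟨m, hm, ?_, lintegral_pi_compProd_le μ κ hm fun x ↦
    h.lintegral_mixtureEstimator_le hN hX hℓ hB hf hfB t x⟩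
  filter_upwards [h.ae_continuous_mixtureEstimator μ f N] with z hz θ
  have hclosed : IsClosed {θ | ENNReal.ofReal
      |mixtureEstimator k g f (fun n ↦ (z n).1) (fun n ↦ (z n).2) θ - ∫ v, f v * g θ v ∂ν|
        ≤ m z} :=
    isClosed_le (ENNReal.continuous_ofReal.comp (hz.sub (h.continuous_integral hf hfB)).abs)
      continuous_const
  refine hclosed.closure_subset_iff.2 ?_ ((TopologicalSpace.denseRange_denseSeq X) θ)
  rintro _ ⟨i, rfl⟩
  exact le_iSup (fun i ↦ ENNReal.ofReal
    |mixtureEstimator k g f (fun n ↦ (z n).1) (fun n ↦ (z n).2) (t i) - ∫ v, f v * g (t i) v ∂ν|) i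

theorem leaveOneOut_pos (h : DensityFamily ν κ k g lo hi ℓ) (hN : 2 ≤ N) (x y : Fin N → E)
    (θ : X) (n : Fin N) : 0 < g θ (y n) / ∑ j ∈ Finset.univ.erase n, k (x j) (y n) := by
  refine div_pos (h.lo_pos.trans_le (h.g_mem _ _).1) (Finset.sum_pos
    (fun j _ ↦ h.lo_pos.trans_le (h.k_mem _ _).1) ?_)
  rw [← Finset.card_pos, Finset.card_erase_of_mem (Finset.mem_univ n), Finset.card_univ,
    Fintype.card_fin]
  omega

/-- Normalizing the weights costs at most the error of the estimator of `∫ g_θ = 1`. -/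
theorem abs_selfNormalized_sub_le (h : DensityFamily ν κ k g lo hi ℓ) (hN : 2 ≤ N)
    (hfB : ∀ y, |f y| ≤ B) (x y : Fin N → E) (θ : X) (I : ℝ) :
    |∑ n, f (y n) * (g θ (y n) / (∑ j ∈ Finset.univ.erase n, k (x j) (y n)) /
        ∑ n', g θ (y n') / ∑ j ∈ Finset.univ.erase n', k (x j) (y n')) - I| ≤
      |leaveOneOutEstimator k g f x y θ - I| +
        B * |leaveOneOutEstimator k g (fun _ ↦ 1) x y θ - 1| := by
  let r : Fin N → ℝ := fun n ↦ g θ (y n) / ∑ j ∈ Finset.univ.erase n, k (x j) (y n)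
  have hr : ∀ n, 0 < r n := h.leaveOneOut_pos hN x y θ
  have hT : leaveOneOutEstimator k g f x y θ = ∑ n, f (y n) * r n := rfl
  have hT1 : leaveOneOutEstimator k g (fun _ ↦ 1) x y θ = ∑ n, r n := by
    simp [leaveOneOutEstimator, r]
  have hne : (Finset.univ : Finset (Fin N)).Nonempty := ⟨⟨0, by omega⟩, Finset.mem_univ _⟩
  have hR : 0 < ∑ n, r n := Finset.sum_pos (fun n _ ↦ hr n) hne
  have hsum : ∑ n, f (y n) * (g θ (y n) / (∑ j ∈ Finset.univ.erase n, k (x j) (y n)) /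
        ∑ n', g θ (y n') / ∑ j ∈ Finset.univ.erase n', k (x j) (y n')) =
      (∑ n, f (y n) * r n) / ∑ n, r n := by
    rw [Finset.sum_div]
    exact Finset.sum_congr rfl fun n _ ↦ (mul_div_assoc _ _ _).symm
  rw [hsum, hT, hT1]
  have hq : |(∑ n, f (y n) * r n) / ∑ n, r n| ≤ B := by
    rw [abs_div, abs_of_pos hR, div_le_iff₀ hR, Finset.mul_sum]
    refine (Finset.abs_sum_le_sum_abs _ _).trans (Finset.sum_le_sum fun n _ ↦ ?_)
    rw [abs_mul, abs_of_pos (hr n)]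
    exact mul_le_mul_of_nonneg_right (hfB _) (hr n).le
  set T := ∑ n, f (y n) * r n
  set R := ∑ n, r n
  have heq : T / R - I = (T - I) + T / R * (1 - R) := by
    field_simp
    ring
  rw [heq, abs_sub_comm R 1]
  refine (abs_add_le _ _).trans (add_le_add le_rfl ?_)
  rw [abs_mul]
  exact mul_le_mul_of_nonneg_right hq (abs_nonneg _)

/-- The uniform error of the self-normalized leave-one-out estimator, which is the one that the
weights of the mesh define. -/
theorem exists_majorant_selfNormalized [IsFiniteMeasure ν] [IsMarkovKernel κ]
    [Nonempty X] [TopologicalSpace.SeparableSpace X]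
    (h : DensityFamily ν κ k g lo hi ℓ) (hN : 2 ≤ N)
    (hX : TotallyBounded X) (hℓ : 0 < ℓ) (hB : 0 < B) (hf : Measurable f)
    (hfB : ∀ y, |f y| ≤ B) (μ : Measure E) [IsProbabilityMeasure μ] :
    ∃ m : (Fin N → E × E) → ℝ≥0∞, Measurable m ∧
      (∀ᵐ z ∂Measure.pi (fun _ : Fin N ↦ μ ⊗ₘ κ), ∀ θ, ENNReal.ofReal
        |∑ n, f (z n).2 * (g θ (z n).2 / (∑ j ∈ Finset.univ.erase n, k (z j).1 (z n).2) /
          ∑ n', g θ (z n').2 / ∑ j ∈ Finset.univ.erase n', k (z j).1 (z n').2)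
            - ∫ v, f v * g θ v ∂ν| ≤ m z) ∧
      ∫⁻ z, m z ∂Measure.pi (fun _ : Fin N ↦ μ ⊗ₘ κ) ≤
        160 * ENNReal.ofReal (B * ℓ / (lo * √N)) * dudleyIntegral X +
          ENNReal.ofReal (6 * (B * hi / (lo * √N))) +
          ENNReal.ofReal (2 * (B * hi ^ 2 / ((N - 1) * lo ^ 2))) := by
  obtain ⟨m, hm, hmz, hmi⟩ := h.exists_majorant_mixtureEstimator (N := N) (by omega) hX hℓ hB hf
    hfB μ
  obtain ⟨m₁, hm₁, hmz₁, hmi₁⟩ := h.exists_majorant_mixtureEstimator (N := N) (B := 1)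
    (f := fun _ ↦ 1) (by omega) hX hℓ one_pos measurable_const (by simp) μ
  have hN' : (2 : ℝ) ≤ N := by exact_mod_cast hN
  have hlo := h.lo_pos
  set e : ℝ := B * hi ^ 2 / ((N - 1) * lo ^ 2) with he
  have he0 : 0 ≤ e := div_nonneg (by positivity) (mul_nonneg (by linarith) (by positivity))
  refine ⟨fun z ↦ m z + ENNReal.ofReal B * m₁ z + ENNReal.ofReal (2 * e),
    (hm.add (hm₁.const_mul _)).add_const _, ?_, ?_⟩
  · filter_upwards [hmz, hmz₁] with z hz hz₁ θ
    have hz := hz θ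
    have hz₁ := hz₁ θ
    simp only [one_mul] at hz₁
    rw [h.integral_g] at hz₁
    set x : Fin N → E := fun n ↦ (z n).1
    set y : Fin N → E := fun n ↦ (z n).2
    set I := ∫ v, f v * g θ v ∂ν
    have h1 := h.abs_selfNormalized_sub_le hN hfB x y θ I
    have h2 := h.abs_leaveOneOutEstimator_sub_le hN hfB x y θ
    have h3 := h.abs_leaveOneOutEstimator_sub_le (f := fun _ ↦ 1) (B := 1) hN (by simp) x y θ
    have h4 : B * (1 * hi ^ 2 / ((N - 1) * lo ^ 2)) = e := by rw [he]; ring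
    have h5 := abs_sub_le (leaveOneOutEstimator k g f x y θ) (mixtureEstimator k g f x y θ) I
    have h6 := abs_sub_le (leaveOneOutEstimator k g (fun _ ↦ 1) x y θ)
      (mixtureEstimator k g (fun _ ↦ 1) x y θ) 1
    have h7 : B * |leaveOneOutEstimator k g (fun _ ↦ 1) x y θ - 1| ≤
        e + B * |mixtureEstimator k g (fun _ ↦ 1) x y θ - 1| := by
      rw [← h4, ← mul_add]
      exact mul_le_mul_of_nonneg_left (h6.trans (add_le_add h3 le_rfl)) hB.le
    refine (ENNReal.ofReal_le_ofReal (q := |mixtureEstimator k g f x y θ - I| +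
      B * |mixtureEstimator k g (fun _ ↦ 1) x y θ - 1| + 2 * e) (by linarith)).trans ?_
    refine ENNReal.ofReal_add_le.trans (add_le_add (ENNReal.ofReal_add_le.trans
      (add_le_add hz ?_)) le_rfl)
    rw [ENNReal.ofReal_mul hB.le]
    gcongr
  · rw [lintegral_add_right _ measurable_const, lintegral_add_left hm, lintegral_const,
      measure_univ, mul_one, lintegral_const_mul _ hm₁]
    refine add_le_add ?_ le_rfl
    refine (add_le_add hmi (mul_le_mul_right hmi₁ _)).trans (le_of_eq ?_)
    have hc : ENNReal.ofReal (B * ℓ / (lo * √N)) =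
        ENNReal.ofReal B * ENNReal.ofReal (1 * ℓ / (lo * √N)) := by
      rw [← ENNReal.ofReal_mul hB.le]
      congr 1
      ring
    have hθ : 0 ≤ hi := by
      obtain ⟨θ⟩ := ‹Nonempty X›
      by_contra hneg
      have hem : IsEmpty E := ⟨fun y ↦ hneg (h.hi_pos θ y).le⟩
      have := h.integral_g θ
      simp [Measure.eq_zero_of_isEmpty ν] at this
    have hd : ENNReal.ofReal (6 * (B * hi / (lo * √N))) =
        ENNReal.ofReal (3 * (B * hi / (lo * √N))) +
          ENNReal.ofReal B * ENNReal.ofReal (3 * (1 * hi / (lo * √N))) := by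
      rw [← ENNReal.ofReal_mul hB.le, ← ENNReal.ofReal_add (by positivity) (by positivity)]
      congr 1
      ring
    rw [hd, hc]
    ring

end DensityFamily

end OneStep

/-! ### The law of the controlled chain -/

theorem map_compProd_comap {T V W : Type*} [MeasurableSpace T] [MeasurableSpace V]
    [MeasurableSpace W] (ρ : Measure T) [IsFiniteMeasure ρ] (K : Kernel V W) [IsMarkovKernel K]
    {f : T → V} (hf : Measurable f) :
    (ρ ⊗ₘ K.comap f hf).map (Prod.map f id) = ρ.map f ⊗ₘ K := by
  ext s hs
  have hm : Measurable (Prod.map f (id : W → W)) := hf.prodMap measurable_id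
  rw [Measure.map_apply hm hs, Measure.compProd_apply (hm hs), Measure.compProd_apply hs,
    lintegral_map (Kernel.measurable_kernel_prodMk_left hs) hf]
  rfl

namespace MDP

section Law

variable {S A : Type*} [MeasurableSpace S] [MeasurableSpace A] (M : MDP S A) (π : Policy S A)
  (x : S)

instance : IsProbabilityMeasure (M.pathLaw π x) := by
  unfold pathLaw; infer_instance

/-- The law of the state and the action at time `n`. -/
noncomputable def pairLaw (n : ℕ) : Measure (S × A) := (M.pathLaw π x).map fun w ↦ w n

/-- The law of the state at time `n`. -/
noncomputable def stateLaw (n : ℕ) : Measure S := (M.pathLaw π x).map fun w ↦ (w n).1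

instance (n : ℕ) : IsProbabilityMeasure (M.pairLaw π x n) :=
  Measure.isProbabilityMeasure_map (measurable_pi_apply n).aemeasurable

instance (n : ℕ) : IsProbabilityMeasure (M.stateLaw π x n) :=
  Measure.isProbabilityMeasure_map (measurable_fst.comp (measurable_pi_apply n)).aemeasurable

theorem fst_pairLaw (n : ℕ) : (M.pairLaw π x n).fst = M.stateLaw π x n := by
  rw [Measure.fst, pairLaw, Measure.map_map measurable_fst (measurable_pi_apply n)]
  rfl

theorem pairLaw_zero : M.pairLaw π x 0 = Measure.dirac x ⊗ₘ π.π 0 := by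
  have h : (M.pathLaw π x).map (Preorder.frestrictLe 0) =
      (Measure.dirac x ⊗ₘ π.π 0).map
        (MeasurableEquiv.piUnique (fun _ : Finset.Iic 0 ↦ S × A)).symm := by
    rw [pathLaw, Kernel.trajMeasure, Measure.map_comp _ _ (by fun_prop),
      Kernel.traj_map_frestrictLe, Kernel.partialTraj_self, Measure.id_comp]
  have h2 := congrArg (Measure.map fun u : (_ : Finset.Iic 0) → S × A ↦
    u ⟨0, Finset.mem_Iic.2 le_rfl⟩) h
  rw [Measure.map_map (measurable_pi_apply _) (by fun_prop),
    Measure.map_map (measurable_pi_apply _) (by fun_prop)] at h2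
  refine (show M.pairLaw π x 0 = _ from h2).trans ?_
  convert Measure.map_id
  ext p <;> rfl

theorem map_pair_succ (n : ℕ) :
    (M.pathLaw π x).map (fun w ↦ (w n, w (n + 1))) =
      M.pairLaw π x n ⊗ₘ (M.P (n + 1) ⊗ₖ (π.π (n + 1)).prodMkLeft (S × A)) := by
  have h := Kernel.map_frestrictLe_trajMeasure_compProd_eq_map_trajMeasure
    (X := fun _ ↦ S × A) (μ₀ := Measure.dirac x ⊗ₘ π.π 0) (κ := M.step π) (a := n)
  have hproj : Measurable fun u : (_ : Finset.Iic n) → S × A ↦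
    u ⟨n, Finset.mem_Iic.2 le_rfl⟩ := measurable_pi_apply _
  have h2 := congrArg (Measure.map (Prod.map (fun u : (_ : Finset.Iic n) → S × A ↦
    u ⟨n, Finset.mem_Iic.2 le_rfl⟩) id)) h
  have : IsProbabilityMeasure ((M.pathLaw π x).map (Preorder.frestrictLe n)) :=
    Measure.isProbabilityMeasure_map (by fun_prop)
  rw [Measure.map_map (hproj.prodMap measurable_id) (by fun_prop)] at h2
  refine Eq.trans h2.symm ?_
  refine (map_compProd_comap ((M.pathLaw π x).map (Preorder.frestrictLe n)) _ hproj).trans ?_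
  rw [Measure.map_map hproj (by fun_prop)]
  rfl

theorem pairLaw_succ (n : ℕ) :
    M.pairLaw π x (n + 1) =
      (M.P (n + 1) ⊗ₖ (π.π (n + 1)).prodMkLeft (S × A)) ∘ₘ M.pairLaw π x n := by
  have hm : Measurable fun w : ℕ → S × A ↦ (w n, w (n + 1)) :=
    (measurable_pi_apply n).prodMk (measurable_pi_apply (n + 1))
  rw [← Measure.snd_compProd, ← map_pair_succ, Measure.snd, Measure.map_map measurable_snd hm]
  rfl

/-- Given the past, the next state is drawn from the transition function. -/
theorem map_pair_state_succ (n : ℕ) :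
    (M.pathLaw π x).map (fun w ↦ (w n, (w (n + 1)).1)) = M.pairLaw π x n ⊗ₘ M.P (n + 1) := by
  have hm : Measurable (Prod.map id Prod.fst : (S × A) × (S × A) → (S × A) × S) :=
    measurable_id.prodMap measurable_fst
  have h := congrArg (Measure.map (Prod.map id Prod.fst : (S × A) × (S × A) → (S × A) × S))
    (M.map_pair_succ π x n)
  rw [Measure.map_map hm ((measurable_pi_apply n).prodMk (measurable_pi_apply (n + 1)))] at h
  refine Eq.trans h ?_
  ext s hs
  rw [Measure.map_apply hm hs, Measure.compProd_apply (hm hs), Measure.compProd_apply hs]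
  refine lintegral_congr fun p ↦ ?_
  have h2 : (M.P (n + 1) ⊗ₖ (π.π (n + 1)).prodMkLeft (S × A)).fst = M.P (n + 1) :=
    Kernel.fst_compProd _ _
  conv_rhs => rw [← h2, Kernel.fst_apply' _ _ (measurable_prodMk_left hs)]
  rfl

theorem stateLaw_succ (n : ℕ) :
    M.stateLaw π x (n + 1) = M.P (n + 1) ∘ₘ M.pairLaw π x n := by
  have hm : Measurable fun w : ℕ → S × A ↦ (w n, (w (n + 1)).1) :=
    (measurable_pi_apply n).prodMk (measurable_fst.comp (measurable_pi_apply (n + 1)))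
  rw [← Measure.snd_compProd, ← map_pair_state_succ, Measure.snd,
    Measure.map_map measurable_snd hm]
  rfl

/-- Given the state, the action is drawn from the policy. -/
theorem pairLaw_eq_compProd (n : ℕ) : M.pairLaw π x n = M.stateLaw π x n ⊗ₘ π.π n := by
  cases n with
  | zero => rw [← fst_pairLaw, pairLaw_zero, Measure.fst_compProd]
  | succ n =>
    rw [pairLaw_succ, stateLaw_succ]
    ext s hs
    rw [Measure.bind_apply hs (Kernel.aemeasurable _), Measure.compProd_apply hs,
      Measure.lintegral_bind (Kernel.aemeasurable _)
        (Kernel.measurable_kernel_prodMk_left hs).aemeasurable]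
    refine lintegral_congr fun p ↦ ?_
    rw [Kernel.compProd_apply hs]
    rfl

/-- Under constant controls the states form a Markov chain. -/
theorem map_state_state_succ_const (b : ℕ → A) (n : ℕ) :
    (M.pathLaw (Policy.const b) x).map (fun w ↦ ((w n).1, (w (n + 1)).1)) =
      M.stateLaw (Policy.const b) x n ⊗ₘ
        (M.P (n + 1)).comap (fun s ↦ (s, b n)) (by fun_prop) := by
  have hm : Measurable (Prod.map Prod.fst id : (S × A) × S → S × S) :=
    measurable_fst.prodMap measurable_id
  have h := congrArg (Measure.map (Prod.map Prod.fst id : (S × A) × S → S × S))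
    (M.map_pair_state_succ (Policy.const b) x n)
  rw [Measure.map_map hm ((measurable_pi_apply n).prodMk
    (measurable_fst.comp (measurable_pi_apply (n + 1))))] at h
  refine Eq.trans h ?_
  ext s hs
  rw [Measure.map_apply hm hs, Measure.compProd_apply (hm hs), Measure.compProd_apply hs,
    pairLaw_eq_compProd, Measure.lintegral_compProd (Kernel.measurable_kernel_prodMk_left (hm hs))]
  refine lintegral_congr fun y ↦ ?_
  have hmeas : Measurable fun a ↦ M.P (n + 1) (y, a) (Prod.mk (y, a) ⁻¹'
      (Prod.map Prod.fst id ⁻¹' s)) :=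
    (Kernel.measurable_kernel_prodMk_left (hm hs)).comp measurable_prodMk_left
  simp only [Policy.const, Kernel.const_apply]
  rw [lintegral_dirac' _ hmeas]
  rfl

end Law

end MDP

/-! ### The reflected densities -/

section Density

variable {S A : Type*} [MeasureSpace S] [MeasurableSpace A] {M : MDP S A} {p : ℕ → A → S → S → ℝ}
  {h : ℕ}

namespace MDP.HasDensity

theorem measurable_density (hp : M.HasDensity p) (hh : h ∈ Finset.Icc 1 M.H) (a : A) (x : S) :
    Measurable fun y ↦ p h a y x :=
  (hp.measurable h hh).comp (measurable_const.prodMk (measurable_id.prodMk measurable_const))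

theorem kernel_apply (hp : M.HasDensity p) (hh : h ∈ Finset.Icc 1 M.H) (a : A) (x : S)
    {s : Set S} (hs : MeasurableSet s) :
    M.P h (x, a) s = ∫⁻ y in s, ENNReal.ofReal (p h a y x) := by
  rw [hp.eq_withDensity h hh, withDensity_apply _ hs]

theorem setIntegral_eq (hp : M.HasDensity p) (hh : h ∈ Finset.Icc 1 M.H) (a : A) (x : S)
    {s : Set S} (hs : MeasurableSet s) :
    ∫ y in s, p h a y x = (M.P h (x, a)).real s := by
  rw [integral_eq_lintegral_of_nonneg_ae (ae_of_all _ fun y ↦ hp.nonneg h hh a y x)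
    (hp.measurable_density hh a x).aestronglyMeasurable, ← hp.kernel_apply hh a x hs]
  rfl

theorem integrable_density (hp : M.HasDensity p) (hh : h ∈ Finset.Icc 1 M.H) (a : A) (x : S) :
    Integrable fun y ↦ p h a y x := by
  refine ⟨(hp.measurable_density hh a x).aestronglyMeasurable, ?_⟩
  rw [hasFiniteIntegral_iff_ofReal (ae_of_all _ fun y ↦ hp.nonneg h hh a y x),
    ← setLIntegral_univ, ← hp.kernel_apply hh a x MeasurableSet.univ]
  exact measure_lt_top _ _

theorem integral_eq_one (hp : M.HasDensity p) (hh : h ∈ Finset.Icc 1 M.H) (a : A) (x : S) :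
    ∫ y, p h a y x = 1 := by
  rw [← setIntegral_univ, hp.setIntegral_eq hh a x MeasurableSet.univ, probReal_univ]

end MDP.HasDensity

end Density

section Reflected

variable {d : ℕ} {S : Set (EuclideanSpace ℝ (Fin d))} {A : Type*} [MeasurableSpace A]
  {M : MDP S A} {p : ℕ → A → S → S → ℝ} {D : Set S} {h : ℕ}

namespace MDP.HasDensity

theorem reflectDensity_eq (hp : M.HasDensity p) (hD : MeasurableSet D)
    (hh : h ∈ Finset.Icc 1 M.H) (a : A) (y x : D) :
    reflectDensity D p h a y x =
      p h a y x + (volume.real D)⁻¹ * (M.P h ((x : S), a)).real Dᶜ := by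
  rw [reflectDensity, hp.setIntegral_eq hh a x hD.compl]

theorem reflectDensity_nonneg (hp : M.HasDensity p) (hD : MeasurableSet D)
    (hh : h ∈ Finset.Icc 1 M.H) (a : A) (y x : D) : 0 ≤ reflectDensity D p h a y x := by
  rw [hp.reflectDensity_eq hD hh]
  exact add_nonneg (hp.nonneg h hh _ _ _) (by positivity)

theorem measurable_reflectDensity (hp : M.HasDensity p) (hD : MeasurableSet D)
    (hh : h ∈ Finset.Icc 1 M.H) :
    Measurable fun z : A × D × D ↦ reflectDensity D p h z.1 z.2.1 z.2.2 := by
  have h1 : Measurable fun z : A × D × D ↦ (z.1, (z.2.1 : S), (z.2.2 : S)) := by fun_prop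
  have h2 : Measurable fun z : A × D × D ↦ ((z.2.2 : S), z.1) := by fun_prop
  simp_rw [hp.reflectDensity_eq hD hh]
  exact ((hp.measurable h hh).comp h1).add
    ((((M.P h).measurable_coe hD.compl).comp h2).ennreal_toReal.const_mul _)

end MDP.HasDensity

theorem lintegral_subtype_set (hD : MeasurableSet D) {s : Set D} (hs : MeasurableSet s)
    (F : S → ℝ≥0∞) : ∫⁻ y in s, F y = ∫⁻ y in Subtype.val '' s, F y := by
  have he := MeasurableEmbedding.subtype_coe hD
  have hpre : Subtype.val ⁻¹' (Subtype.val '' s) = s := preimage_image_eq s Subtype.val_injective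
  have h1 := he.lintegral_map (μ := (volume : Measure D).restrict s) F
  have h2 := he.restrict_map (volume : Measure D) (Subtype.val '' s)
  rw [hpre] at h2
  rw [← h1, ← h2, Measure.Subtype.volume_def, he.map_comap, Subtype.range_coe,
    Measure.restrict_restrict (he.measurableSet_image.2 hs),
    inter_eq_left.2 (Subtype.coe_image_subset D s)]

/-- The transition function of the reflected chain has the reflected densities. -/
theorem MDP.HasDensity.reflectKernel_apply (hp : M.HasDensity p) (hS : MeasurableSet S)
    (hD : IsCompact D) (h0 : 0 < volume D) (hh : h ∈ Finset.Icc 1 M.H) (x : D) (a : A) :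
    reflectKernel D (M.P h) (x, a) =
      (volume : Measure D).withDensity fun y ↦ ENNReal.ofReal (reflectDensity D p h a y x) := by
  have hDm : MeasurableSet D := hD.isClosed.measurableSet
  have := isProbabilityMeasure_unif hS hD h0
  have hfin := volume_ne_top hS hD
  ext s hs
  have he := MeasurableEmbedding.subtype_coe hDm
  have hms : MeasurableSet (Subtype.val '' s : Set S) := he.measurableSet_image.2 hs
  have hpre : reflectPoint D ⁻¹' s = ((Subtype.val '' s) ×ˢ univ) ∪ (Dᶜ ×ˢ s) := by
    ext ⟨y, z⟩
    by_cases hy : y ∈ D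
    · simp [reflectPoint, hy]
    · simp [reflectPoint, hy]
  have hdisj : Disjoint ((Subtype.val '' s : Set S) ×ˢ (univ : Set D)) (Dᶜ ×ˢ s) := by
    refine Set.disjoint_left.2 ?_
    rintro ⟨y, z⟩ ⟨⟨y', -, rfl⟩, -⟩ ⟨hy, -⟩
    exact hy y'.2
  rw [reflectKernel, Kernel.map_apply' _ (measurable_reflectPoint hDm) _ hs, Kernel.prod_apply,
    hpre, measure_union hdisj (hDm.compl.prod hs), Measure.prod_prod, Measure.prod_prod,
    Kernel.comap_apply, Kernel.const_apply, measure_univ, mul_one, withDensity_apply _ hs]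
  have hv : 0 < volume.real D := ENNReal.toReal_pos h0.ne' hfin
  have hsplit : ∀ y : D, ENNReal.ofReal (reflectDensity D p h a y x) =
      ENNReal.ofReal (p h a y x) +
        (volume D)⁻¹ * M.P h ((x : S), a) Dᶜ := by
    intro y
    rw [hp.reflectDensity_eq hDm hh, ENNReal.ofReal_add (hp.nonneg h hh _ _ _) (by positivity),
      ENNReal.ofReal_mul (by positivity), ENNReal.ofReal_inv_of_pos hv, measureReal_def,
      measureReal_def,
      ENNReal.ofReal_toReal hfin, ENNReal.ofReal_toReal (measure_ne_top _ _)]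
  simp_rw [hsplit]
  rw [lintegral_add_right _ measurable_const, setLIntegral_const,
    lintegral_subtype_set hDm hs fun y ↦ ENNReal.ofReal (p h a y x), ← hp.kernel_apply hh a x hms,
    unif, Measure.smul_apply, smul_eq_mul]
  ring

theorem MDP.HasDensity.reflect (hp : M.HasDensity p) (hS : MeasurableSet S)
    (hD : IsCompact D) (h0 : 0 < volume D) :
    (M.reflect hS hD h0).HasDensity (reflectDensity D p) where
  measurable _ hh := hp.measurable_reflectDensity hD.isClosed.measurableSet hh
  nonneg _ hh := hp.reflectDensity_nonneg hD.isClosed.measurableSet hh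
  eq_withDensity _ hh x a := hp.reflectKernel_apply hS hD h0 hh x a

/-- The reflected densities inherit two-sided bounds. Their upper bound is not `Λ`, as the mass
that leaves `D` is spread over `D`, but the ratio of the bounds is still of the order `Λ / δ`. -/
theorem exists_reflectDensity_mem_Icc [PseudoMetricSpace A] {δ Λ L : ℝ≥0} (hp : M.HasDensity p)
    (hS : MeasurableSet S) (hD : IsCompact D) (h0 : 0 < volume D)
    (hloc : LocalDensityBounds p M.H D δ Λ L) (hΛ : δ ≤ Λ) :
    ∃ lo hi : ℝ, δ ≤ lo ∧ hi ≤ 3 * (Λ / δ) * lo ∧ ∀ h ∈ Finset.Icc 1 M.H, ∀ a, ∀ y x : D,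
      reflectDensity D p h a y x ∈ Icc lo hi := by
  have hDm : MeasurableSet D := hD.isClosed.measurableSet
  have hfin := volume_ne_top hS hD
  set v : ℝ := volume.real D with hv
  have hv0 : 0 < v := ENNReal.toReal_pos h0.ne' hfin
  have hδ : (0 : ℝ) < δ := hloc.δ_pos
  have hδΛ : (δ : ℝ) ≤ Λ := hΛ
  have hratio : 1 ≤ (Λ : ℝ) / δ := (one_le_div hδ).2 hδΛ
  have hmass : ∀ h ∈ Finset.Icc 1 M.H, ∀ a, ∀ x : D,
      1 - Λ * v ≤ (M.P h ((x : S), a)).real Dᶜ := by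
    intro h hh a x
    rw [probReal_compl_eq_one_sub hDm, ← hp.setIntegral_eq hh a x hDm]
    have : ∫ y in D, p h a y x ≤ ∫ _ in D, (Λ : ℝ) :=
      setIntegral_mono_on (hp.integrable_density hh a x).integrableOn
        (integrableOn_const hfin) hDm fun y hy ↦ (hloc.bounds h hh a x x.2 y hy).2
    rw [setIntegral_const, smul_eq_mul, ← hv] at this
    linarith [mul_comm v Λ]
  -- if `Λ λ(D)` is small, at least half of the mass leaves `D`, and its uniform redistribution
  -- dominates the densities from below; otherwise it adds at most `λ(D)⁻¹ ≤ 2 Λ`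
  rcases le_total ((Λ : ℝ) * v) (1 / 2) with hsmall | hlarge
  · refine ⟨δ + 1 / 2 * v⁻¹, Λ + v⁻¹, by linarith [inv_pos.2 hv0], ?_, fun h hh a y x ↦ ?_⟩
    · have h1 : 3 * (Λ / δ : ℝ) * (δ + 1 / 2 * v⁻¹) = 3 * Λ + (Λ / δ) * (3 / 2 * v⁻¹) := by
        field_simp
      rw [h1]
      have h2 : 1 * (3 / 2 * v⁻¹) ≤ (Λ / δ : ℝ) * (3 / 2 * v⁻¹) :=
        mul_le_mul_of_nonneg_right hratio (by positivity)
      linarith [inv_pos.2 hv0]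
    · rw [hp.reflectDensity_eq hDm hh]
      have hb := hloc.bounds h hh a x x.2 y y.2
      have hm := hmass h hh a x
      have hm1 : (M.P h ((x : S), a)).real Dᶜ ≤ 1 := measureReal_le_one
      have hv1 := inv_pos.2 hv0
      constructor <;> nlinarith
  · refine ⟨δ, 3 * Λ, le_rfl, le_of_eq (by field_simp), fun h hh a y x ↦ ?_⟩
    rw [hp.reflectDensity_eq hDm hh]
    have hb := hloc.bounds h hh a x x.2 y y.2
    have hm1 : (M.P h ((x : S), a)).real Dᶜ ≤ 1 := measureReal_le_one
    have hm0 : 0 ≤ (M.P h ((x : S), a)).real Dᶜ := measureReal_nonneg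
    have hv1 : v⁻¹ ≤ 2 * Λ := by
      rw [inv_le_iff_one_le_mul₀ hv0]
      linarith
    have hv2 := inv_pos.2 hv0
    constructor
    · linarith [hb.1, mul_nonneg hv2.le hm0]
    · linarith [hb.2, mul_le_of_le_one_right hv2.le hm1]

/-- The reflected densities inherit the Lipschitz bound. -/
theorem ae_reflectDensity_sub_le [PseudoMetricSpace A] {δ Λ L : ℝ≥0} (hp : M.HasDensity p)
    (hS : MeasurableSet S) (hD : IsCompact D)
    (hloc : LocalDensityBounds p M.H D δ Λ L) (hh : h ∈ Finset.Icc 1 M.H) :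
    ∀ᵐ y : D, ∀ a a' : A, ∀ x x' : D, |reflectDensity D p h a y x - reflectDensity D p h a' y x'| ≤
      L * (dist x x' + dist a a') := by
  have hDm : MeasurableSet D := hD.isClosed.measurableSet
  have hfin := volume_ne_top hS hD
  obtain ⟨ℒ, hℒ, hℒ0, hlip, hle⟩ := hloc.lipschitz
  set e := eLpNorm ℒ ∞ (volume.restrict D) with he
  set e' := eLpNorm ℒ 1 (volume.restrict Dᶜ) with he'
  have hefin : e ≠ ⊤ := ne_top_of_le_ne_top ENNReal.coe_ne_top (le_self_add.trans hle)
  have he'fin : (volume D)⁻¹ * e' ≠ ⊤ :=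
    ne_top_of_le_ne_top ENNReal.coe_ne_top (le_add_self.trans hle)
  have he'fin' : e' ≠ ⊤ := fun htop ↦ he'fin (by
    rw [htop, ENNReal.mul_top (ENNReal.inv_ne_zero.2 hfin)])
  have hint : Integrable ℒ (volume.restrict Dᶜ) :=
    memLp_one_iff_integrable.1 ⟨hℒ.aestronglyMeasurable, he'fin'.lt_top⟩
  have hreal : e.toReal + (volume.real D)⁻¹ * ∫ y in Dᶜ, ℒ y ≤ L := by
    have h1 : ∫ y in Dᶜ, ℒ y = e'.toReal := by
      rw [integral_eq_lintegral_of_nonneg_ae (ae_of_all _ hℒ0) hℒ.aestronglyMeasurable, he',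
        eLpNorm_one_eq_lintegral_enorm]
      congr 1
      refine lintegral_congr fun y ↦ ?_
      rw [Real.enorm_of_nonneg (hℒ0 y)]
    have h2 := ENNReal.toReal_mono ENNReal.coe_ne_top hle
    rw [ENNReal.toReal_add hefin he'fin, ENNReal.toReal_mul, ENNReal.toReal_inv] at h2
    rw [h1]
    exact h2
  have hae : ∀ᵐ y ∂volume.restrict D, ℒ y ≤ e.toReal := by
    filter_upwards [ae_le_eLpNormEssSup (f := ℒ) (μ := volume.restrict D)] with y hy
    rw [← eLpNorm_exponent_top, ← he, Real.enorm_of_nonneg (hℒ0 y)] at hy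
    exact (ENNReal.ofReal_le_iff_le_toReal hefin).1 hy
  rw [ae_restrict_iff_subtype hDm] at hae
  filter_upwards [hae] with y hy a a' x x'
  set r := dist x x' + dist a a' with hr
  have hr0 : 0 ≤ r := by positivity
  have h1 : |p h a y x - p h a' y x'| ≤ e.toReal * r :=
    (hlip h hh a a' x x.2 x' x'.2 y).trans (mul_le_mul_of_nonneg_right hy hr0)
  have h2 : |(∫ z in Dᶜ, p h a z x) - ∫ z in Dᶜ, p h a' z x'| ≤ (∫ z in Dᶜ, ℒ z) * r := by
    rw [← integral_sub (hp.integrable_density hh a x).integrableOn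
      (hp.integrable_density hh a' x').integrableOn, ← integral_mul_const, ← Real.norm_eq_abs]
    exact norm_integral_le_of_norm_le (hint.mul_const r)
      (ae_of_all _ fun z ↦ hlip h hh a a' x x.2 x' x'.2 z)
  have hv : 0 ≤ (volume.real D)⁻¹ := by positivity
  calc |reflectDensity D p h a y x - reflectDensity D p h a' y x'|
      = |(p h a y x - p h a' y x') + (volume.real D)⁻¹ *
          ((∫ z in Dᶜ, p h a z x) - ∫ z in Dᶜ, p h a' z x')| := by
        rw [reflectDensity, reflectDensity]
        ring_nf
    _ ≤ e.toReal * r + (volume.real D)⁻¹ * ((∫ z in Dᶜ, ℒ z) * r) := by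
        refine (abs_add_le _ _).trans (add_le_add h1 ?_)
        rw [abs_mul, abs_of_nonneg hv]
        exact mul_le_mul_of_nonneg_left h2 hv
    _ = (e.toReal + (volume.real D)⁻¹ * ∫ y in Dᶜ, ℒ y) * r := by ring
    _ ≤ L * r := mul_le_mul_of_nonneg_right hreal hr0

end Reflected

/-! ### Dynamic programming with densities -/

namespace MDP

section OptStage

variable {E A : Type*} [MeasureSpace E] [MeasurableSpace A]

/-- The backward recursion for the optimal value: `optStage M q j` is the value function at time
`H - j` of the process with transition densities `q`. -/
noncomputable def optStage (M : MDP E A) (q : ℕ → A → E → E → ℝ) : ℕ → E → ℝ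
  | 0 => M.F
  | j + 1 => fun x ↦ ⨆ a : A, (M.R (M.H - (j + 1)) x a +
      ∫ y, M.optStage q j y * q (M.H - (j + 1) + 1) a y x)

variable {M : MDP E A} {q : ℕ → A → E → E → ℝ} {G : ℝ} {j : ℕ}

theorem HasDensity.abs_integral_mul_le (hq : M.HasDensity q) {h : ℕ} (hh : h ∈ Finset.Icc 1 M.H)
    {v : E → ℝ} {K : ℝ} (hv : ∀ y, |v y| ≤ K) (a : A) (x : E) :
    |∫ y, v y * q h a y x| ≤ K := by
  calc |∫ y, v y * q h a y x| ≤ ∫ y, K * q h a y x := by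
        rw [← Real.norm_eq_abs]
        refine norm_integral_le_of_norm_le ((hq.integrable_density hh a x).const_mul K)
          (ae_of_all _ fun y ↦ ?_)
        rw [Real.norm_eq_abs, abs_mul, abs_of_nonneg (hq.nonneg h hh a y x)]
        exact mul_le_mul_of_nonneg_right (hv y) (hq.nonneg h hh a y x)
    _ = K := by rw [integral_const_mul, hq.integral_eq_one hh, mul_one]

theorem stage_mem_Icc (hj : j + 1 ≤ M.H) : M.H - (j + 1) + 1 ∈ Finset.Icc 1 M.H := by
  rw [Finset.mem_Icc]; omega

theorem abs_optStage_le [Nonempty A] (hq : M.HasDensity q) (hR : ∀ h < M.H, ∀ x a, |M.R h x a| ≤ G)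
    (hF : ∀ x, |M.F x| ≤ G) (hj : j ≤ M.H) (x : E) : |M.optStage q j x| ≤ (j + 1) * G := by
  induction j generalizing x with
  | zero => simpa [optStage] using hF x
  | succ j ih =>
    have hb : ∀ a, |M.R (M.H - (j + 1)) x a +
        ∫ y, M.optStage q j y * q (M.H - (j + 1) + 1) a y x| ≤ (j + 1 + 1) * G := by
      intro a
      have h1 := hR (M.H - (j + 1)) (by omega) x a
      have h2 := hq.abs_integral_mul_le (stage_mem_Icc hj) (fun y ↦ ih (by omega) y) a x
      exact (abs_add_le _ _).trans (by linarith)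
    push_cast
    rw [optStage, abs_le]
    constructor
    · let a := Classical.arbitrary A
      refine ((abs_le.1 (hb a)).1).trans (le_ciSup (f := fun a ↦ M.R (M.H - (j + 1)) x a +
        ∫ y, M.optStage q j y * q (M.H - (j + 1) + 1) a y x) ⟨(j + 1 + 1) * G, ?_⟩ a)
      rintro _ ⟨a, rfl⟩
      exact (abs_le.1 (hb a)).2
    · exact ciSup_le fun a ↦ (abs_le.1 (hb a)).2

/-- The value of the action `a` in the state `x` at time `H - (j + 1)`, if the play is optimal
afterwards. -/
noncomputable def actionValue (M : MDP E A) (q : ℕ → A → E → E → ℝ) (j : ℕ) (x : E) (a : A) : ℝ :=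
  M.R (M.H - (j + 1)) x a + ∫ y, M.optStage q j y * q (M.H - (j + 1) + 1) a y x

theorem optStage_succ (x : E) : M.optStage q (j + 1) x = ⨆ a, M.actionValue q j x a := rfl

theorem abs_actionValue_le [Nonempty A] (hq : M.HasDensity q)
    (hR : ∀ h < M.H, ∀ x a, |M.R h x a| ≤ G) (hF : ∀ x, |M.F x| ≤ G) (hj : j + 1 ≤ M.H) (x : E)
    (a : A) : |M.actionValue q j x a| ≤ (j + 1 + 1) * G := by
  have h1 := hR (M.H - (j + 1)) (by omega) x a
  have h2 := hq.abs_integral_mul_le (stage_mem_Icc hj)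
    (fun y ↦ abs_optStage_le hq hR hF (by omega : j ≤ M.H) y) a x
  exact (abs_add_le _ _).trans (by linarith)

theorem bddAbove_actionValue [Nonempty A] (hq : M.HasDensity q)
    (hR : ∀ h < M.H, ∀ x a, |M.R h x a| ≤ G) (hF : ∀ x, |M.F x| ≤ G) (hj : j + 1 ≤ M.H) (x : E) :
    BddAbove (range (M.actionValue q j x)) := by
  refine ⟨(j + 1 + 1) * G, ?_⟩
  rintro _ ⟨a, rfl⟩
  exact (abs_le.1 (abs_actionValue_le hq hR hF hj x a)).2

theorem measurable_actionValue [SFinite (volume : Measure E)] (hq : M.HasDensity q)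
    (hj : j + 1 ≤ M.H) (hv : AEMeasurable (M.optStage q j)) :
    Measurable (Function.uncurry (M.actionValue q j)) := by
  have h1 : ∀ x a, ∫ y, M.optStage q j y * q (M.H - (j + 1) + 1) a y x =
      ∫ y, hv.mk _ y * q (M.H - (j + 1) + 1) a y x := fun x a ↦
    integral_congr_ae (hv.ae_eq_mk.mono fun y hy ↦ by simp only [hy])
  have h2 : Measurable fun z : (E × A) × E ↦
      hv.mk _ z.2 * q (M.H - (j + 1) + 1) z.1.2 z.2 z.1.1 :=
    (hv.measurable_mk.comp measurable_snd).mul ((hq.measurable _ (stage_mem_Icc hj)).comp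
      (f := fun z : (E × A) × E ↦ (z.1.2, z.2, z.1.1)) (by fun_prop))
  have h3 := h2.stronglyMeasurable.integral_prod_right' (ν := (volume : Measure E))
  have h4 : Function.uncurry (M.actionValue q j) = fun z ↦
      Function.uncurry (M.R (M.H - (j + 1))) z +
      ∫ y, hv.mk _ y * q (M.H - (j + 1) + 1) z.2 y z.1 := by
    ext ⟨x, a⟩
    exact congrArg _ (h1 x a)
  rw [h4]
  exact (M.measurable_R _).add h3.measurable

theorem aemeasurable_optStage [StandardBorelSpace E] [StandardBorelSpace A] [Nonempty A]
    [IsFiniteMeasure (volume : Measure E)] (hq : M.HasDensity q)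
    (hR : ∀ h < M.H, ∀ x a, |M.R h x a| ≤ G) (hF : ∀ x, |M.F x| ≤ G) (hj : j ≤ M.H) :
    AEMeasurable (M.optStage q j) := by
  induction j with
  | zero => exact M.measurable_F.aemeasurable
  | succ j ih =>
    exact aemeasurable_iSup_of_measurable (measurable_actionValue hq hj (ih (by omega)))
      (bddAbove_actionValue hq hR hF hj) _

/-- An almost everywhere `ε`-optimal measurable choice of actions, which is `ε`-optimal in a
prescribed state. -/
theorem exists_measurable_near_optimal [StandardBorelSpace E] [StandardBorelSpace A] [Nonempty A]
    [IsFiniteMeasure (volume : Measure E)] (hq : M.HasDensity q)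
    (hR : ∀ h < M.H, ∀ x a, |M.R h x a| ≤ G) (hF : ∀ x, |M.F x| ≤ G) (hj : j + 1 ≤ M.H)
    {ε : ℝ} (hε : 0 < ε) (x₀ : E) :
    ∃ α : E → A, Measurable α ∧
      (∀ᵐ x, M.optStage q (j + 1) x - ε ≤ M.actionValue q j x (α x)) ∧
      M.optStage q (j + 1) x₀ - ε ≤ M.actionValue q j x₀ (α x₀) := by
  classical
  have hv := aemeasurable_optStage hq hR hF hj
  have hQ := measurable_actionValue hq hj (aemeasurable_optStage hq hR hF (by omega : j ≤ M.H))
  have hB : MeasurableSet {z : E × A | hv.mk _ z.1 - ε < Function.uncurry (M.actionValue q j) z} :=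
    measurableSet_lt ((hv.measurable_mk.comp measurable_fst).sub_const ε) hQ
  have hex : ∀ x, ∃ a, M.optStage q (j + 1) x - ε < M.actionValue q j x a := fun x ↦
    exists_lt_of_lt_ciSup (by rw [← optStage_succ]; linarith)
  obtain ⟨α, hα, hsel⟩ := exists_measurable_selection hB volume
  obtain ⟨a₀, ha₀⟩ := hex x₀
  refine ⟨fun x ↦ if x = x₀ then a₀ else α x,
    Measurable.ite (measurableSet_singleton x₀) measurable_const hα, ?_, ?_⟩
  · filter_upwards [hsel, hv.ae_eq_mk] with x hx hxv
    by_cases h : x = x₀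
    · subst h
      simpa using ha₀.le
    · simp only [h, if_false]
      obtain ⟨a, ha⟩ := hex x
      rw [hxv] at ha ⊢
      exact le_of_lt (hx ⟨a, ha⟩)
  · simpa using ha₀.le

end OptStage

end MDP

/-! ### Comparison of the reflected and the original problem -/

theorem integrable_of_abs_le {T : Type*} [MeasurableSpace T] {μ : Measure T} [IsFiniteMeasure μ]
    {f : T → ℝ} (hf : Measurable f) {K : ℝ} (hK : ∀ z, |f z| ≤ K) : Integrable f μ :=
  Integrable.of_bound hf.aestronglyMeasurable K (ae_of_all _ hK)

namespace MDP

section Chain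

variable {S A : Type*} [MeasurableSpace S] [MeasurableSpace A] (M : MDP S A) (π : Policy S A)
  (x : S)

theorem integral_stateLaw (n : ℕ) {f : S → ℝ} (hf : Measurable f) :
    ∫ z, f z.1 ∂M.pairLaw π x n = ∫ y, f y ∂M.stateLaw π x n := by
  rw [← fst_pairLaw, Measure.fst, integral_map measurable_fst.aemeasurable
    hf.aestronglyMeasurable]

theorem integral_stateLaw_succ (n : ℕ) {f : S → ℝ} (hf : Measurable f) {K : ℝ}
    (hK : ∀ y, |f y| ≤ K) :
    ∫ y, f y ∂M.stateLaw π x (n + 1) = ∫ z, ∫ y, f y ∂M.P (n + 1) z ∂M.pairLaw π x n := by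
  have hf2 : Measurable fun z : (S × A) × S ↦ f z.2 := hf.comp measurable_snd
  rw [stateLaw_succ, ← Measure.snd_compProd, Measure.snd,
    integral_map measurable_snd.aemeasurable hf.aestronglyMeasurable,
    Measure.integral_compProd (integrable_of_abs_le hf2 fun z ↦ hK z.2)]

theorem measurable_integral_kernel (n : ℕ) {f : S → ℝ} (hf : Measurable f) :
    Measurable fun z ↦ ∫ y, f y ∂M.P n z :=
  (StronglyMeasurable.integral_kernel hf.stronglyMeasurable).measurable

theorem abs_integral_kernel_le (n : ℕ) {f : S → ℝ} {K : ℝ}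
    (hK : ∀ y, |f y| ≤ K) (z : S × A) : |∫ y, f y ∂M.P n z| ≤ K := by
  simpa using norm_integral_le_of_norm_le_const (μ := M.P n z) (f := f) (C := K) (ae_of_all _ hK)

theorem measureReal_stateLaw_succ (n : ℕ) {B : Set S} (hB : MeasurableSet B) :
    (M.stateLaw π x (n + 1)).real B = ∫ z, (M.P (n + 1) z).real B ∂M.pairLaw π x n := by
  have h := M.integral_stateLaw_succ π x n (f := B.indicator 1) (measurable_one.indicator hB)
    (K := 1) fun y ↦ by
      by_cases hy : y ∈ B <;> simp [hy]
  simpa only [integral_indicator_one hB] using h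

theorem policyValue_eq_sum {G : ℝ} (hR : ∀ h < M.H, ∀ x a, |M.R h x a| ≤ G)
    (hF : ∀ x, |M.F x| ≤ G) :
    M.policyValue π x = ∑ t ∈ Finset.range M.H, ∫ z, M.R t z.1 z.2 ∂M.pairLaw π x t +
      ∫ y, M.F y ∂M.stateLaw π x M.H := by
  have hmR : ∀ t, Measurable fun w : ℕ → S × A ↦ M.R t (w t).1 (w t).2 := fun t ↦
    (M.measurable_R t).comp (measurable_pi_apply t)
  have hmF : Measurable fun w : ℕ → S × A ↦ M.F (w M.H).1 :=
    M.measurable_F.comp (measurable_fst.comp (measurable_pi_apply _))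
  have hint : ∀ t ∈ Finset.range M.H,
      Integrable (fun w : ℕ → S × A ↦ M.R t (w t).1 (w t).2) (M.pathLaw π x) := fun t ht ↦
    integrable_of_abs_le (hmR t) fun w ↦ hR t (Finset.mem_range.1 ht) _ _
  rw [policyValue, integral_add (integrable_finsetSum _ hint)
    (integrable_of_abs_le hmF fun w ↦ hF _), integral_finsetSum _ hint]
  congr 1
  · refine Finset.sum_congr rfl fun t _ ↦ ?_
    rw [pairLaw, integral_map (measurable_pi_apply t).aemeasurable
      (M.measurable_R t).aestronglyMeasurable]
  · have hfst : Measurable fun w : ℕ → S × A ↦ (w M.H).1 :=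
      measurable_fst.comp (measurable_pi_apply _)
    rw [stateLaw, integral_map hfst.aemeasurable M.measurable_F.aestronglyMeasurable]

theorem abs_policyValue_le {G : ℝ} (hR : ∀ h < M.H, ∀ x a, |M.R h x a| ≤ G)
    (hF : ∀ x, |M.F x| ≤ G) : |M.policyValue π x| ≤ (M.H + 1) * G := by
  rw [policyValue, ← Real.norm_eq_abs]
  refine (norm_integral_le_of_norm_le_const (C := (M.H + 1) * G) (ae_of_all _ fun w ↦ ?_)).trans_eq
    (by simp)
  refine (norm_add_le _ _).trans ?_
  have h1 : ‖∑ t ∈ Finset.range M.H, M.R t (w t).1 (w t).2‖ ≤ M.H * G := by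
    refine (norm_sum_le_of_le _ fun t ht ↦ hR t (Finset.mem_range.1 ht) _ _).trans_eq ?_
    simp
  have h2 : ‖M.F (w M.H).1‖ ≤ G := hF _
  linarith

theorem stateLaw_zero : M.stateLaw π x 0 = Measure.dirac x := by
  rw [← fst_pairLaw, pairLaw_zero, Measure.fst_compProd]

/-- One step of a telescoping sum: a pointwise drift inequality, with an error term off `Bᶜ` that
is charged to the probability of `B`, is integrated along the chain. -/
theorem integral_drift_le {n : ℕ} {B : Set S} (hB : MeasurableSet B) {U U' : S → ℝ}
    (hU : Measurable U) (hU' : Measurable U') {G K s ε : ℝ} (hUK : ∀ y, |U y| ≤ K)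
    (hUK' : ∀ y, |U' y| ≤ K) (hR : ∀ x a, |M.R n x a| ≤ G)
    (hdrift : ∀ᵐ z ∂M.pairLaw π x n,
      s * (M.R n z.1 z.2 + ∫ y, U' y ∂M.P (n + 1) z - U z.1) ≤
        ε + K * (M.P (n + 1) z).real B + (K + G) * B.indicator 1 z.1) :
    s * (∫ z, M.R n z.1 z.2 ∂M.pairLaw π x n + ∫ y, U' y ∂M.stateLaw π x (n + 1) -
        ∫ y, U y ∂M.stateLaw π x n) ≤
      ε + K * (M.stateLaw π x (n + 1)).real B + (K + G) * (M.stateLaw π x n).real B := by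
  have hi1 : Integrable (fun z : S × A ↦ M.R n z.1 z.2) (M.pairLaw π x n) :=
    integrable_of_abs_le (M.measurable_R n) fun z ↦ hR z.1 z.2
  have hi2 : Integrable (fun z ↦ ∫ y, U' y ∂M.P (n + 1) z) (M.pairLaw π x n) :=
    integrable_of_abs_le (M.measurable_integral_kernel _ hU') (M.abs_integral_kernel_le _ hUK')
  have hi3 : Integrable (fun z : S × A ↦ U z.1) (M.pairLaw π x n) :=
    integrable_of_abs_le (hU.comp measurable_fst) fun z ↦ hUK z.1
  have hi4 : Integrable (fun z ↦ (M.P (n + 1) z).real B) (M.pairLaw π x n) :=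
    integrable_of_abs_le (((M.P (n + 1)).measurable_coe hB).ennreal_toReal) (K := 1) fun z ↦ by
      rw [abs_of_nonneg (by positivity)]
      exact measureReal_le_one
  have hi5 : Integrable (fun z : S × A ↦ B.indicator (1 : S → ℝ) z.1) (M.pairLaw π x n) :=
    integrable_of_abs_le ((measurable_one.indicator hB).comp measurable_fst) (K := 1) fun z ↦ by
      by_cases hz : z.1 ∈ B <;> simp [hz]
  have hi12 : Integrable (fun z ↦ M.R n z.1 z.2 + ∫ y, U' y ∂M.P (n + 1) z) (M.pairLaw π x n) :=
    hi1.add hi2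
  have hi14 : Integrable (fun z ↦ ε + K * (M.P (n + 1) z).real B) (M.pairLaw π x n) :=
    (integrable_const ε).add (hi4.const_mul K)
  have h := integral_mono_ae ((hi12.sub hi3).const_mul s)
    (hi14.add (hi5.const_mul (K + G))) hdrift
  have hL : ∫ z, s * (M.R n z.1 z.2 + ∫ y, U' y ∂M.P (n + 1) z - U z.1) ∂M.pairLaw π x n =
      s * (∫ z, M.R n z.1 z.2 ∂M.pairLaw π x n + ∫ y, U' y ∂M.stateLaw π x (n + 1) -
        ∫ y, U y ∂M.stateLaw π x n) := by
    rw [integral_const_mul, integral_sub hi12 hi3, integral_add hi1 hi2,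
      ← M.integral_stateLaw_succ π x n hU' hUK', M.integral_stateLaw π x n hU]
  have hRt : ∫ z, (ε + K * (M.P (n + 1) z).real B + (K + G) * B.indicator 1 z.1)
      ∂M.pairLaw π x n =
      ε + K * (M.stateLaw π x (n + 1)).real B + (K + G) * (M.stateLaw π x n).real B := by
    rw [integral_add hi14 (hi5.const_mul (K + G)),
      integral_add (integrable_const ε) (hi4.const_mul K), integral_const_mul, integral_const_mul,
      ← M.measureReal_stateLaw_succ π x n hB,
      M.integral_stateLaw π x n (measurable_one.indicator hB), integral_indicator_one hB]
    simp
  rw [← hL, ← hRt]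
  exact h

end Chain

theorem HasDensity.ae_stateLaw {S A : Type*} [MeasureSpace S] [MeasurableSingletonClass S]
    [MeasurableSpace A] {M : MDP S A} {p : ℕ → A → S → S → ℝ} (hp : M.HasDensity p)
    (π : Policy S A) {x : S} {T : S → Prop} (hT : ∀ᵐ y, T y) (hx : T x) {n : ℕ} (hn : n ≤ M.H) :
    ∀ᵐ y ∂M.stateLaw π x n, T y := by
  cases n with
  | zero =>
    rw [stateLaw_zero, ae_dirac_eq]
    exact hx
  | succ n =>
    obtain ⟨s, hs, hsm, hs0⟩ := exists_measurable_superset_of_null (ae_iff.1 hT)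
    refine measure_mono_null hs ?_
    rw [stateLaw_succ, Measure.bind_apply hsm (Kernel.aemeasurable _)]
    refine (lintegral_congr fun z ↦ ?_).trans lintegral_zero
    rw [hp.kernel_apply (by rw [Finset.mem_Icc]; omega) z.2 z.1 hsm]
    exact setLIntegral_measure_zero _ _ hs0

end MDP

section Reflected

variable {d : ℕ} {S : Set (EuclideanSpace ℝ (Fin d))} {A : Type*} [MeasurableSpace A]
  {M : MDP S A} {p : ℕ → A → S → S → ℝ} {D : Set S}

/-- A bounded, almost everywhere measurable function on `D` has a measurable version on the whole
space that vanishes off `D` and keeps its value in one prescribed point. -/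
theorem exists_measurable_extension (hD : MeasurableSet D) {v : D → ℝ} (hv : AEMeasurable v)
    {K : ℝ} (hK : ∀ y, |v y| ≤ K) (x₀ : D) :
    ∃ U : S → ℝ, Measurable U ∧ (∀ y, |U y| ≤ K) ∧ (∀ y ∉ D, U y = 0) ∧ U x₀ = v x₀ ∧
      ∀ᵐ y : D, U y = v y := by
  classical
  have he := MeasurableEmbedding.subtype_coe hD
  let w : D → ℝ := fun y ↦ if y = x₀ then v x₀ else max (-K) (min K (hv.mk v y))
  have hK0 : 0 ≤ K := (abs_nonneg _).trans (hK x₀)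
  have hw : Measurable w := Measurable.ite (measurableSet_singleton x₀) measurable_const
    (measurable_const.max (measurable_const.min hv.measurable_mk))
  have hwK : ∀ y, |w y| ≤ K := by
    intro y
    by_cases h : y = x₀
    · simpa [w, h] using hK x₀
    · simp only [w, h, if_false]
      exact abs_le.2 ⟨le_max_left _ _, max_le (by linarith) (min_le_left _ _)⟩
  have hU : ∀ y : D, Function.extend Subtype.val w (0 : S → ℝ) y = w y := fun y ↦
    Subtype.val_injective.extend_apply w (0 : S → ℝ) y
  have hU0 : ∀ y ∉ D, Function.extend Subtype.val w (0 : S → ℝ) y = 0 := fun y hy ↦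
    Function.extend_apply' w (0 : S → ℝ) y fun ⟨z, hz⟩ ↦ hy (hz ▸ z.2)
  refine ⟨Function.extend Subtype.val w (0 : S → ℝ), he.measurable_extend hw measurable_const,
    fun y ↦ ?_,
    hU0, (hU x₀).trans (if_pos rfl), ?_⟩
  · by_cases hy : y ∈ D
    · exact (congrArg abs (hU ⟨y, hy⟩)).trans_le (hwK _)
    · simpa [hU0 y hy] using hK0
  · filter_upwards [hv.ae_eq_mk] with y hy
    rw [hU]
    by_cases h : y = x₀
    · simp [w, h]
    · simp only [w, h, if_false, ← hy]
      rw [min_eq_right (abs_le.1 (hK y)).2, max_eq_right (abs_le.1 (hK y)).1]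

/-- Integrating against the reflected density and against the transition function differs by the
mass that leaves `D`. -/
theorem abs_integral_reflectDensity_sub_le (hp : M.HasDensity p) (hS : MeasurableSet S)
    (hD : IsCompact D) (h0 : 0 < volume D) {h : ℕ} (hh : h ∈ Finset.Icc 1 M.H) {v : D → ℝ}
    (hv : AEMeasurable v) {K : ℝ} (hK : ∀ y, |v y| ≤ K) {U : S → ℝ} (hU0 : ∀ y ∉ D, U y = 0)
    (hUv : ∀ᵐ y : D, U y = v y) (x : D) (a : A) :
    |(∫ y, v y * reflectDensity D p h a y x) - ∫ y, U y ∂M.P h ((x : S), a)| ≤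
      K * (M.P h ((x : S), a)).real Dᶜ := by
  have hDm : MeasurableSet D := hD.isClosed.measurableSet
  have hfin := volume_ne_top hS hD
  have he := MeasurableEmbedding.subtype_coe hDm
  have hvol : (volume : Measure D) univ = volume D := by
    rw [Measure.Subtype.volume_def, he.comap_apply]
    simp
  have : IsFiniteMeasure (volume : Measure D) := ⟨by rw [hvol]; exact hfin.lt_top⟩
  have hv0 : 0 < volume.real D := ENNReal.toReal_pos h0.ne' hfin
  set m := (M.P h ((x : S), a)).real Dᶜ with hm
  have hm0 : 0 ≤ m := measureReal_nonneg
  have hpi : Integrable fun y : D ↦ p h a y x := by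
    refine (he.integrable_map_iff (μ := (volume : Measure D)) (g := fun y ↦ p h a y x)).1 ?_
    rw [Measure.Subtype.volume_def, he.map_comap]
    exact (hp.integrable_density hh a x).restrict
  have hvi : Integrable v := Integrable.of_bound hv.aestronglyMeasurable K (ae_of_all _ hK)
  have hvp : Integrable fun y : D ↦ v y * p h a y x :=
    hpi.bdd_mul hv.aestronglyMeasurable (ae_of_all _ hK)
  have h1 : ∫ y, U y ∂M.P h ((x : S), a) = ∫ y : D, v y * p h a y x := by
    rw [hp.eq_withDensity h hh, integral_withDensity_ofReal (hp.measurable_density hh a x)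
      fun y ↦ hp.nonneg h hh a y x]
    have h2 : ∫ y in D, p h a y x * U y = ∫ y, p h a y x * U y :=
      setIntegral_eq_integral_of_forall_compl_eq_zero fun y hy ↦ by rw [hU0 y hy, mul_zero]
    rw [← h2, ← integral_subtype hDm fun y ↦ p h a y x * U y]
    refine integral_congr_ae (hUv.mono fun y hy ↦ ?_)
    simp only [hy, mul_comm]
  have h2 : ∫ y, v y * reflectDensity D p h a y x =
      (∫ y : D, v y * p h a y x) + ((volume.real D)⁻¹ * m) * ∫ y, v y := by
    rw [← integral_const_mul, ← integral_add hvp (hvi.const_mul _)]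
    congr 1 with y
    rw [hp.reflectDensity_eq hDm hh]
    ring
  have h3 : |∫ y, v y| ≤ K * volume.real D := by
    refine (norm_integral_le_of_norm_le_const (f := v) (C := K) (ae_of_all _ hK)).trans_eq ?_
    rw [measureReal_def, hvol]
    rfl
  rw [h1, h2, add_sub_cancel_left, abs_mul, abs_of_nonneg (by positivity)]
  calc (volume.real D)⁻¹ * m * |∫ y, v y| ≤ (volume.real D)⁻¹ * m * (K * volume.real D) := by
        gcongr
    _ = K * m := by field_simp

theorem isFiniteMeasure_volume_subtype (hS : MeasurableSet S) (hD : IsCompact D) :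
    IsFiniteMeasure (volume : Measure D) := by
  have he := MeasurableEmbedding.subtype_coe hD.isClosed.measurableSet
  refine ⟨?_⟩
  rw [Measure.Subtype.volume_def, he.comap_apply]
  simpa using (volume_ne_top hS hD).lt_top

end Reflected

section Comparison

variable {d : ℕ} {S : Set (EuclideanSpace ℝ (Fin d))} {A : Type*} [MeasurableSpace A]
  [StandardBorelSpace A] [Nonempty A] {M : MDP S A} {p : ℕ → A → S → S → ℝ} {D : Set S} {G : ℝ}

/-- If the actions of `π` are optimal up to `ε` (for `s = -1`; for `s = 1` the hypothesis holds for
every policy, with `ε = 0`) in the reflected problem, then the value of `π` in the original problem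
compares with the optimal value of the reflected problem up to the exit probabilities. -/
theorem mul_policyValue_sub_le (hp : M.HasDensity p) (hS : MeasurableSet S) (hD : IsCompact D)
    (h0 : 0 < volume D) (hR : ∀ h < M.H, ∀ x a, |M.R h x a| ≤ G) (hF : ∀ x, |M.F x| ≤ G)
    (x₀ : D) (π : Policy S A) {s ε : ℝ} (hs : |s| ≤ 1) (hε : 0 ≤ ε)
    (hopt : ∀ n < M.H, ∀ᵐ z ∂M.pairLaw π x₀ n, ∀ hz : z.1 ∈ D,
      s * ((M.reflect hS hD h0).actionValue (reflectDensity D p) (M.H - (n + 1)) ⟨z.1, hz⟩ z.2 -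
        (M.reflect hS hD h0).optStage (reflectDensity D p) (M.H - n) ⟨z.1, hz⟩) ≤ ε) :
    s * (M.policyValue π x₀ - (M.reflect hS hD h0).optStage (reflectDensity D p) M.H x₀) ≤
      M.H * ε + (2 * M.H + 3) * G *
        ∑ l ∈ Finset.range (M.H + 1), (M.stateLaw π x₀ l).real Dᶜ := by
  have hDm : MeasurableSet D := hD.isClosed.measurableSet
  have := hS.standardBorel
  have := hDm.standardBorel
  have := isFiniteMeasure_volume_subtype hS hD
  set M' := M.reflect hS hD h0 with hM'
  set q := reflectDensity D p with hq_def
  have hq : M'.HasDensity q := hp.reflect hS hD h0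
  have hR' : ∀ h < M'.H, ∀ x a, |M'.R h x a| ≤ G := fun h hh x a ↦ hR h hh x a
  have hF' : ∀ x, |M'.F x| ≤ G := fun x ↦ hF x
  have hG : 0 ≤ G := (abs_nonneg _).trans (hF x₀)
  set K : ℝ := (M.H + 1) * G with hK_def
  have hK0 : 0 ≤ K := by positivity
  have hvK : ∀ j ≤ M.H, ∀ y, |M'.optStage q j y| ≤ K := by
    intro j hj y
    refine (MDP.abs_optStage_le hq hR' hF' hj y).trans ?_
    have : (j : ℝ) ≤ M.H := by exact_mod_cast hj
    rw [hK_def]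
    gcongr
  have hvm : ∀ j ≤ M.H, AEMeasurable (M'.optStage q j) := fun j hj ↦
    MDP.aemeasurable_optStage hq hR' hF' hj
  -- Borel versions of the reflected value functions, extended by zero to the whole state space
  choose! U hU hUK hU0 hUx hUv using fun j (hj : j ≤ M.H) ↦
    exists_measurable_extension hDm (hvm j hj) (hvK j hj) x₀
  have hUS : ∀ j ≤ M.H, ∀ n ≤ M.H, ∀ᵐ y ∂M.stateLaw π x₀ n,
      ∀ hy : y ∈ D, U j y = M'.optStage q j ⟨y, hy⟩ := by
    intro j hj n hn
    refine hp.ae_stateLaw π (T := fun y ↦ ∀ hy : y ∈ D, U j y = M'.optStage q j ⟨y, hy⟩) ?_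
      (fun _ ↦ hUx j hj) hn
    have h1 := hUv j hj
    rw [Measure.Subtype.volume_def] at h1
    have h2 : ∀ᵐ y ∂(volume : Measure S).restrict D,
        ∀ hy : y ∈ D, U j y = M'.optStage q j ⟨y, hy⟩ := by
      rw [ae_restrict_iff_subtype hDm]
      exact h1.mono fun y hy _ ↦ hy
    exact ((ae_restrict_iff' hDm).1 h2).mono fun y hy hyD ↦ hy hyD hyD
  let P : ℕ → ℝ := fun l ↦ (M.stateLaw π x₀ l).real Dᶜ
  let r : ℕ → ℝ := fun n ↦ ∫ z, M.R n z.1 z.2 ∂M.pairLaw π x₀ n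
  let e : ℕ → ℝ := fun n ↦ ∫ y, U (M.H - n) y ∂M.stateLaw π x₀ n
  have hstep : ∀ n ∈ Finset.range M.H,
      s * (r n + e (n + 1) - e n) ≤ ε + K * P (n + 1) + (K + G) * P n := by
    intro n hn
    have hn : n < M.H := Finset.mem_range.1 hn
    have hi : M.H - (n + 1) ≤ M.H := Nat.sub_le _ _
    refine M.integral_drift_le π x₀ hDm.compl (hU _ (Nat.sub_le _ _)) (hU _ hi)
      (hUK _ (Nat.sub_le _ _)) (hUK _ hi) (hR n hn) ?_
    have hae : ∀ᵐ z ∂M.pairLaw π x₀ n, ∀ hz : z.1 ∈ D,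
        U (M.H - n) z.1 = M'.optStage q (M.H - n) ⟨z.1, hz⟩ := by
      have h := hUS (M.H - n) (Nat.sub_le _ _) n hn.le
      rw [← MDP.fst_pairLaw] at h
      exact ae_of_ae_map measurable_fst.aemeasurable h
    filter_upwards [hae, hopt n hn] with z hzU hzopt
    have hP0 : 0 ≤ (M.P (n + 1) z).real Dᶜ := measureReal_nonneg
    have hsle : ∀ t, s * t ≤ |t| := fun t ↦ (le_abs_self _).trans (by
      rw [abs_mul]
      exact mul_le_of_le_one_left (abs_nonneg _) hs)
    by_cases hz : z.1 ∈ D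
    · rw [hzU hz]
      have h1 := hzopt hz
      set v := M'.optStage q (M.H - n) ⟨z.1, hz⟩
      set Q := M'.actionValue q (M.H - (n + 1)) ⟨z.1, hz⟩ z.2 with hQ
      set J := ∫ y, U (M.H - (n + 1)) y ∂M.P (n + 1) z
      have h2 : |Q - (M.R n z.1 z.2 + J)| ≤ K * (M.P (n + 1) z).real Dᶜ := by
        have h3 := abs_integral_reflectDensity_sub_le hp hS hD h0 (h := n + 1)
          (by rw [Finset.mem_Icc]; omega) (hvm _ hi) (hvK _ hi) (hU0 _ hi) (hUv _ hi)
          ⟨z.1, hz⟩ z.2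
        have h4 : Q = M.R n z.1 z.2 + ∫ y, M'.optStage q (M.H - (n + 1)) y *
            q (n + 1) z.2 y ⟨z.1, hz⟩ := by
          have hidx : M'.H - (M.H - (n + 1) + 1) = n := by
            change M.H - (M.H - (n + 1) + 1) = n
            omega
          rw [hQ, MDP.actionValue, hidx]
          rfl
        rw [h4, add_sub_add_left_eq_sub]
        exact h3
      have h3 := hsle (M.R n z.1 z.2 + J - Q)
      rw [abs_sub_comm] at h3
      have h4 : s * (M.R n z.1 z.2 + J - v) = s * (Q - v) + s * (M.R n z.1 z.2 + J - Q) := by ring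
      have h5 : Dᶜ.indicator (1 : S → ℝ) z.1 = 0 := by simp [hz]
      rw [h4, h5]
      linarith
    · have h1 : Dᶜ.indicator (1 : S → ℝ) z.1 = 1 := by simp [hz]
      rw [hU0 _ (Nat.sub_le _ _) z.1 hz, h1, sub_zero]
      have h2 := hsle (M.R n z.1 z.2 + ∫ y, U (M.H - (n + 1)) y ∂M.P (n + 1) z)
      have h3 := abs_add_le (M.R n z.1 z.2) (∫ y, U (M.H - (n + 1)) y ∂M.P (n + 1) z)
      have h4 := hR n hn z.1 z.2
      have h5 := M.abs_integral_kernel_le (n + 1) (hUK _ hi) z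
      have h6 := mul_nonneg hK0 hP0
      linarith
  have hterm : s * (∫ y, M.F y ∂M.stateLaw π x₀ M.H - e M.H) ≤ G * P M.H := by
    have hFi : Integrable M.F (M.stateLaw π x₀ M.H) := integrable_of_abs_le M.measurable_F hF
    have hUi : Integrable (U 0) (M.stateLaw π x₀ M.H) :=
      integrable_of_abs_le (hU 0 (Nat.zero_le _)) (hUK 0 (Nat.zero_le _))
    have hIi : Integrable (Dᶜ.indicator (1 : S → ℝ)) (M.stateLaw π x₀ M.H) :=
      integrable_of_abs_le (measurable_one.indicator hDm.compl) (K := 1) fun y ↦ by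
        by_cases hy : y ∈ D <;> simp [hy]
    simp only [e, P]
    rw [Nat.sub_self, ← integral_sub hFi hUi, ← integral_const_mul,
      ← integral_indicator_one hDm.compl, ← integral_const_mul]
    refine integral_mono_ae ((hFi.sub hUi).const_mul s) (hIi.const_mul G) ?_
    filter_upwards [hUS 0 (Nat.zero_le _) M.H le_rfl] with y hy
    by_cases hyD : y ∈ D
    · have h1 : U 0 y = M.F y := hy hyD
      simp [h1, hyD]
    · have h1 : s * (M.F y - 0) ≤ |M.F y - 0| := (le_abs_self _).trans (by
        rw [abs_mul]
        exact mul_le_of_le_one_left (abs_nonneg _) hs)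
      have h2 := hF y
      simp only [hU0 0 (Nat.zero_le _) y hyD, mem_compl_iff, hyD, not_false_eq_true,
        indicator_of_mem, Pi.one_apply, mul_one]
      rw [sub_zero] at h1 ⊢
      linarith
  have he0 : e 0 = M'.optStage q M.H x₀ := by
    simp only [e]
    rw [MDP.stateLaw_zero, integral_dirac, Nat.sub_zero, hUx _ le_rfl]
  have hsum := Finset.sum_le_sum hstep
  have hL : ∑ n ∈ Finset.range M.H, s * (r n + e (n + 1) - e n) =
      s * (∑ n ∈ Finset.range M.H, r n + e M.H - e 0) := by
    rw [← Finset.mul_sum]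
    simp_rw [add_sub_assoc]
    rw [Finset.sum_add_distrib, Finset.sum_range_sub]
  have hRt : ∑ n ∈ Finset.range M.H, (ε + K * P (n + 1) + (K + G) * P n) =
      M.H * ε + K * ∑ n ∈ Finset.range M.H, P (n + 1) + (K + G) * ∑ n ∈ Finset.range M.H, P n := by
    rw [Finset.sum_add_distrib, Finset.sum_add_distrib, ← Finset.mul_sum, ← Finset.mul_sum]
    simp
  have hP0 : ∀ l, 0 ≤ P l := fun l ↦ measureReal_nonneg
  have hS1 : ∑ n ∈ Finset.range M.H, P (n + 1) ≤ ∑ l ∈ Finset.range (M.H + 1), P l := by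
    rw [Finset.sum_range_succ' P]
    linarith [hP0 0]
  have hS2 : ∑ n ∈ Finset.range M.H, P n + P M.H = ∑ l ∈ Finset.range (M.H + 1), P l :=
    (Finset.sum_range_succ P M.H).symm
  rw [hL, hRt] at hsum
  rw [M.policyValue_eq_sum π x₀ hR hF, ← he0]
  have hval : s * (∑ n ∈ Finset.range M.H, r n + ∫ y, M.F y ∂M.stateLaw π x₀ M.H - e 0) =
      s * (∑ n ∈ Finset.range M.H, r n + e M.H - e 0) +
        s * (∫ y, M.F y ∂M.stateLaw π x₀ M.H - e M.H) := by ring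
  have hKG : (2 * M.H + 3) * G = K + (K + G) := by rw [hK_def]; ring
  refine hval.trans_le ?_
  rw [hKG]
  have hKS := mul_le_mul_of_nonneg_left hS1 hK0
  have hPK := mul_nonneg hK0 (hP0 M.H)
  have : (K + G) * ∑ l ∈ Finset.range (M.H + 1), P l =
      (K + G) * ∑ n ∈ Finset.range M.H, P n + (K + G) * P M.H := by rw [← hS2]; ring
  change _ ≤ M.H * ε + (K + (K + G)) * ∑ l ∈ Finset.range (M.H + 1), P l
  linarith

/-- The policy that applies measurable maps from states to actions. -/
noncomputable def Policy.deterministic {S A : Type*} [MeasurableSpace S]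
    [MeasurableSpace A] (α : ℕ → S → A) (hα : ∀ n, Measurable (α n)) : Policy S A where
  π t := Kernel.deterministic (α t) (hα t)
  markov _ := inferInstance

/-- The optimal values of the reflected and of the original problem differ at most by the exit
probabilities. -/
theorem abs_optStage_sub_optValue_le (hp : M.HasDensity p) (hS : MeasurableSet S)
    (hD : IsCompact D) (h0 : 0 < volume D) (hR : ∀ h < M.H, ∀ x a, |M.R h x a| ≤ G)
    (hF : ∀ x, |M.F x| ≤ G) (x₀ : D) {β : ℕ → ℝ}
    (hβ : ∀ (π : Policy S A) l, (M.stateLaw π x₀ l).real Dᶜ ≤ β l) :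
    |(M.reflect hS hD h0).optStage (reflectDensity D p) M.H x₀ - M.optValue x₀| ≤
      (2 * M.H + 3) * G * ∑ l ∈ Finset.range (M.H + 1), β l := by
  classical
  have hDm : MeasurableSet D := hD.isClosed.measurableSet
  have := hS.standardBorel
  have := hDm.standardBorel
  have := isFiniteMeasure_volume_subtype hS hD
  set M' := M.reflect hS hD h0 with hM'
  set q := reflectDensity D p with hq_def
  have hq : M'.HasDensity q := hp.reflect hS hD h0
  have hR' : ∀ h < M'.H, ∀ x a, |M'.R h x a| ≤ G := fun h hh x a ↦ hR h hh x a
  have hF' : ∀ x, |M'.F x| ≤ G := fun x ↦ hF x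
  have hG : 0 ≤ G := (abs_nonneg _).trans (hF x₀)
  have hsum : ∀ π : Policy S A, (2 * M.H + 3) * G *
      ∑ l ∈ Finset.range (M.H + 1), (M.stateLaw π x₀ l).real Dᶜ ≤
        (2 * M.H + 3) * G * ∑ l ∈ Finset.range (M.H + 1), β l := by
    intro π
    gcongr with l
    exact hβ π l
  have hbdd : BddAbove (range fun π : Policy S A ↦ M.policyValue π x₀) := by
    refine ⟨(M.H + 1) * G, ?_⟩
    rintro _ ⟨π, rfl⟩
    exact (abs_le.1 (M.abs_policyValue_le π x₀ hR hF)).2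
  have hne : Nonempty (Policy S A) := ⟨Policy.const fun _ ↦ Classical.arbitrary A⟩
  rw [abs_sub_le_iff]
  constructor
  · -- an almost everywhere near-optimal selector defines a near-optimal policy
    rw [sub_le_iff_le_add]
    refine le_of_forall_pos_le_add fun ε hε ↦ ?_
    set η : ℝ := ε / (M.H + 1) with hη
    have hη0 : 0 < η := by positivity
    have hsel : ∀ n < M.H, ∃ α : D → A, Measurable α ∧
        (∀ᵐ x, M'.optStage q (M.H - n) x - η ≤ M'.actionValue q (M.H - (n + 1)) x (α x)) ∧
        M'.optStage q (M.H - n) x₀ - η ≤ M'.actionValue q (M.H - (n + 1)) x₀ (α x₀) := by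
      intro n hn
      have h := MDP.exists_measurable_near_optimal hq hR' hF' (j := M.H - (n + 1))
        (show M.H - (n + 1) + 1 ≤ M.H by omega) hη0 x₀
      rwa [show M.H - (n + 1) + 1 = M.H - n by omega] at h
    choose! α hα hα1 hα2 using hsel
    let a₀ := Classical.arbitrary A
    let γ : ℕ → S → A := fun n ↦
      if n < M.H then Function.extend Subtype.val (α n) fun _ ↦ a₀ else fun _ ↦ a₀
    have hγ : ∀ n, Measurable (γ n) := by
      intro n
      by_cases hn : n < M.H
      · simp only [γ, hn, if_true]
        exact (MeasurableEmbedding.subtype_coe hDm).measurable_extend (hα n hn) measurable_const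
      · simp only [γ, hn, if_false]
        exact measurable_const
    have hγD : ∀ n < M.H, ∀ y (hy : y ∈ D), γ n y = α n ⟨y, hy⟩ := by
      intro n hn y hy
      simp only [γ, hn, if_true]
      exact Subtype.val_injective.extend_apply (α n) (fun _ ↦ a₀) ⟨y, hy⟩
    set π : Policy S A := Policy.deterministic γ hγ with hπ
    have hmain := mul_policyValue_sub_le hp hS hD h0 hR hF x₀ π (s := -1) (ε := η) (by simp)
      hη0.le (by
        intro n hn
        have hstate : ∀ᵐ y ∂M.stateLaw π x₀ n, ∀ hy : y ∈ D,
            M'.optStage q (M.H - n) ⟨y, hy⟩ - η ≤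
              M'.actionValue q (M.H - (n + 1)) ⟨y, hy⟩ (γ n y) := by
          refine hp.ae_stateLaw π (T := fun y ↦ ∀ hy : y ∈ D,
            M'.optStage q (M.H - n) ⟨y, hy⟩ - η ≤
              M'.actionValue q (M.H - (n + 1)) ⟨y, hy⟩ (γ n y)) ?_ ?_ hn.le
          · have h1 := hα1 n hn
            rw [Measure.Subtype.volume_def] at h1
            have h2 : ∀ᵐ y ∂(volume : Measure S).restrict D, ∀ hy : y ∈ D,
                M'.optStage q (M.H - n) ⟨y, hy⟩ - η ≤
                  M'.actionValue q (M.H - (n + 1)) ⟨y, hy⟩ (γ n y) := by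
              rw [ae_restrict_iff_subtype hDm]
              refine h1.mono fun y hy hyD ↦ ?_
              rw [hγD n hn y hyD]
              exact hy
            exact ((ae_restrict_iff' hDm).1 h2).mono fun y hy hyD ↦ hy hyD hyD
          · intro hy
            rw [hγD n hn x₀ hy]
            exact hα2 n hn
        have hpair : M.pairLaw π x₀ n = (M.stateLaw π x₀ n).map fun y ↦ (y, γ n y) := by
          rw [MDP.pairLaw_eq_compProd]
          exact Measure.compProd_deterministic (hγ n)
        have hact : ∀ᵐ z ∂M.pairLaw π x₀ n, z.2 = γ n z.1 := by
          have hg : Measurable fun y ↦ (y, γ n y) := measurable_id.prodMk (hγ n)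
          have hset : MeasurableSet {z : S × A | z.2 = γ n z.1} :=
            measurableSet_eq_fun measurable_snd ((hγ n).comp measurable_fst)
          rw [hpair]
          exact (ae_map_iff hg.aemeasurable hset).2 (ae_of_all _ fun y ↦ rfl)
        rw [← MDP.fst_pairLaw] at hstate
        filter_upwards [hact, ae_of_ae_map measurable_fst.aemeasurable hstate] with z hz hzs hzD
        have h3 := hzs hzD
        rw [hz]
        linarith)
    have h1 := hsum π
    have h2 : M.policyValue π x₀ ≤ M.optValue x₀ := le_ciSup hbdd π
    have h3 : M.H * η ≤ ε := by
      rw [hη, mul_div_assoc', div_le_iff₀ (by positivity)]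
      nlinarith
    linarith
  · rw [sub_le_iff_le_add]
    refine ciSup_le fun π ↦ ?_
    have hmain := mul_policyValue_sub_le hp hS hD h0 hR hF x₀ π (s := 1) (ε := 0) (by simp) le_rfl
      (by
        intro n hn
        refine ae_of_all _ fun z hz ↦ ?_
        have h := le_ciSup (MDP.bddAbove_actionValue hq hR' hF' (j := M.H - (n + 1))
          (show M.H - (n + 1) + 1 ≤ M.H by omega) ⟨z.1, hz⟩) z.2
        rw [← MDP.optStage_succ, show M.H - (n + 1) + 1 = M.H - n by omega] at h
        linarith)
    have h1 := hsum π
    linarith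

end Comparison

/-! ### The backward recursion on the mesh -/

namespace MDP

section Mesh

/-- The data that enter one step of the recursion: a state, the transitions of the `N` chains, and
the values in their end points. -/
abbrev StepData (E : Type*) (N : ℕ) := E × (Fin N → E × E) × (Fin N → ℝ)

theorem sum_weight_le_one {E A : Type*} {q : ℕ → A → E → E → ℝ} {b : ℕ → A} {N h : ℕ}
    (s : Fin N → ℕ → E) (x : E) (a : A) :
    ∑ n, weight q b s h n x a ≤ 1 := by
  simp only [weight]
  rw [← Finset.sum_div]
  exact div_self_le_one _

variable {E A : Type*} [MeasureSpace E] [MeasurableSpace A] {M : MDP E A}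
  {q : ℕ → A → E → E → ℝ} {b : ℕ → A} {G K : ℝ} {N : ℕ} {j h : ℕ}

theorem weight_nonneg (hq : M.HasDensity q) (hh : h + 1 ∈ Finset.Icc 1 M.H) (s : Fin N → ℕ → E)
    (n : Fin N) (x : E) (a : A) : 0 ≤ weight q b s h n x a := by
  have h1 : ∀ n, 0 ≤ q (h + 1) a (s n (h + 1)) x /
      ∑ k ∈ Finset.univ.erase n, q (h + 1) (b h) (s n (h + 1)) (s k h) := fun n ↦
    div_nonneg (hq.nonneg _ hh _ _ _) (Finset.sum_nonneg fun k _ ↦ hq.nonneg _ hh _ _ _)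
  exact div_nonneg (h1 n) (Finset.sum_nonneg fun n _ ↦ h1 n)

theorem abs_sum_mul_weight_le (hq : M.HasDensity q) (hh : h + 1 ∈ Finset.Icc 1 M.H)
    (s : Fin N → ℕ → E) (x : E) (a : A) {v : Fin N → ℝ} (hK : 0 ≤ K) (hv : ∀ n, |v n| ≤ K) :
    |∑ n, v n * weight q b s h n x a| ≤ K := by
  calc |∑ n, v n * weight q b s h n x a| ≤ ∑ n, K * weight q b s h n x a := by
        refine (Finset.abs_sum_le_sum_abs _ _).trans (Finset.sum_le_sum fun n _ ↦ ?_)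
        have hw := weight_nonneg (b := b) hq hh s n x a
        rw [abs_mul, abs_of_nonneg hw]
        exact mul_le_mul_of_nonneg_right (hv n) hw
    _ = K * ∑ n, weight q b s h n x a := (Finset.mul_sum _ _ _).symm
    _ ≤ K := mul_le_of_le_one_right hK (sum_weight_le_one s x a)

theorem abs_meshStage_le [Nonempty A] (hq : M.HasDensity q)
    (hR : ∀ h < M.H, ∀ x a, |M.R h x a| ≤ G) (hF : ∀ x, |M.F x| ≤ G) (s : Fin N → ℕ → E)
    (hj : j ≤ M.H) (x : E) : |M.meshStage q b s j x| ≤ (j + 1) * G := by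
  have hG : 0 ≤ G := (abs_nonneg _).trans (hF x)
  induction j generalizing x with
  | zero => simpa [meshStage] using hF x
  | succ j ih =>
    have hb : ∀ a, |M.R (M.H - (j + 1)) x a + ∑ n, M.meshStage q b s j
        (s n (M.H - (j + 1) + 1)) * weight q b s (M.H - (j + 1)) n x a| ≤ (j + 1 + 1) * G := by
      intro a
      have h1 := hR (M.H - (j + 1)) (by omega) x a
      have h2 := abs_sum_mul_weight_le (b := b) hq (stage_mem_Icc hj) s x a
        (mul_nonneg (by positivity) hG)
        (fun n ↦ ih (by omega) (s n (M.H - (j + 1) + 1)))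
      exact (abs_add_le _ _).trans (by linarith)
    push_cast
    rw [meshStage, abs_le]
    constructor
    · let a := Classical.arbitrary A
      refine ((abs_le.1 (hb a)).1).trans (le_ciSup (f := fun a ↦ M.R (M.H - (j + 1)) x a +
        ∑ n, M.meshStage q b s j (s n (M.H - (j + 1) + 1)) *
          weight q b s (M.H - (j + 1)) n x a) ⟨(j + 1 + 1) * G, ?_⟩ a)
      rintro _ ⟨a, rfl⟩
      exact (abs_le.1 (hb a)).2
    · exact ciSup_le fun a ↦ (abs_le.1 (hb a)).2

/-- The values of the algorithm are random variables. The supremum over the actions is universally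
measurable as a function of the finitely many mesh points and values that it involves. -/
theorem aemeasurable_meshStage [StandardBorelSpace E] [StandardBorelSpace A] [Nonempty A]
    (hq : M.HasDensity q) (hR : ∀ h < M.H, ∀ x a, |M.R h x a| ≤ G) (hF : ∀ x, |M.F x| ≤ G)
    {Ω : Type*} [MeasurableSpace Ω] {Pr : Measure Ω} [IsFiniteMeasure Pr] {X : Fin N → ℕ → Ω → E}
    (hX : ∀ n, ∀ t ≤ M.H, Measurable (X n t)) (hj : j ≤ M.H) {ξ : Ω → E} (hξ : Measurable ξ) :
    AEMeasurable (fun ω ↦ M.meshStage q b (fun n t ↦ X n t ω) j (ξ ω)) Pr := by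
  induction j generalizing ξ with
  | zero => exact (M.measurable_F.comp hξ).aemeasurable
  | succ j ih =>
    set h := M.H - (j + 1) with hh
    have hmem : h + 1 ∈ Finset.Icc 1 M.H := stage_mem_Icc hj
    have hmX : ∀ n, Measurable (X n (h + 1)) := fun n ↦ hX n _ (by omega)
    have hmX' : ∀ n, Measurable (X n h) := fun n ↦ hX n _ (by omega)
    have hv := fun n ↦ ih (by omega) (hmX n)
    set K : ℝ := (j + 1) * G with hK
    -- the positions and values that enter one step, with the values truncated
    let s : (Fin N → E × E) → Fin N → ℕ → E := fun z n t ↦ if t = h then (z n).1 else (z n).2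
    let c : ℝ → ℝ := fun v ↦ max (-K) (min v K)
    let g : StepData E N → A → ℝ := fun t a ↦ M.R h t.1 a +
      ∑ n, c (t.2.2 n) * weight q b (s t.2.1) h n t.1 a
    have hqm : ∀ {u : StepData E N × A → A} {y x : StepData E N × A → E},
        Measurable u → Measurable y → Measurable x →
        Measurable fun z ↦ q (h + 1) (u z) (y z) (x z) := fun hu hy hx ↦
      (hq.measurable _ hmem).comp (hu.prodMk (hy.prodMk hx))
    have hs1 : ∀ z : Fin N → E × E, ∀ n, s z n h = (z n).1 := fun z n ↦ if_pos rfl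
    have hs2 : ∀ z : Fin N → E × E, ∀ n, s z n (h + 1) = (z n).2 := fun z n ↦
      if_neg (Nat.succ_ne_self h)
    have hratio : ∀ n, Measurable fun z : StepData E N × A ↦
        q (h + 1) z.2 (z.1.2.1 n).2 z.1.1 /
          ∑ k ∈ Finset.univ.erase n, q (h + 1) (b h) (z.1.2.1 n).2 (z.1.2.1 k).1 := fun n ↦
      (hqm (by fun_prop) (by fun_prop) (by fun_prop)).div
        (Finset.measurable_sum _ fun k _ ↦ hqm (by fun_prop) (by fun_prop) (by fun_prop))
    have hg : Measurable (Function.uncurry g) := by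
      have hw : ∀ n, Measurable fun z : StepData E N × A ↦
          weight q b (s z.1.2.1) h n z.1.1 z.2 := by
        intro n
        simp only [weight, hs1, hs2]
        exact (hratio n).div (Finset.measurable_sum _ fun n _ ↦ hratio n)
      have hc : ∀ n, Measurable fun z : StepData E N × A ↦ c (z.1.2.2 n) := fun n ↦
        measurable_const.max (Measurable.min (by fun_prop) measurable_const)
      exact ((M.measurable_R h).comp (f := fun z : StepData E N × A ↦ (z.1.1, z.2))
        (by fun_prop)).add (Finset.measurable_sum _ fun n _ ↦ (hc n).mul (hw n))
    have hG : Pr = 0 ∨ 0 ≤ G := by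
      rcases isEmpty_or_nonempty Ω with hΩ | ⟨⟨ω⟩⟩
      · exact Or.inl (Measure.eq_zero_of_isEmpty Pr)
      · exact Or.inr ((abs_nonneg _).trans (hF (ξ ω)))
    rcases hG with rfl | hG
    · exact aemeasurable_zero_measure
    have hK0 : 0 ≤ K := by positivity
    have hbdd : ∀ t, BddAbove (range (g t)) := by
      refine fun t ↦ ⟨G + K, ?_⟩
      rintro _ ⟨a, rfl⟩
      refine add_le_add ((abs_le.1 (hR h (by omega) _ _)).2)
        ((abs_le.1 (abs_sum_mul_weight_le hq hmem _ _ _ hK0 fun n ↦ ?_)).2)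
      exact abs_le.2 ⟨le_max_left _ _, max_le (by linarith) (min_le_right _ _)⟩
    let τ : Ω → StepData E N := fun ω ↦
      (ξ ω, fun n ↦ (X n h ω, X n (h + 1) ω), fun n ↦ (hv n).mk _ ω)
    have hτ : Measurable τ := hξ.prodMk
      ((measurable_pi_iff.2 fun n ↦ (hmX' n).prodMk (hmX n)).prodMk
      (measurable_pi_iff.2 fun n ↦ (hv n).measurable_mk))
    refine ((aemeasurable_iSup_of_measurable hg hbdd (Pr.map τ)).comp_measurable hτ).congr ?_
    filter_upwards [ae_all_iff.2 fun n ↦ (hv n).ae_eq_mk] with ω hω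
    rw [meshStage]
    refine iSup_congr fun a ↦ ?_
    change M.R h (ξ ω) a + _ = M.R h (ξ ω) a + _
    congr 1
    refine Finset.sum_congr rfl fun n _ ↦ ?_
    have hb := abs_le.1 (abs_meshStage_le (b := b) hq hR hF (fun n t ↦ X n t ω)
      (by omega : j ≤ M.H) (X n (h + 1) ω))
    congr 1
    · change max (-K) (min ((hv n).mk _ ω) K) = _
      rw [← hω n, min_eq_left hb.2, max_eq_right hb.1]
    · simp only [weight, hs1, hs2, τ]
      rfl

/-- One step of the propagation of the error. -/
theorem abs_meshStage_succ_sub_le [Nonempty A] (hq : M.HasDensity q)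
    (hR : ∀ h < M.H, ∀ x a, |M.R h x a| ≤ G) (hF : ∀ x, |M.F x| ≤ G) {s : Fin N → ℕ → E}
    (hj : j + 1 ≤ M.H) {x : E} {f : E → ℝ} (hf : f =ᵐ[volume] M.optStage q j) {c e : ℝ}
    (hc0 : 0 ≤ c)
    (hc : ∀ n, |M.meshStage q b s j (s n (M.H - (j + 1) + 1)) - f (s n (M.H - (j + 1) + 1))| ≤ c)
    (he : ∀ a, |∑ n, f (s n (M.H - (j + 1) + 1)) * weight q b s (M.H - (j + 1)) n x a -
      ∫ y, f y * q (M.H - (j + 1) + 1) a y x| ≤ e) :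
    |M.meshStage q b s (j + 1) x - M.optStage q (j + 1) x| ≤ c + e := by
  have hG : 0 ≤ G := (abs_nonneg _).trans (hF x)
  rw [meshStage, optStage_succ]
  set u : A → ℝ := fun a ↦ M.R (M.H - (j + 1)) x a + ∑ n, M.meshStage q b s j
    (s n (M.H - (j + 1) + 1)) * weight q b s (M.H - (j + 1)) n x a with hu
  have hdiff : ∀ a, |u a - M.actionValue q j x a| ≤ c + e := by
    intro a
    have h1 : ∫ y, M.optStage q j y * q (M.H - (j + 1) + 1) a y x =
        ∫ y, f y * q (M.H - (j + 1) + 1) a y x :=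
      integral_congr_ae (hf.mono fun y hy ↦ by simp only [hy])
    have h2 := abs_sum_mul_weight_le (b := b) hq (stage_mem_Icc hj) s x a hc0 hc
    simp only [sub_mul, Finset.sum_sub_distrib] at h2
    have h3 := abs_add_le _ _ |>.trans (add_le_add h2 (he a))
    refine le_of_eq_of_le (congrArg _ ?_) h3
    simp only [hu, actionValue, h1]
    ring
  have hub : BddAbove (range u) := by
    refine ⟨G + (j + 1) * G, ?_⟩
    rintro _ ⟨a, rfl⟩
    exact add_le_add ((abs_le.1 (hR _ (by omega) _ _)).2)
      ((abs_le.1 (abs_sum_mul_weight_le hq (stage_mem_Icc hj) _ _ _ (by positivity) fun n ↦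
        abs_meshStage_le hq hR hF s (by omega) _)).2)
  rw [abs_sub_le_iff]
  constructor
  · rw [sub_le_iff_le_add]
    refine ciSup_le fun a ↦ ?_
    have h1 := le_ciSup (bddAbove_actionValue hq hR hF hj x) a
    linarith [(abs_le.1 (hdiff a)).2]
  · rw [sub_le_iff_le_add]
    refine ciSup_le fun a ↦ ?_
    have h1 := le_ciSup hub a
    linarith [(abs_le.1 (hdiff a)).1]

/-- The transitions of the mesh from time `h` to time `h + 1` are independent and identically
distributed. -/
theorem IsMesh.map_pairs {x : E} {Ω : Type*} [MeasurableSpace Ω] {Pr : Measure Ω}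
    [IsProbabilityMeasure Pr] {X : Fin N → ℕ → Ω → E} (hX : M.IsMesh b x Pr X) (hh : h < M.H) :
    Pr.map (fun ω n ↦ (X n h ω, X n (h + 1) ω)) = Measure.pi fun _ : Fin N ↦
      M.stateLaw (Policy.const b) x h ⊗ₘ (M.P (h + 1)).comap (fun s ↦ (s, b h)) (by fun_prop) := by
  let ψ : (Fin (M.H + 1) → E) → E × E := fun w ↦ (w ⟨h, by omega⟩, w ⟨h + 1, by omega⟩)
  have hψ : Measurable ψ := by fun_prop
  have hpath : ∀ n, Measurable fun ω (t : Fin (M.H + 1)) ↦ X n t ω := fun n ↦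
    measurable_pi_iff.2 fun t ↦ hX.measurable n t (by omega)
  have hind := hX.indep.comp (fun _ ↦ ψ) fun _ ↦ hψ
  refine ((iIndepFun_iff_map_fun_eq_pi_map fun n ↦
    (hψ.comp (hpath n)).aemeasurable).1 hind).trans ?_
  congr 1
  ext1 n
  rw [← Measure.map_map hψ (hpath n), hX.law n, Measure.map_map hψ (by fun_prop)]
  exact M.map_state_state_succ_const x b h

end Mesh

end MDP

/-! ### The statistical error -/

namespace MDP

section StatisticalError

variable {E A : Type*} [MeasureSpace E] [MeasurableSpace A] {M : MDP E A}
  {q : ℕ → A → E → E → ℝ} {b : ℕ → A} {G lo hi ℓ : ℝ} {N : ℕ} {x₀ : E} {Ω : Type*}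
  [MeasurableSpace Ω] {Pr : Measure Ω} [IsProbabilityMeasure Pr] {X : Fin N → ℕ → Ω → E}
  {Y : Type*} [PseudoMetricSpace Y] {Z : Set Y}

/-- The densities of `M`, indexed by the points of a subset `Z` of a metric space by means of
`φ : Z → E × A`, satisfy at time `h` the assumptions on one step of the mesh. -/
abbrev StepFamily (M : MDP E A) (q : ℕ → A → E → E → ℝ) (b : ℕ → A) (φ : Z → E × A)
    (lo hi ℓ : ℝ) (h : ℕ) : Prop :=
  DensityFamily volume ((M.P (h + 1)).comap (fun s ↦ (s, b h)) (by fun_prop))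
    (fun x y ↦ q (h + 1) (b h) y x) (fun θ y ↦ q (h + 1) (φ θ).2 y (φ θ).1) lo hi ℓ

/-- The error of one step of the mesh, uniformly over all states and actions, has a majorant whose
expectation is controlled by the Dudley integral. -/
theorem IsMesh.exists_majorant_step [IsFiniteMeasure (volume : Measure E)] [Nonempty Z]
    [TopologicalSpace.SeparableSpace Z] (hX : M.IsMesh b x₀ Pr X) {h : ℕ} (hh : h < M.H)
    {φ : Z → E × A} (hφ : Function.Surjective φ) (hfam : StepFamily M q b φ lo hi ℓ h)
    (hN : 2 ≤ N) (hZ : TotallyBounded Z) (hℓ : 0 < ℓ) {B : ℝ} {f : E → ℝ} (hf : Measurable f)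
    (hfB : ∀ y, |f y| ≤ B) :
    ∃ m : Ω → ℝ≥0∞, Measurable m ∧
      (∀ᵐ ω ∂Pr, ∀ x a, ENNReal.ofReal
        |∑ n, f (X n (h + 1) ω) * weight q b (fun n t ↦ X n t ω) h n x a -
          ∫ y, f y * q (h + 1) a y x| ≤ m ω) ∧
      ∫⁻ ω, m ω ∂Pr ≤ 160 * ENNReal.ofReal (B * ℓ / (lo * √N)) * dudleyIntegral Z +
          ENNReal.ofReal (6 * (B * hi / (lo * √N))) +
          ENNReal.ofReal (2 * (B * hi ^ 2 / ((N - 1) * lo ^ 2))) := by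
  have hB : 0 ≤ B := (abs_nonneg _).trans (hfB x₀)
  rcases hB.eq_or_lt with rfl | hB
  · have hf0 : ∀ y, f y = 0 := fun y ↦ abs_eq_zero.1 (le_antisymm (hfB y) (abs_nonneg _))
    exact ⟨0, measurable_zero, ae_of_all _ fun ω x a ↦ by simp [hf0], by simp⟩
  have hpair : Measurable fun ω n ↦ (X n h ω, X n (h + 1) ω) := measurable_pi_iff.2 fun n ↦
    (hX.measurable n h (by omega)).prodMk (hX.measurable n (h + 1) (by omega))
  obtain ⟨m, hm, hmz, hmi⟩ := hfam.exists_majorant_selfNormalized hN hZ hℓ hB hf hfB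
    (M.stateLaw (Policy.const b) x₀ h)
  rw [← hX.map_pairs hh] at hmz hmi
  refine ⟨fun ω ↦ m fun n ↦ (X n h ω, X n (h + 1) ω), hm.comp hpair, ?_, ?_⟩
  · filter_upwards [ae_of_ae_map hpair.aemeasurable hmz] with ω hω x a
    obtain ⟨θ, hθ⟩ := hφ (x, a)
    have h1 := hω θ
    simp only [hθ] at h1
    exact h1
  · rwa [lintegral_map hm hpair] at hmi

/-- The expected distance between the output of the algorithm and the optimal value of the process
that is simulated. -/
theorem IsMesh.lintegral_abs_meshValue_sub_le [StandardBorelSpace E] [StandardBorelSpace A]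
    [Nonempty A] [IsFiniteMeasure (volume : Measure E)] [Nonempty Z]
    [TopologicalSpace.SeparableSpace Z] (hX : M.IsMesh b x₀ Pr X) (hq : M.HasDensity q)
    (hR : ∀ h < M.H, ∀ x a, |M.R h x a| ≤ G) (hF : ∀ x, |M.F x| ≤ G) {φ : Z → E × A}
    (hφ : Function.Surjective φ) (hfam : ∀ h < M.H, StepFamily M q b φ lo hi ℓ h)
    (hN : 2 ≤ N) (hZ : TotallyBounded Z) (hℓ : 0 < ℓ) :
    ∫⁻ ω, ENNReal.ofReal |M.meshValue q b (fun n t ↦ X n t ω) x₀ - M.optStage q M.H x₀| ∂Pr ≤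
      M.H * (160 * ENNReal.ofReal (M.H * G * ℓ / (lo * √N)) * dudleyIntegral Z +
          ENNReal.ofReal (6 * (M.H * G * hi / (lo * √N))) +
          ENNReal.ofReal (2 * (M.H * G * hi ^ 2 / ((N - 1) * lo ^ 2)))) := by
  have hG : 0 ≤ G := (abs_nonneg _).trans (hF x₀)
  set B : ℝ := M.H * G with hB
  have hopt : ∀ j < M.H, ∀ x, |M.optStage q j x| ≤ B := fun j hj x ↦
    (abs_optStage_le hq hR hF hj.le x).trans
      (mul_le_mul_of_nonneg_right (by exact_mod_cast hj) hG)
  have hstep : ∀ j < M.H, ∃ f : E → ℝ, ∃ m : Ω → ℝ≥0∞, f =ᵐ[volume] M.optStage q j ∧ Measurable m ∧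
      (∀ᵐ ω ∂Pr, ∀ x a, ENNReal.ofReal
        |∑ n, f (X n (M.H - (j + 1) + 1) ω) *
            weight q b (fun n t ↦ X n t ω) (M.H - (j + 1)) n x a -
          ∫ y, f y * q (M.H - (j + 1) + 1) a y x| ≤ m ω) ∧
      ∫⁻ ω, m ω ∂Pr ≤ 160 * ENNReal.ofReal (B * ℓ / (lo * √N)) * dudleyIntegral Z +
          ENNReal.ofReal (6 * (B * hi / (lo * √N))) +
          ENNReal.ofReal (2 * (B * hi ^ 2 / ((N - 1) * lo ^ 2))) := by
    intro j hj
    have hv := aemeasurable_optStage hq hR hF hj.le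
    have hB0 : 0 ≤ B := by positivity
    obtain ⟨f, hf, hfB, hfv⟩ : ∃ f : E → ℝ, Measurable f ∧ (∀ y, |f y| ≤ B) ∧
        f =ᵐ[volume] M.optStage q j := by
      refine ⟨fun y ↦ max (-B) (min (hv.mk _ y) B),
        measurable_const.max (hv.measurable_mk.min measurable_const),
        fun y ↦ abs_le.2 ⟨le_max_left _ _, max_le (by linarith) (min_le_right _ _)⟩, ?_⟩
      filter_upwards [hv.ae_eq_mk] with y hy
      have h1 := abs_le.1 (hopt j hj y)
      rw [← hy, min_eq_left h1.2, max_eq_right h1.1]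
    obtain ⟨m, hm, hmle, hmint⟩ := hX.exists_majorant_step (by omega : M.H - (j + 1) < M.H) hφ
      (hfam _ (by omega)) hN hZ hℓ hf hfB
    exact ⟨f, m, hfv, hm, hmle, hmint⟩
  choose! f m hf hm hmle hmint using hstep
  -- the errors of the steps add up, in all states simultaneously
  have hrec : ∀ j ≤ M.H, ∀ᵐ ω ∂Pr, ∀ x, ENNReal.ofReal
      |M.meshStage q b (fun n t ↦ X n t ω) j x - M.optStage q j x| ≤
        ∑ i ∈ Finset.range j, m i ω := by
    intro j hj
    induction j with
    | zero => exact ae_of_all _ fun ω x ↦ by simp [meshStage, optStage]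
    | succ j ih =>
      have hpt : ∀ n, ∀ᵐ ω ∂Pr, f j (X n (M.H - (j + 1) + 1) ω) =
          M.optStage q j (X n (M.H - (j + 1) + 1) ω) := by
        intro n
        have hlt : M.H - (j + 1) < M.H := by omega
        have h1 := hX.measurable n (M.H - (j + 1) + 1) (by omega)
        have h2 : Pr.map (X n (M.H - (j + 1) + 1)) =
            M.stateLaw (Policy.const b) x₀ (M.H - (j + 1) + 1) := by
          have h3 : Measurable fun ω (t : Fin (M.H + 1)) ↦ X n t ω :=
            measurable_pi_iff.2 fun t ↦ hX.measurable n t (by omega)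
          have h4 := congrArg (Measure.map fun w : Fin (M.H + 1) → E ↦
            w ⟨M.H - (j + 1) + 1, by omega⟩) (hX.law n)
          rw [Measure.map_map (by fun_prop) h3, Measure.map_map (by fun_prop) (by fun_prop)] at h4
          exact h4
        refine ae_of_ae_map (p := fun y ↦ f j y = M.optStage q j y) h1.aemeasurable ?_
        rw [h2]
        refine Measure.AbsolutelyContinuous.ae_le ?_ (hf j (by omega))
        rw [stateLaw_succ]
        refine Measure.AbsolutelyContinuous.mk fun s hs hs0 ↦ ?_
        rw [Measure.bind_apply hs (Kernel.aemeasurable _)]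
        refine (lintegral_congr fun z ↦ ?_).trans lintegral_zero
        rw [hq.kernel_apply (stage_mem_Icc hj) z.2 z.1 hs]
        exact setLIntegral_measure_zero _ _ hs0
      filter_upwards [ih (by omega), hmle j (by omega), ae_all_iff.2 hpt] with ω h1 h2 h3 x
      rw [Finset.sum_range_succ]
      by_cases htop : ∑ i ∈ Finset.range j, m i ω = ⊤ ∨ m j ω = ⊤
      · rcases htop with htop | htop <;> simp [htop]
      push Not at htop
      rw [← ENNReal.ofReal_toReal htop.1] at h1 ⊢
      rw [← ENNReal.ofReal_toReal htop.2] at h2 ⊢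
      rw [← ENNReal.ofReal_add ENNReal.toReal_nonneg ENNReal.toReal_nonneg]
      refine ENNReal.ofReal_le_ofReal ?_
      refine abs_meshStage_succ_sub_le hq hR hF hj (hf j (by omega)) ENNReal.toReal_nonneg
        (fun n ↦ ?_) fun a ↦ ?_
      · rw [h3 n]
        exact (ENNReal.ofReal_le_ofReal_iff ENNReal.toReal_nonneg).1 (h1 _)
      · exact (ENNReal.ofReal_le_ofReal_iff ENNReal.toReal_nonneg).1 (h2 x a)
  calc ∫⁻ ω, ENNReal.ofReal |M.meshValue q b (fun n t ↦ X n t ω) x₀ - M.optStage q M.H x₀| ∂Pr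
      ≤ ∫⁻ ω, ∑ i ∈ Finset.range M.H, m i ω ∂Pr :=
        lintegral_mono_ae ((hrec M.H le_rfl).mono fun ω hω ↦ hω x₀)
    _ = ∑ i ∈ Finset.range M.H, ∫⁻ ω, m i ω ∂Pr :=
        lintegral_finsetSum' _ fun i hi ↦ (hm i (Finset.mem_range.1 hi)).aemeasurable
    _ ≤ ∑ i ∈ Finset.range M.H, _ :=
        Finset.sum_le_sum fun i hi ↦ hmint i (Finset.mem_range.1 hi)
    _ = _ := by rw [Finset.sum_const, Finset.card_range, nsmul_eq_mul]

end StatisticalError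

end MDP

/-! ### The total error -/

/-- The bounds of one step, for reflected densities between `lo` and `hi`, in terms of the local
bounds of the original densities. The summand `J` leaves room for the terms that the estimate does
not need. -/
theorem step_bound_le {H N : ℕ} {G δ Λ L : ℝ≥0} {lo hi : ℝ} (hδ : 0 < δ) (hN : 2 ≤ N)
    (hlo : δ ≤ lo) (hhi0 : 0 ≤ hi) (hhi : hi ≤ 3 * (Λ / δ) * lo) (I J : ℝ≥0∞) :
    H * (160 * ENNReal.ofReal (H * G * (2 * L) / (lo * √N)) * I +
          ENNReal.ofReal (6 * (H * G * hi / (lo * √N))) +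
          ENNReal.ofReal (2 * (H * G * hi ^ 2 / ((N - 1) * lo ^ 2)))) ≤
      320 * ((H ^ 2 * G / NNReal.sqrt N : ℝ≥0) * ((L * I + J + Λ) / δ +
        (Λ : ℝ≥0∞) ^ 2 / (δ : ℝ≥0∞) ^ 2)) := by
  have hδ' : (0 : ℝ) < δ := hδ
  have hlo0 : 0 < lo := hδ'.trans_le hlo
  have hN' : (2 : ℝ) ≤ N := by exact_mod_cast hN
  have hs0 : 0 < √(N : ℝ) := Real.sqrt_pos.2 (by linarith)
  have hs1 : 1 ≤ √(N : ℝ) := Real.one_le_sqrt.2 (by linarith)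
  have hsq : √(N : ℝ) * √N = N := Real.mul_self_sqrt (by positivity)
  have hr : hi / lo ≤ 3 * (Λ / δ) := (div_le_iff₀ hlo0).2 hhi
  have hr0 : 0 ≤ hi / lo := div_nonneg hhi0 hlo0.le
  set c : ℝ≥0 := H * G / NNReal.sqrt N with hc
  have hcr : (c : ℝ) = H * G / √N := by simp [hc]
  have e1 : ENNReal.ofReal (H * G * (2 * L) / (lo * √N)) ≤ ((2 * c * (L / δ) : ℝ≥0) : ℝ≥0∞) := by
    refine ENNReal.ofReal_le_of_le_toReal ?_
    rw [ENNReal.coe_toReal]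
    push_cast
    rw [hcr]
    calc H * G * (2 * L) / (lo * √N) ≤ H * G * (2 * L) / (δ * √N) := by gcongr
      _ = 2 * (H * G / √N) * (L / δ) := by field_simp
  have e2 : ENNReal.ofReal (6 * (H * G * hi / (lo * √N))) ≤
      ((18 * c * (Λ / δ) : ℝ≥0) : ℝ≥0∞) := by
    refine ENNReal.ofReal_le_of_le_toReal ?_
    rw [ENNReal.coe_toReal]
    push_cast
    rw [hcr]
    calc 6 * (H * G * hi / (lo * √N)) = 6 * (H * G / √N) * (hi / lo) := by field_simp
      _ ≤ 6 * (H * G / √N) * (3 * (Λ / δ)) := by gcongr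
      _ = 18 * (H * G / √N) * (Λ / δ) := by ring
  have e3 : ENNReal.ofReal (2 * (H * G * hi ^ 2 / ((N - 1) * lo ^ 2))) ≤
      ((36 * c * (Λ ^ 2 / δ ^ 2) : ℝ≥0) : ℝ≥0∞) := by
    refine ENNReal.ofReal_le_of_le_toReal ?_
    rw [ENNReal.coe_toReal]
    push_cast
    rw [hcr]
    have hN1 : 0 < (N : ℝ) - 1 := by linarith
    have h1 : 1 / ((N : ℝ) - 1) ≤ 2 / √N := by
      rw [div_le_div_iff₀ hN1 hs0]
      nlinarith
    calc 2 * (H * G * hi ^ 2 / ((N - 1) * lo ^ 2))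
        = 2 * (H * G) * (hi / lo) ^ 2 * (1 / (N - 1)) := by field_simp
      _ ≤ 2 * (H * G) * (3 * (Λ / δ)) ^ 2 * (2 / √N) := by gcongr
      _ = 36 * (H * G / √N) * (Λ ^ 2 / δ ^ 2) := by field_simp; ring
  have hcH : ((H ^ 2 * G / NNReal.sqrt N : ℝ≥0) : ℝ≥0∞) = H * c := by
    rw [show (H ^ 2 * G / NNReal.sqrt N : ℝ≥0) = H * c by rw [hc]; ring]
    push_cast
    rfl
  rw [hcH]
  have hδ2 : δ ^ 2 ≠ 0 := pow_ne_zero 2 hδ.ne'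
  calc _ ≤ H * (160 * ((2 * c * (L / δ) : ℝ≥0) : ℝ≥0∞) * I +
        ((18 * c * (Λ / δ) : ℝ≥0) : ℝ≥0∞) + ((36 * c * (Λ ^ 2 / δ ^ 2) : ℝ≥0) : ℝ≥0∞)) := by
        gcongr
    _ = H * c * (320 * (L * I / δ) + 0 * (J / δ) + 18 * (Λ / δ) + 36 * (Λ ^ 2 / δ ^ 2)) := by
        push_cast [ENNReal.coe_div hδ.ne', ENNReal.coe_div hδ2]
        simp only [div_eq_mul_inv]
        ring
    _ ≤ H * c * (320 * (L * I / δ) + 320 * (J / δ) + 320 * (Λ / δ) + 320 * (Λ ^ 2 / δ ^ 2)) := by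
        gcongr <;> norm_num
    _ = _ := by
        simp only [div_eq_mul_inv]
        ring

section Reflected

variable {d : ℕ} {S : Set (EuclideanSpace ℝ (Fin d))} {A : Type*} [PseudoMetricSpace A]
  [MeasurableSpace A] {M : MDP S A} {p : ℕ → A → S → S → ℝ} {D : Set S}
  {G δ Λ L : ℝ≥0}

/-- The reflected densities, indexed by `D × A`. The Lipschitz constant doubles, because the metric
is the maximum of the two distances and not their sum. -/
theorem stepFamily_reflect (hp : M.HasDensity p) (hS : MeasurableSet S) (hD : IsCompact D)
    (h0 : 0 < volume D) (hloc : LocalDensityBounds p M.H D δ Λ L) {lo hi : ℝ} (hlo : 0 < lo)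
    (hmem : ∀ h ∈ Finset.Icc 1 M.H, ∀ a, ∀ y x : D, reflectDensity D p h a y x ∈ Icc lo hi)
    (b : ℕ → A) {h : ℕ} (hh : h < M.H) :
    (M.reflect hS hD h0).StepFamily (reflectDensity D p) b
      (fun θ : (D ×ˢ univ : Set (S × A)) ↦ (⟨θ.1.1, θ.2.1⟩, θ.1.2)) lo hi (2 * L) h := by
  have hq : (M.reflect hS hD h0).HasDensity (reflectDensity D p) := hp.reflect hS hD h0
  have hh' : h + 1 ∈ Finset.Icc 1 M.H := by rw [Finset.mem_Icc]; omega
  refine ⟨hlo, ?_, fun x y ↦ hmem _ hh' _ _ _, fun x ↦ ?_, fun θ ↦ ?_, fun θ y ↦ hmem _ hh' _ _ _,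
    fun θ ↦ ?_, ?_⟩
  · exact (hq.measurable _ hh').comp (f := fun z : D × D ↦ (b h, z.2, z.1)) (by fun_prop)
  · rw [Kernel.comap_apply]
    exact hq.eq_withDensity _ hh' x (b h)
  · exact hq.measurable_density hh' _ _
  · exact hq.integral_eq_one hh' _ _
  · filter_upwards [ae_reflectDensity_sub_le hp hS hD hloc hh'] with y hy θ θ'
    refine (hy _ _ _ _).trans ?_
    have h1 : dist θ.1.1 θ'.1.1 ≤ dist θ θ' := le_max_left _ _
    have h2 : dist θ.1.2 θ'.1.2 ≤ dist θ θ' := le_max_right _ _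
    rw [show (2 * L : ℝ) * dist θ θ' = L * (dist θ θ' + dist θ θ') by ring]
    exact mul_le_mul_of_nonneg_left (add_le_add h1 h2) L.2

end Reflected

end StochasticMesh

open StochasticMesh in
theorem theorem4p2 :
    ∃ (C : ℝ≥0) (N₀ : ℕ),
      ∀ {d : ℕ} {S : Set (EuclideanSpace ℝ (Fin d))} (hS : MeasurableSet S)
        {A : Type*} [MetricSpace A] [CompactSpace A] [MeasurableSpace A] [BorelSpace A]
        (M : MDP S A) (p : ℕ → A → S → S → ℝ) (_ : M.HasDensity p)
        (G : ℝ≥0) (_ : ∀ h < M.H, ∀ x a, |M.R h x a| ≤ G) (_ : ∀ x, |M.F x| ≤ G)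
        {D : Set S} (hD : IsCompact D) (h0 : 0 < volume D)
        (δ Λ L : ℝ≥0) (_ : LocalDensityBounds p M.H D δ Λ L)
        (b : ℕ → A) (x₀ : D)
        {Ω : Type*} [MeasurableSpace Ω] (Pr : Measure Ω) [IsProbabilityMeasure Pr]
        (N : ℕ) (_ : N₀ < N) (X : Fin N → ℕ → Ω → D)
        (_ : (M.reflect hS hD h0).IsMesh b x₀ Pr X),
        let err : Ω → ℝ := fun ω ↦
          |(M.reflect hS hD h0).meshValue (reflectDensity D p) b (fun n t ↦ X n t ω) x₀
            - M.optValue x₀|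
        Integrable err Pr ∧
        ENNReal.ofReal (∫ ω, err ω ∂Pr) ≤
          C * ((M.H ^ 2 * G / NNReal.sqrt N : ℝ≥0) *
              ((L * dudleyIntegral (D ×ˢ (univ : Set A))
                  + L * Metric.ediam D * Metric.ediam (univ : Set A) + Λ) / δ
                + (Λ : ℝ≥0∞) ^ 2 / (δ : ℝ≥0∞) ^ 2)
            + M.H * G * ∑ l ∈ Finset.range (M.H + 1),
                ⨆ π : Policy S A, M.pathLaw π x₀ {w | (w l).1 ∉ D}) := by
  -- the leave-one-out weights make sense for at least two chains
  refine ⟨320, 1, ?_⟩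
  intro d S hS A _ _ _ _ M p hp G hR hF D hD h0 δ Λ L hloc b x₀ Ω _ Pr _ N hN X hX err
  have hDm : MeasurableSet D := hD.isClosed.measurableSet
  have := hS.standardBorel
  have := hDm.standardBorel
  have := isFiniteMeasure_volume_subtype hS hD
  have hA : Nonempty A := ⟨b 0⟩
  set M' := M.reflect hS hD h0 with hM'
  set q := reflectDensity D p with hq_def
  have hq : M'.HasDensity q := hp.reflect hS hD h0
  have hR' : ∀ h < M'.H, ∀ x a, |M'.R h x a| ≤ G := fun h hh x a ↦ hR h hh x a
  have hF' : ∀ x, |M'.F x| ≤ G := fun x ↦ hF x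
  have hmeas : AEMeasurable err Pr :=
    ((MDP.aemeasurable_meshStage hq hR' hF' hX.measurable le_rfl
      (measurable_const (a := x₀))).sub_const _).norm
  have hint : Integrable err Pr := by
    refine Integrable.of_bound hmeas.aestronglyMeasurable ((M.H + 1) * G + |M.optValue x₀|)
      (ae_of_all _ fun ω ↦ ?_)
    rw [Real.norm_eq_abs, abs_abs]
    exact (abs_sub _ _).trans (add_le_add_left
      (MDP.abs_meshStage_le hq hR' hF' (fun n t ↦ X n t ω) le_rfl x₀) _)
  refine ⟨hint, ?_⟩
  rw [ofReal_integral_eq_lintegral_ofReal hint (ae_of_all _ fun ω ↦ abs_nonneg _)]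
  -- exit probabilities
  set β : ℕ → ℝ≥0∞ := fun l ↦ ⨆ π : Policy S A, M.pathLaw π x₀ {w | (w l).1 ∉ D} with hβ
  have hfst : ∀ l, Measurable fun w : ℕ → S × A ↦ (w l).1 := fun l ↦
    measurable_fst.comp (measurable_pi_apply l)
  have hstate : ∀ (π : Policy S A) l, M.stateLaw π x₀ l Dᶜ = M.pathLaw π x₀ {w | (w l).1 ∉ D} :=
    fun π l ↦ Measure.map_apply (hfst l) hDm.compl
  have hβ1 : ∀ l, β l ≠ ⊤ := fun l ↦
    ((iSup_le fun π ↦ prob_le_one).trans_lt ENNReal.one_lt_top).ne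
  have hβle : ∀ (π : Policy S A) l, (M.stateLaw π x₀ l).real Dᶜ ≤ (β l).toReal := fun π l ↦
    ENNReal.toReal_mono (hβ1 l) ((hstate π l).le.trans
      (le_iSup (fun π : Policy S A ↦ M.pathLaw π x₀ {w | (w l).1 ∉ D}) π))
  have hexit : ENNReal.ofReal |M'.optStage q M.H x₀ - M.optValue x₀| ≤
      320 * (M.H * G * ∑ l ∈ Finset.range (M.H + 1), β l) := by
    have hcmp := abs_optStage_sub_optValue_le hp hS hD h0 hR hF x₀ hβle
    rcases Nat.eq_zero_or_pos M.H with hH | hH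
    · -- without any step there is no error, as the chain starts in `D`
      have hβ0 : β 0 = 0 := by
        rw [hβ, ENNReal.iSup_eq_zero]
        intro π
        rw [← hstate, MDP.stateLaw_zero, Measure.dirac_apply' _ hDm.compl]
        simp
      rw [hH, zero_add, Finset.sum_range_one, hβ0, ENNReal.toReal_zero, mul_zero] at hcmp
      rw [← hH] at hcmp
      rw [ENNReal.ofReal_eq_zero.2 hcmp]
      exact zero_le
    · refine (ENNReal.ofReal_le_ofReal hcmp).trans (ENNReal.ofReal_le_of_le_toReal ?_)
      have hH' : (1 : ℝ) ≤ M.H := by exact_mod_cast hH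
      simp only [ENNReal.toReal_mul, ENNReal.toReal_sum fun l _ ↦ hβ1 l, ENNReal.toReal_natCast,
        ENNReal.coe_toReal, ENNReal.toReal_ofNat]
      rw [← mul_assoc, ← mul_assoc]
      gcongr
      linarith
  have hstat : ∫⁻ ω, ENNReal.ofReal
      |M'.meshValue q b (fun n t ↦ X n t ω) x₀ - M'.optStage q M.H x₀| ∂Pr ≤
      320 * ((M.H ^ 2 * G / NNReal.sqrt N : ℝ≥0) *
        ((L * dudleyIntegral (D ×ˢ (univ : Set A))
          + L * Metric.ediam D * Metric.ediam (univ : Set A) + Λ) / δ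
          + (Λ : ℝ≥0∞) ^ 2 / (δ : ℝ≥0∞) ^ 2)) := by
    rcases Nat.eq_zero_or_pos M.H with hH | hH
    · have h1 : ∀ ω, M'.meshValue q b (fun n t ↦ X n t ω) x₀ = M'.optStage q M.H x₀ := by
        intro ω
        have hH' : M'.H = 0 := hH
        rw [MDP.meshValue, hH', hH]
        rfl
      simp [h1]
    · have hb := hloc.bounds 1 (Finset.mem_Icc.2 ⟨le_rfl, hH⟩) (b 0) x₀ x₀.2 x₀ x₀.2
      have hδΛ : δ ≤ Λ := by exact_mod_cast hb.1.trans hb.2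
      obtain ⟨lo, hi, hlo, hhi, hmem⟩ := exists_reflectDensity_mem_Icc hp hS hD h0 hloc hδΛ
      have hlo0 : 0 < lo := lt_of_lt_of_le hloc.δ_pos hlo
      have hm := hmem 1 (Finset.mem_Icc.2 ⟨le_rfl, hH⟩) (b 0) x₀ x₀
      have hcomp : IsCompact (D ×ˢ (univ : Set A)) := hD.prod isCompact_univ
      have hne : Nonempty (D ×ˢ univ : Set (S × A)) := ⟨⟨(x₀, b 0), x₀.2, mem_univ _⟩⟩
      refine (hX.lintegral_abs_meshValue_sub_le hq hR' hF' (fun z ↦ ?_) (fun h hh ↦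
        stepFamily_reflect hp hS hD h0 hloc hlo0 hmem b hh) hN hcomp.totallyBounded
          (mul_pos two_pos hloc.L_pos)).trans
        (step_bound_le hloc.δ_pos hN hlo (hlo0.le.trans (hm.1.trans hm.2)) hhi _ _)
      exact ⟨⟨(z.1, z.2), z.1.2, mem_univ _⟩, rfl⟩
  calc ∫⁻ ω, ENNReal.ofReal (err ω) ∂Pr
      ≤ ∫⁻ ω, (ENNReal.ofReal |M'.meshValue q b (fun n t ↦ X n t ω) x₀ - M'.optStage q M.H x₀| +
          ENNReal.ofReal |M'.optStage q M.H x₀ - M.optValue x₀|) ∂Pr := by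
        refine lintegral_mono fun ω ↦ ?_
        rw [← ENNReal.ofReal_add (abs_nonneg _) (abs_nonneg _)]
        exact ENNReal.ofReal_le_ofReal (abs_sub_le _ _ _)
    _ = ∫⁻ ω, ENNReal.ofReal |M'.meshValue q b (fun n t ↦ X n t ω) x₀ - M'.optStage q M.H x₀| ∂Pr +
          ENNReal.ofReal |M'.optStage q M.H x₀ - M.optValue x₀| := by
        rw [lintegral_add_right _ measurable_const, lintegral_const, measure_univ, mul_one]
    _ ≤ _ := by
        rw [mul_add]
        exact add_le_add hstat hexit
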